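/- Let $0<q<1$ and let $r,c\in\mathbb R$ with $r>0$ and $r^*:=r-c>0$. Put $p=q^{2r}$, $p^*=q^{2r^*}$, $z=q^{2u}$, $[n]_q=\frac{q^n-q^{-n}}{q-q^{-1}}$, $\delta(z)=\sum_{m\in\mathbb Z}z^m$, $(a;p)_\infty=\prod_{n\ge0}(1-ap^n)$, $(a;p,t)_\infty=\prod_{m,n\ge0}(1-ap^mt^n)$, $\Theta_p(z)=(z;p)_\infty(p/z;p)_\infty(p;p)_\infty$, $[u]=q^{u^2/r-u}\Theta_p(q^{2u})$, $\{a\}=(a;p,q^6)_\infty$; a star means that $r$ is replaced by $r^*$. **Quantum group.** $U_q(A_2^{(2)})$ at level $c$ is the $\mathbb C$-algebra generated by $x^\pm_m$ $(m\in\mathbb Z)$, $a_m$ $(m\neq0)$, $h$, $q^{\pm h/2}$, $q^{\pm d}$ such that, with $x^\pm(z)=\sum_m x^\pm_mz^{-m}$, $\psi(q^{c/2}z)=q^{h/2}\exp((q-q^{-1})\sum_{m>0}a_mz^{-m})$, $\varphi(q^{-c/2}z)=q^{-h/2}\exp(-(q-q^{-1})\sum_{m>0}a_{-m}z^m)$: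 $h,q^{\pm h/2},q^{\pm d}$ commute, $[h,a_m]=0$, $[h,x^\pm_m]=\pm2x^\pm_m$, $q^{h/2}a_m=a_mq^{h/2}$, $q^{h/2}x^\pm_m=q^{\pm1}x^\pm_mq^{h/2}$, $q^da_mq^{-d}=q^ma_m$, $q^dx^\pm_mq^{-d}=q^mx^\pm_m$, $$[a_m,a_n]=\delta_{m+n,0}\tfrac{[2m]_q-[m]_q}{m}q^{-c|m|}[cm]_q,\quad [a_m,x^+(z)]=\tfrac{[2m]_q-[m]_q}{m}q^{-c|m|}z^mx^+(z),\quad [a_m,x^-(z)]=-\tfrac{[2m]_q-[m]_q}{m}z^mx^-(z),$$ $$(z_1-q^{\pm2}z_2)(z_1-q^{\mp1}z_2)x^\pm(z_1)x^\pm(z_2)=-(q^{\pm2}z_1-z_2)(q^{\mp1}z_1-z_2)x^\pm(z_2)x^\pm(z_1),$$ $$x^+(z_1)x^-(z_2)+x^-(z_2)x^+(z_1)=-\tfrac1{q-q^{-1}}\big(\psi(q^{c/2}z_2)\delta(q^{-c}z_1/z_2)-\varphi(q^{-c/2}z_2)\delta(q^{c}z_1/z_2)\big),$$ $$\sum_{\sigma\in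 S_3}\big(q^{\mp3/2}z_{\sigma(1)}+(q^{\mp1/2}-q^{\pm1/2})z_{\sigma(2)}-q^{\pm3/2}z_{\sigma(3)}\big)x^\pm(z_{\sigma(1)})x^\pm(z_{\sigma(2)})x^\pm(z_{\sigma(3)})=0.$$ **Heisenberg algebra.** $\mathbb C\{\mathcal H\}$ is given by $P,Q,\bar\alpha$ with $[P,Q]=1$, $[Q,\bar\alpha]=\pi i$, $[P,\bar\alpha]=0$, used through $P,e^{\pm Q},e^{\pm\bar\alpha}$: $[P,e^Q]=e^Q$, $e^Qe^{\bar\alpha}=e^{\pi i}e^{\bar\alpha}e^Q$, $[P,e^{\bar\alpha}]=0$. **Modules.** Let $M$ be any module over $U_q(A_2^{(2)})\otimes\mathbb C\{\mathcal H\}$ which is restricted (for each $v\in M$: $x^\pm_mv=0=a_mv$ for all large $m$, and every $a_m$ with $m>0$ acts nilpotently on $v$), which is spanned by joint eigenvectors of $P$ and $h$, and on which $q^{h/2}$ acts by $q^{\mu/2}$ on the $\mu$-eigenspace of $h$. **Currents.** With $u^+(z)=\exp\big(\sum_{m>0}\frac{a_{-m}}{[r^*m]_q}q^{rm}z^m\big)$,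 $u^-(z)=\exp\big(-\sum_{m>0}\frac{a_m}{[rm]_q}q^{rm}z^{-m}\big)$, $e(z)=u^+(z)x^+(z)$, $f(z)=x^-(z)u^-(z)$, $\alpha_m=a_m$ $(m>0)$, $\alpha_m=\frac{[rm]_q}{[r^*m]_q}q^{c|m|}a_m$ $(m<0)$, $k(z)=\,:\!\exp\big(-\sum_{m\ne0}\frac{[m]_q}{[rm]_q([2m]_q-[m]_q)}\alpha_mz^{-m}\big)\!:$ and $\psi(z,p)=\exp\big(\sum_{m>0}\frac{q^{cm}}{[r^*m]_q}a_{-m}z^m\big)\exp\big(-\sum_{m>0}\frac{1}{[rm]_q}a_mz^{-m}\big)$, the formulas $$E(z)=e(z)e^{\bar\alpha}e^{-Q}z^{-P/r^*},\qquad F(z)=f(z)e^{-\bar\alpha}z^{P/r+h/2r},\qquad K(z)=k(z)e^{-Q}z^{(1/r-1/r^*)P+h/2r}$$ (and $H(z)=\psi(z,p)e^{-Q}z^{(1/r-1/r^*)P+h/2r}$) define currents of linear operators on $M$. **Claim.** These formulas give a realization of the elliptic algebra $U_{q,p}(A_2^{(2)})$ at level $c$: the currents satisfy on $M$ its defining relations.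 Namely, $K(z)$ has a two-sided inverse current, and with $H^\pm(z)=H(q^{\pm(r-c/2)}z)$: $$H(z)=\kappa\,K(q^{-1}z)K(z)^{-1}K(qz),\quad \kappa=\tfrac{\{pq^8\}\{pq^5\}\{pq^3\}\{pq^4\}^2\{p\}\{p^*q^7\}^*\{p^*q\}^*\{p^*q^2\}^{*2}\{p^*q^6\}^{*2}}{\{pq^7\}\{pq\}\{pq^2\}^2\{pq^6\}^2\{p^*\}^*\{p^*q^8\}^*\{p^*q^5\}^*\{p^*q^3\}^*\{p^*q^4\}^{*2}},$$ $$K(z_1)K(z_2)=\rho(u_1-u_2)K(z_2)K(z_1),\quad \rho=\tfrac{\rho^{+*}}{\rho^+},\quad \rho^+(u)=-qz^{1/r}\tfrac{\{pq^2z\}\{pq^3z\}^2\{pq^4z\}\{1/z\}\{q/z\}\{q^5/z\}\{q^6/z\}}{\{pz\}\{pqz\}\{pq^5z\}\{pq^6z\}\{q^2/z\}\{q^3/z\}^2\{q^4/z\}},$$ $$K(z_1)E(z_2)=-\tfrac{[u_1-u_2+\frac{r^*+1}2]^*}{[u_1-u_2+\frac{r^*-1}2]^*}E(z_2)K(z_1),\qquad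 K(z_1)F(z_2)=-\tfrac{[u_1-u_2+\frac{r-1}2]}{[u_1-u_2+\frac{r+1}2]}F(z_2)K(z_1),$$ $$E(z_1)E(z_2)=-\tfrac{[u_1-u_2+1]^*[u_1-u_2-\frac12]^*}{[u_1-u_2-1]^*[u_1-u_2+\frac12]^*}E(z_2)E(z_1),\qquad F(z_1)F(z_2)=-\tfrac{[u_1-u_2-1][u_1-u_2+\frac12]}{[u_1-u_2+1][u_1-u_2-\frac12]}F(z_2)F(z_1),$$ $$[E(z_1),F(z_2)]=\tfrac1{q-q^{-1}}\big(H^+(q^{c/2}z_2)\delta(q^{-c}z_1/z_2)-H^-(q^{-c/2}z_2)\delta(q^cz_1/z_2)\big),$$ and, with $w_{ji}=z_{\sigma(j)}/z_{\sigma(i)}$, $B_*(w)=\frac{(p^*q^2w;p^*)_\infty(p^*q^{-1}w;p^*)_\infty}{(p^*q^{-2}w;p^*)_\infty(p^*qw;p^*)_\infty}$, $A_*(w)=(1-q^2w)B_*(w)$, $B(w)=\frac{(pq^{-2}w;p)_\infty(pqw;p)_\infty}{(pq^2w;p)_\infty(pq^{-1}w;p)_\infty}$, $A(w)=(1-q^{-2}w)B(w)$,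 $$\sum_{\sigma\in S_3}z_{\sigma(1)}^{-2/r^*}z_{\sigma(2)}^{-1/r^*}B_*(w_{31})\big(z_{\sigma(1)}A_*(w_{21})B_*(w_{32})+q\,z_{\sigma(2)}B_*(w_{21})A_*(w_{32})\big)E(z_{\sigma(1)})E(z_{\sigma(2)})E(z_{\sigma(3)})=0,$$ $$\sum_{\sigma\in S_3}z_{\sigma(1)}^{2/r}z_{\sigma(2)}^{1/r}B(w_{31})\big(z_{\sigma(1)}A(w_{21})B(w_{32})+q^{-1}z_{\sigma(2)}B(w_{21})A(w_{32})\big)F(z_{\sigma(1)})F(z_{\sigma(2)})F(z_{\sigma(3)})=0.$$ **Meaning of the relations.** All relations are identities of formal series in (complex) powers of the $z_i$, applied to vectors of $M$. For the exchange relations the factor $f(u_1-u_2)$ is written as $f(u)=C z^{\gamma}R(z)/L(1/z)$, $z=q^{2u}$, and the relation reads $L(z_2/z_1)A(z_1)B(z_2)=C(z_1/z_2)^\gamma R(z_1/z_2)B(z_2)A(z_1)$ with $L,R$ expanded as power series, where $L=R$ and: for $KE$, $L(w)=\frac{(q^{r^*+1}w;p^*)_\infty}{(q^{r^*-1}w;p^*)_\infty}$,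 $C=-1$, $\gamma=\frac1{r^*}$; for $KF$, $L(w)=\frac{(q^{r-1}w;p)_\infty}{(q^{r+1}w;p)_\infty}$, $C=-1$, $\gamma=-\frac1r$; for $EE$, $L(w)=(1-q^2w)(1-q^{-1}w)B_*(w)$, $C=-1$, $\gamma=\frac1{r^*}-2$; for $FF$, $L(w)=(1-q^{-2}w)(1-qw)B(w)$, $C=-1$, $\gamma=-\frac1r-2$; for $KK$, $L(w)=\frac{\{pw\}\{pqw\}\{pq^5w\}\{pq^6w\}}{\{pq^2w\}\{pq^3w\}^2\{pq^4w\}}\cdot\frac{\{p^*q^2w\}^*\{p^*q^3w\}^{*2}\{p^*q^4w\}^*}{\{p^*w\}^*\{p^*qw\}^*\{p^*q^5w\}^*\{p^*q^6w\}^*}$, $C=1$, $\gamma=\frac1{r^*}-\frac1r$. The Serre relations are expanded in powers of $w_{21},w_{31},w_{32}$. The products $K(z)K(z)^{-1}=K(z)^{-1}K(z)=1$ and $K(q^{-1}z)K(z)^{-1}K(qz)$ are, coefficient by coefficient in $z$, sums over modes that converge against every linear functional on $M$. In the relation for $[E,F]$ on a vector with $Pv=lv$, $\delta(q^{\mp c}z_1/z_2)$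 is the sum of $(q^{\mp c}z_1/z_2)^s$ over the exponents $s\in-l/r^*+\mathbb Z$ that occur in $E(z_1)$. -/

import Mathlib

open scoped TensorProduct

noncomputable section

namespace EllipticA22

/-! ### Numbers, infinite products, theta functions -/

/-- The `q`-number `[x]_q = (q^x - q^{-x}) / (q - q^{-1})`. -/
def qn (q x : ℝ) : ℝ := (q ^ x - q ^ (-x)) / (q - q⁻¹)

/-- `[2m]_q - [m]_q`. -/
def dn (q x : ℝ) : ℝ := qn q (2 * x) - qn q x

/-- `(a; p)_∞`. -/
def poch (a p : ℂ) : ℂ := ∏' n : ℕ, (1 - a * p ^ n)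

/-- `(a; p, t)_∞`. -/
def poch₂ (a p t : ℂ) : ℂ := ∏' n : ℕ × ℕ, (1 - a * p ^ n.1 * t ^ n.2)

/-- `(a w; p)_∞` as a formal power series in `w`: each coefficient is the limit of the
corresponding coefficients of the finite products. -/
def pochSeries (a p : ℂ) : PowerSeries ℂ :=
  PowerSeries.mk fun k => Filter.limUnder Filter.atTop fun N : ℕ =>
    PowerSeries.coeff k
      (∏ n ∈ Finset.range N, (1 - PowerSeries.C (a * p ^ n) * PowerSeries.X))

/-- `(a w; p, t)_∞` as a formal power series in `w`. -/
def poch₂Series (a p t : ℂ) : PowerSeries ℂ :=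
  PowerSeries.mk fun k => Filter.limUnder Filter.atTop fun N : ℕ =>
    PowerSeries.coeff k
      (∏ n ∈ Finset.range N ×ˢ Finset.range N,
        (1 - PowerSeries.C (a * p ^ n.1 * t ^ n.2) * PowerSeries.X))

/-- `Θ_p(z) = (z; p)_∞ (p/z; p)_∞ (p; p)_∞`. -/
def Theta (p z : ℂ) : ℂ := poch z p * poch (p / z) p * poch p p

/-- The nome `p = q^{2r}`. -/
def nome (q r : ℝ) : ℂ := (q : ℂ) ^ (2 * r : ℂ)

/-- The theta function `[u] = q^{u²/r - u} Θ_p(q^{2u})`, `p = q^{2r}`.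
The function `[u]^*` is `br q (r - c) u`. -/
def br (q r : ℝ) (u : ℂ) : ℂ :=
  (q : ℂ) ^ (u ^ 2 / r - u) * Theta (nome q r) ((q : ℂ) ^ (2 * u))

/-- `{a} = (a; p, q⁶)_∞` with `p = q^{2r}`; `{a}^*` is `brace q (r - c) a`. -/
def brace (q r : ℝ) (a : ℂ) : ℂ := poch₂ a (nome q r) ((q : ℂ) ^ 6)

/-- Numerator of the scalar `ρ⁺(u)`, with `z = q^{2u}`. -/
def rhoNum (q r : ℝ) (u : ℂ) : ℂ :=
  let z : ℂ := (q : ℂ) ^ (2 * u);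
  let p : ℂ := nome q r;
  -(q : ℂ) * (q : ℂ) ^ (2 * u / r) *
    (brace q r (p * q ^ 2 * z) * brace q r (p * q ^ 3 * z) ^ 2 * brace q r (p * q ^ 4 * z) *
      brace q r (1 / z) * brace q r (q / z) * brace q r (q ^ 5 / z) * brace q r (q ^ 6 / z))

/-- Denominator of the scalar `ρ⁺(u)`. -/
def rhoDen (q r : ℝ) (u : ℂ) : ℂ :=
  let z : ℂ := (q : ℂ) ^ (2 * u);
  let p : ℂ := nome q r;
  brace q r (p * z) * brace q r (p * q * z) * brace q r (p * q ^ 5 * z) *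
    brace q r (p * q ^ 6 * z) * brace q r (q ^ 2 / z) * brace q r (q ^ 3 / z) ^ 2 *
    brace q r (q ^ 4 / z)

/-- The constant `κ`. -/
def kappa (q r c : ℝ) : ℂ :=
  let p : ℂ := nome q r;
  let p' : ℂ := nome q (r - c);
  let b : ℂ → ℂ := brace q r;
  let b' : ℂ → ℂ := brace q (r - c);
  (b (p * q ^ 8) * b (p * q ^ 5) * b (p * q ^ 3) * b (p * q ^ 4) ^ 2 * b p *
      b' (p' * q ^ 7) * b' (p' * q) * b' (p' * q ^ 2) ^ 2 * b' (p' * q ^ 6) ^ 2) /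
    (b (p * q ^ 7) * b (p * q) * b (p * q ^ 2) ^ 2 * b (p * q ^ 6) ^ 2 *
      b' p' * b' (p' * q ^ 8) * b' (p' * q ^ 5) * b' (p' * q ^ 3) * b' (p' * q ^ 4) ^ 2)

/-! ### Exponentials of currents -/

/-- The coefficient of `w^n` in `exp (∑_{m > 0} b_m w^m)`, for `b_m` in any algebra. -/
def expCoeff {A : Type*} [Ring A] [Algebra ℂ A] (b : ℕ → A) (n : ℕ) : A :=
  ∑ k ∈ Finset.range (n + 1), ((k.factorial : ℂ)⁻¹) •
    PowerSeries.coeff n ((PowerSeries.mk fun m => if m = 0 then 0 else b m) ^ k)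

/-! ### The quantum group `U_q(A_2^{(2)})` at level `c` in Drinfeld generators -/

/-- Drinfeld generators: `x ε m` is `x^ε_m`, `a m` is `a_m` (`m ≠ 0`), `k = q^{h/2}`, `d = q^d`. -/
inductive UqGen : Type
  | x (ε : ℤˣ) (m : ℤ)
  | a (m : {m : ℤ // m ≠ 0})
  | h
  | k
  | kinv
  | d
  | dinv

/-- A generator inside the free algebra. -/
abbrev gU (g : UqGen) : FreeAlgebra ℂ UqGen := FreeAlgebra.ι ℂ g

/-- `x^ε_m` in the free algebra. -/
def gx (ε : ℤˣ) (m : ℤ) : FreeAlgebra ℂ UqGen := gU (.x ε m)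

/-- `a_m` in the free algebra (there is no `a_0`; the value at `0` is `0`). -/
def ga (m : ℤ) : FreeAlgebra ℂ UqGen := if hm : m ≠ 0 then gU (.a ⟨m, hm⟩) else 0

/-- The coefficient of `z^{-n}` in
`ψ(q^{c/2} z) = q^{h/2} exp((q - q⁻¹) ∑_{m > 0} a_m z^{-m})`. -/
def gpsi (q : ℝ) (n : ℤ) : FreeAlgebra ℂ UqGen :=
  if 0 ≤ n then
    gU .k * expCoeff (fun m : ℕ => ((q : ℂ) - (q : ℂ)⁻¹) • ga m) n.toNat
  else 0

/-- The coefficient of `z^{-n}` in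
`φ(q^{-c/2} z) = q^{-h/2} exp(-(q - q⁻¹) ∑_{m > 0} a_{-m} z^m)`. -/
def gphi (q : ℝ) (n : ℤ) : FreeAlgebra ℂ UqGen :=
  if n ≤ 0 then
    gU .kinv * expCoeff (fun m : ℕ => (-((q : ℂ) - (q : ℂ)⁻¹)) • ga (-m)) (-n).toNat
  else 0

/-- The defining relations of `U_q(A_2^{(2)})` at level `c` (the central element `q^c` is the
number `q^c`), written for the modes of the Drinfeld currents `x^±(z) = ∑ x^±_m z^{-m}`. -/
inductive UqRel (q c : ℝ) : FreeAlgebra ℂ UqGen → FreeAlgebra ℂ UqGen → Prop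
  | k_kinv : UqRel q c (gU .k * gU .kinv) 1
  | kinv_k : UqRel q c (gU .kinv * gU .k) 1
  | d_dinv : UqRel q c (gU .d * gU .dinv) 1
  | dinv_d : UqRel q c (gU .dinv * gU .d) 1
  | h_k : UqRel q c (gU .h * gU .k) (gU .k * gU .h)
  | h_d : UqRel q c (gU .h * gU .d) (gU .d * gU .h)
  | d_k : UqRel q c (gU .d * gU .k) (gU .k * gU .d)
  | h_a (m : ℤ) : UqRel q c (gU .h * ga m) (ga m * gU .h)
  | k_a (m : ℤ) : UqRel q c (gU .k * ga m) (ga m * gU .k)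
  | d_a (m : ℤ) : UqRel q c (gU .d * ga m) (((q : ℂ) ^ m) • (ga m * gU .d))
  | h_x (ε : ℤˣ) (m : ℤ) : UqRel q c (gU .h * gx ε m - gx ε m * gU .h)
      ((2 * ((ε : ℤ) : ℂ)) • gx ε m)
  | k_x (ε : ℤˣ) (m : ℤ) : UqRel q c (gU .k * gx ε m) (((q : ℂ) ^ (ε : ℤ)) • (gx ε m * gU .k))
  | d_x (ε : ℤˣ) (m : ℤ) : UqRel q c (gU .d * gx ε m) (((q : ℂ) ^ m) • (gx ε m * gU .d))
  | a_a (m n : ℤ) (hm : m ≠ 0) (hn : n ≠ 0) : UqRel q c (ga m * ga n - ga n * ga m)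
      (if m + n = 0 then
        algebraMap ℂ _ ((1 / (m : ℝ) * dn q m * q ^ (-c * |(m : ℝ)|) * qn q (c * m) : ℝ) : ℂ)
      else 0)
  | a_xp (m n : ℤ) (hm : m ≠ 0) : UqRel q c (ga m * gx 1 n - gx 1 n * ga m)
      (((1 / (m : ℝ) * dn q m * q ^ (-c * |(m : ℝ)|) : ℝ) : ℂ) • gx 1 (n + m))
  | a_xm (m n : ℤ) (hm : m ≠ 0) : UqRel q c (ga m * gx (-1) n - gx (-1) n * ga m)
      (((-(1 / (m : ℝ) * dn q m) : ℝ) : ℂ) • gx (-1) (n + m))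
  /-- `(z₁ - A z₂)(z₁ - B z₂) x^ε(z₁) x^ε(z₂) = -(A z₁ - z₂)(B z₁ - z₂) x^ε(z₂) x^ε(z₁)`
  with `A = q^{2ε}`, `B = q^{-ε}`. -/
  | x_x (ε : ℤˣ) (m n : ℤ) (A B : ℂ) (hA : A = (q : ℂ) ^ (2 * (ε : ℤ)))
      (hB : B = (q : ℂ) ^ (-(ε : ℤ))) : UqRel q c
      (gx ε (m + 2) * gx ε n - (A + B) • (gx ε (m + 1) * gx ε (n + 1))
        + (A * B) • (gx ε m * gx ε (n + 2)))
      (-((A * B) • (gx ε n * gx ε (m + 2)) - (A + B) • (gx ε (n + 1) * gx ε (m + 1))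
        + gx ε (n + 2) * gx ε m))
  /-- `x⁺(z₁) x⁻(z₂) + x⁻(z₂) x⁺(z₁)
  = -(q - q⁻¹)⁻¹ (ψ(q^{c/2} z₂) δ(q^{-c} z₁/z₂) - φ(q^{-c/2} z₂) δ(q^c z₁/z₂))`. -/
  | xp_xm (m n : ℤ) : UqRel q c (gx 1 m * gx (-1) n + gx (-1) n * gx 1 m)
      ((-((q : ℂ) - (q : ℂ)⁻¹)⁻¹) •
        ((((q ^ (c * m) : ℝ) : ℂ)) • gpsi q (m + n) - ((q ^ (-c * m) : ℝ) : ℂ) • gphi q (m + n)))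
  /-- `∑_σ (q^{-3ε/2} z_{σ1} + (q^{-ε/2} - q^{ε/2}) z_{σ2} - q^{3ε/2} z_{σ3})
  x^ε(z_{σ1}) x^ε(z_{σ2}) x^ε(z_{σ3}) = 0`. -/
  | serre (ε : ℤˣ) (m : Fin 3 → ℤ) (e : ℝ) (he : e = ((ε : ℤ) : ℝ)) : UqRel q c
      (∑ σ : Equiv.Perm (Fin 3),
        (((q ^ (-3 * e / 2) : ℝ) : ℂ) • (gx ε (m (σ 0) + 1) * gx ε (m (σ 1)) * gx ε (m (σ 2)))
        + ((q ^ (-e / 2) - q ^ (e / 2) : ℝ) : ℂ) •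
            (gx ε (m (σ 0)) * gx ε (m (σ 1) + 1) * gx ε (m (σ 2)))
        - ((q ^ (3 * e / 2) : ℝ) : ℂ) •
            (gx ε (m (σ 0)) * gx ε (m (σ 1)) * gx ε (m (σ 2) + 1))))
      0

/-- The algebra `U_q(A_2^{(2)})` at level `c`. -/
abbrev Uq (q c : ℝ) : Type := RingQuot (UqRel q c)

/-! ### The Heisenberg algebra `ℂ{H}` -/

/-- Generators `P`, `e^{±Q}`, `e^{±ᾱ}`. -/
inductive HeisGen : Type
  | P
  | eQ
  | eQinv
  | eA
  | eAinv

/-- A generator inside the free algebra. -/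
abbrev gH (g : HeisGen) : FreeAlgebra ℂ HeisGen := FreeAlgebra.ι ℂ g

/-- The relations `[P, Q] = 1`, `[Q, ᾱ] = π i`, `[P, ᾱ] = 0` in exponentiated (Weyl) form:
`[P, e^Q] = e^Q`, `e^Q e^ᾱ = e^{π i} e^ᾱ e^Q`, `[P, e^ᾱ] = 0`. -/
inductive HeisRel : FreeAlgebra ℂ HeisGen → FreeAlgebra ℂ HeisGen → Prop
  | Q_inv : HeisRel (gH .eQ * gH .eQinv) 1
  | inv_Q : HeisRel (gH .eQinv * gH .eQ) 1
  | A_inv : HeisRel (gH .eA * gH .eAinv) 1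
  | inv_A : HeisRel (gH .eAinv * gH .eA) 1
  | P_Q : HeisRel (gH .P * gH .eQ - gH .eQ * gH .P) (gH .eQ)
  | P_A : HeisRel (gH .P * gH .eA) (gH .eA * gH .P)
  | Q_A : HeisRel (gH .eQ * gH .eA) (Complex.exp (Real.pi * Complex.I) • (gH .eA * gH .eQ))

/-- The algebra generated by `P`, `e^{±Q}`, `e^{±ᾱ}`. -/
abbrev Heis : Type := RingQuot HeisRel

section Rep

variable {q c : ℝ} {M : Type*} [AddCommGroup M] [Module ℂ M]

/-- The action on `M` of an element of `U_q(A_2^{(2)})`. -/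
def opU (π : Uq q c ⊗[ℂ] Heis →ₐ[ℂ] Module.End ℂ M) (y : FreeAlgebra ℂ UqGen) :
    Module.End ℂ M :=
  π (RingQuot.mkAlgHom ℂ (UqRel q c) y ⊗ₜ[ℂ] 1)

/-- The action on `M` of an element of the Heisenberg algebra. -/
def opH (π : Uq q c ⊗[ℂ] Heis →ₐ[ℂ] Module.End ℂ M) (g : HeisGen) : Module.End ℂ M :=
  π (1 ⊗ₜ[ℂ] RingQuot.mkAlgHom ℂ HeisRel (gH g))

/-- The modules on which the currents act. They are the restricted modules (the sums over modes
in products of currents are finite on every vector), decomposed into joint eigenvectors of `P`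
and `h` (so that `z^P`, `z^h` make sense), with `q^{h/2}` acting as the exponential of `h`. -/
structure IsRestricted (π : Uq q c ⊗[ℂ] Heis →ₐ[ℂ] Module.End ℂ M) : Prop where
  trunc : ∀ v : M, ∃ N : ℤ, ∀ m ≥ N,
    (∀ ε, opU π (gx ε m) v = 0) ∧ opU π (ga m) v = 0
  nilp : ∀ (v : M) (m : ℤ), 0 < m → ∃ k : ℕ, ((opU π (ga m)) ^ k) v = 0
  weight : Submodule.span ℂ
    {v : M | ∃ l μ : ℂ, opH π .P v = l • v ∧ opU π (gU .h) v = μ • v} = ⊤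
  qh : ∀ (μ : ℂ) (v : M), opU π (gU .h) v = μ • v →
    opU π (gU .k) v = ((q : ℂ) ^ (μ / 2)) • v

/-! ### The dressed currents -/

/-- The coefficient of `z^n` in
`u⁺(z, p) = exp (∑_{m > 0} a_{-m} q^{rm} z^m / [r^* m]_q)`, `r^* = r - c`. -/
def uPlus (r : ℝ) (π : Uq q c ⊗[ℂ] Heis →ₐ[ℂ] Module.End ℂ M) (n : ℕ) : Module.End ℂ M :=
  expCoeff (fun m : ℕ => ((q ^ (r * m) / qn q ((r - c) * m) : ℝ) : ℂ) • opU π (ga (-m))) n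

/-- The coefficient of `z^{-n}` in
`u⁻(z, p) = exp (-∑_{m > 0} a_m q^{rm} z^{-m} / [r m]_q)`. -/
def uMinus (r : ℝ) (π : Uq q c ⊗[ℂ] Heis →ₐ[ℂ] Module.End ℂ M) (n : ℕ) : Module.End ℂ M :=
  expCoeff (fun m : ℕ => ((-(q ^ (r * m) / qn q (r * m)) : ℝ) : ℂ) • opU π (ga m)) n

/-- The coefficient of `z^{-n}` in `e(z, p) = u⁺(z, p) x⁺(z)`. -/
def eMode (r : ℝ) (π : Uq q c ⊗[ℂ] Heis →ₐ[ℂ] Module.End ℂ M) (n : ℤ) (v : M) : M :=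
  ∑ᶠ j : ℕ, uPlus r π j (opU π (gx 1 (n + j)) v)

/-- The coefficient of `z^{-n}` in `f(z, p) = x⁻(z) u⁻(z, p)`. -/
def fMode (r : ℝ) (π : Uq q c ⊗[ℂ] Heis →ₐ[ℂ] Module.End ℂ M) (n : ℤ) (v : M) : M :=
  ∑ᶠ j : ℕ, opU π (gx (-1) (n - j)) (uMinus r π j v)

/-- The coefficient of `z^{-n}` in the normally ordered exponential
`:exp (∑_{m ≠ 0} b_m z^{-m}): = exp (∑_{m > 0} b_{-m} z^m) exp (∑_{m > 0} b_m z^{-m})`. -/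
def normalExpMode (b : ℤ → Module.End ℂ M) (n : ℤ) (v : M) : M :=
  ∑ᶠ j : ℕ, if 0 ≤ n + j then
    expCoeff (fun m : ℕ => b (-m)) j (expCoeff (fun m : ℕ => b m) (n + j).toNat v) else 0

/-- The bosons `α_m`: `a_m` for `m > 0` and `[rm]_q / [r^* m]_q q^{c|m|} a_m` for `m < 0`. -/
def alphaOp (r : ℝ) (π : Uq q c ⊗[ℂ] Heis →ₐ[ℂ] Module.End ℂ M) (m : ℤ) : Module.End ℂ M :=
  if 0 < m then opU π (ga m)
  else ((qn q (r * m) / qn q ((r - c) * m) * q ^ (c * |(m : ℝ)|) : ℝ) : ℂ) • opU π (ga m)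

/-- The coefficient of `z^{-n}` in
`k(z, p) = :exp (-∑_{m ≠ 0} [m]_q / ([rm]_q ([2m]_q - [m]_q)) α_m z^{-m}):`. -/
def kMode (r : ℝ) (π : Uq q c ⊗[ℂ] Heis →ₐ[ℂ] Module.End ℂ M) : ℤ → M → M :=
  normalExpMode fun m =>
    ((-(qn q m / (qn q (r * m) * dn q m)) : ℝ) : ℂ) • alphaOp r π m

/-- The coefficient of `z^{-n}` in `ψ(z, p)
= exp (∑_{m > 0} q^{cm} / [r^* m]_q a_{-m} z^m) exp (-∑_{m > 0} 1 / [rm]_q a_m z^{-m})`. -/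
def psiMode (r : ℝ) (π : Uq q c ⊗[ℂ] Heis →ₐ[ℂ] Module.End ℂ M) : ℤ → M → M :=
  normalExpMode fun m =>
    if 0 < m then ((-(1 / qn q (r * m)) : ℝ) : ℂ) • opU π (ga m)
    else ((q ^ (c * |(m : ℝ)|) / qn q ((r - c) * |(m : ℝ)|) : ℝ) : ℂ) • opU π (ga m)

/-! ### Currents with complex exponents -/

/-- `A(z) = ∑_s A_s z^s` is the current `y(z) T z^{χ(P, h)}`, where `y(z) = ∑_n y_n z^{-n}`:
on a vector `v` with `P v = l v`, `h v = μ v` it is `∑_n y_n (T v) z^{χ(l, μ) - n}`. -/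
def IsCurrent (π : Uq q c ⊗[ℂ] Heis →ₐ[ℂ] Module.End ℂ M) (A : ℂ → Module.End ℂ M)
    (y : ℤ → M → M) (T : Module.End ℂ M) (χ : ℂ → ℂ → ℂ) : Prop :=
  ∀ (l μ : ℂ) (v : M), opH π .P v = l • v → opU π (gU .h) v = μ • v →
    (∀ n : ℤ, A (χ l μ - n) v = y n (T v)) ∧
    ∀ s : ℂ, (∀ n : ℤ, s ≠ χ l μ - n) → A s v = 0

/-- On every vector, only finitely many coefficients of `z^{s-k}`, `k ∈ ℕ`, are non-zero. -/
def IsSmooth (A : ℂ → Module.End ℂ M) : Prop :=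
  ∀ (s : ℂ) (v : M), ∃ N : ℕ, ∀ k ≥ N, A (s - k) v = 0

end Rep

/-! ### Structure functions -/

/-- A quotient of infinite products in `w`, as a pair of functions and as the power series of
its expansion at `w = 0`. -/
structure Coeff where
  num : ℂ → ℂ
  den : ℂ → ℂ
  series : PowerSeries ℂ

/-- `∏_{a ∈ N} (a w; p)_∞ / ∏_{a ∈ D} (a w; p)_∞`. -/
def pochCoeff (p : ℂ) (N D : List ℂ) : Coeff where
  num w := (N.map fun a => poch (a * w) p).prod
  den w := (D.map fun a => poch (a * w) p).prod
  series := (N.map fun a => pochSeries a p).prod * ((D.map fun a => pochSeries a p).prod)⁻¹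

/-- The list of arguments of `{p}{pq}{pq⁵}{pq⁶}`. -/
def rhoList₁ (q r : ℝ) : List ℂ :=
  [nome q r, nome q r * q, nome q r * q ^ 5, nome q r * q ^ 6]

/-- The list of arguments of `{pq²}{pq³}²{pq⁴}`. -/
def rhoList₂ (q r : ℝ) : List ℂ :=
  [nome q r * q ^ 2, nome q r * q ^ 3, nome q r * q ^ 3, nome q r * q ^ 4]

/-- `∏_{a ∈ L} {a w}`, as a function of `w`. -/
def braceProd (q r : ℝ) (L : List ℂ) (w : ℂ) : ℂ := (L.map fun a => brace q r (a * w)).prod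

/-- `∏_{a ∈ L} {a w}`, as a power series in `w`. -/
def braceSeries (q r : ℝ) (L : List ℂ) : PowerSeries ℂ :=
  (L.map fun a => poch₂Series a (nome q r) ((q : ℂ) ^ 6)).prod

/-- `{pw}{pqw}{pq⁵w}{pq⁶w} {p^*q²w}^*{p^*q³w}^{*2}{p^*q⁴w}^*
/ ({pq²w}{pq³w}²{pq⁴w} {p^*w}^*{p^*qw}^*{p^*q⁵w}^*{p^*q⁶w}^*)`. -/
def rhoCoeff (q r r' : ℝ) : Coeff where
  num w := braceProd q r (rhoList₁ q r) w * braceProd q r' (rhoList₂ q r') w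
  den w := braceProd q r (rhoList₂ q r) w * braceProd q r' (rhoList₁ q r') w
  series := braceSeries q r (rhoList₁ q r) * braceSeries q r' (rhoList₂ q r') *
    (braceSeries q r (rhoList₂ q r) * braceSeries q r' (rhoList₁ q r'))⁻¹

section Relations

variable {M : Type*} [AddCommGroup M] [Module ℂ M]

/-- The exchange relation `A(z₁) B(z₂) = (N / D)(u₁ - u₂) B(z₂) A(z₁)`, `z_i = q^{2u_i}`, in the
sense of formal series: the function `N / D` is split as
`(N / D)(u) = C z^γ R(z) / L(1/z)`, `z = q^{2u}`, and the relation is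
`L(z₂/z₁) A(z₁) B(z₂) = C (z₁/z₂)^γ R(z₁/z₂) B(z₂) A(z₁)`,
`L` and `R` being expanded in non-negative powers of their arguments. -/
def Exchange (q : ℝ) (A B : ℂ → Module.End ℂ M) (N D : ℂ → ℂ) (C γ : ℂ) (L R : Coeff) : Prop :=
  (∀ u : ℂ, N u * L.num ((q : ℂ) ^ (-(2 * u))) * R.den ((q : ℂ) ^ (2 * u)) =
    C * (q : ℂ) ^ (2 * u * γ) * R.num ((q : ℂ) ^ (2 * u)) * L.den ((q : ℂ) ^ (-(2 * u))) * D u) ∧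
  ∀ (s t : ℂ) (v : M),
    ∑ᶠ k : ℕ, PowerSeries.coeff k L.series • A (s + k) (B (t - k) v) =
      C • ∑ᶠ k : ℕ, PowerSeries.coeff k R.series • B (t + γ + k) (A (s - γ - k) v)

/-- The coefficient of `z₁^{s₁} z₂^{s₂} z₃^{s₃}` in
`z₁^{g₁} z₂^{g₂} A₂₁(z₂/z₁) A₃₁(z₃/z₁) A₃₂(z₃/z₂) X(z₁) X(z₂) X(z₃) v`. -/
def tripleCoeff (X : ℂ → Module.End ℂ M) (g₁ g₂ : ℂ) (A₂₁ A₃₁ A₃₂ : PowerSeries ℂ)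
    (s₁ s₂ s₃ : ℂ) (v : M) : M :=
  ∑ᶠ n : ℕ × ℕ × ℕ,
    (PowerSeries.coeff n.1 A₂₁ * PowerSeries.coeff n.2.1 A₃₁ * PowerSeries.coeff n.2.2 A₃₂) •
      X (s₁ - g₁ + n.1 + n.2.1) (X (s₂ - g₂ - n.1 + n.2.2) (X (s₃ - n.2.1 - n.2.2) v))

/-- The Serre relation
`∑_σ z_{σ1}^{g₁} z_{σ2}^{g₂} (z_{σ1} A(w₂₁) B(w₃₁) B(w₃₂) + b z_{σ2} B(w₂₁) B(w₃₁) A(w₃₂))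
X(z_{σ1}) X(z_{σ2}) X(z_{σ3}) = 0`, where `w_{ji} = z_{σj}/z_{σi}`. -/
def Serre (X : ℂ → Module.End ℂ M) (g₁ g₂ b : ℂ) (A B : PowerSeries ℂ) : Prop :=
  ∀ (s : Fin 3 → ℂ) (v : M), ∑ σ : Equiv.Perm (Fin 3),
    (tripleCoeff X (g₁ + 1) g₂ A B B (s (σ 0)) (s (σ 1)) (s (σ 2)) v +
      b • tripleCoeff X g₁ (g₂ + 1) B B A (s (σ 0)) (s (σ 1)) (s (σ 2)) v) = 0

/-- The defining relations of the elliptic algebra `U_{q,p}(A_2^{(2)})` at level `c`, with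
`p = q^{2r}`, `p^* = q^{2r^*}`, `r^* = r - c`, for currents `E(z) = ∑_s E_s z^s`, etc., acting
on `M`. `Kinv` is `K(z)^{-1}`, and `H` is the auxiliary current `H(z)`. The operator `P` serves
only to name the exponents of `z` that occur in `E(z)`. -/
structure EllipticRelations (q r c : ℝ) (P : Module.End ℂ M)
    (E F K Kinv H : ℂ → Module.End ℂ M) : Prop where
  smooth_E : IsSmooth E
  smooth_F : IsSmooth F
  smooth_K : IsSmooth K
  smooth_Kinv : IsSmooth Kinv
  /-- `K(z) K(z)^{-1} = 1`; the infinite sum over modes converges against every functional. -/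
  K_Kinv : ∀ (s : ℂ) (v : M) (ξ : Module.Dual ℂ M),
    HasSum (fun t : ℂ => ξ (K t (Kinv (s - t) v))) (if s = 0 then ξ v else 0)
  Kinv_K : ∀ (s : ℂ) (v : M) (ξ : Module.Dual ℂ M),
    HasSum (fun t : ℂ => ξ (Kinv t (K (s - t) v))) (if s = 0 then ξ v else 0)
  /-- `H(z) = κ K(q^{-1} z) K(z)^{-1} K(q z)`. -/
  H_K : ∀ (s : ℂ) (v : M) (ξ : Module.Dual ℂ M),
    HasSum (fun t : ℂ × ℂ => kappa q r c * ((q : ℂ) ^ (-t.1) * (q : ℂ) ^ (s - t.1 - t.2) *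
      ξ (K t.1 (Kinv t.2 (K (s - t.1 - t.2) v))))) (ξ (H s v))
  /-- `K(z₁) K(z₂) = ρ(u₁ - u₂) K(z₂) K(z₁)`, `ρ = ρ^{+*} / ρ⁺`. -/
  K_K : Exchange q K K
    (fun u => rhoNum q (r - c) u * rhoDen q r u) (fun u => rhoDen q (r - c) u * rhoNum q r u)
    1 (1 / (r - c) - 1 / r) (rhoCoeff q r (r - c)) (rhoCoeff q r (r - c))
  /-- `K(z₁) E(z₂) = -[u₁-u₂+(r^*+1)/2]^* / [u₁-u₂+(r^*-1)/2]^* E(z₂) K(z₁)`. -/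
  K_E : Exchange q K E
    (fun u => -br q (r - c) (u + (r - c + 1) / 2)) (fun u => br q (r - c) (u + (r - c - 1) / 2))
    (-1) (1 / (r - c))
    (pochCoeff (nome q (r - c)) [(q : ℂ) ^ (r - c + 1 : ℂ)] [(q : ℂ) ^ (r - c - 1 : ℂ)])
    (pochCoeff (nome q (r - c)) [(q : ℂ) ^ (r - c + 1 : ℂ)] [(q : ℂ) ^ (r - c - 1 : ℂ)])
  /-- `K(z₁) F(z₂) = -[u₁-u₂+(r-1)/2] / [u₁-u₂+(r+1)/2] F(z₂) K(z₁)`. -/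
  K_F : Exchange q K F
    (fun u => -br q r (u + (r - 1) / 2)) (fun u => br q r (u + (r + 1) / 2))
    (-1) (-1 / r)
    (pochCoeff (nome q r) [(q : ℂ) ^ (r - 1 : ℂ)] [(q : ℂ) ^ (r + 1 : ℂ)])
    (pochCoeff (nome q r) [(q : ℂ) ^ (r - 1 : ℂ)] [(q : ℂ) ^ (r + 1 : ℂ)])
  /-- `E(z₁) E(z₂) = -[u₁-u₂+1]^* [u₁-u₂-1/2]^* / ([u₁-u₂-1]^* [u₁-u₂+1/2]^*) E(z₂) E(z₁)`. -/
  E_E : Exchange q E E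
    (fun u => -(br q (r - c) (u + 1) * br q (r - c) (u - 1 / 2)))
    (fun u => br q (r - c) (u - 1) * br q (r - c) (u + 1 / 2))
    (-1) (1 / (r - c) - 2)
    (pochCoeff (nome q (r - c)) [(q : ℂ) ^ 2, (q : ℂ)⁻¹]
      [nome q (r - c) / q ^ 2, nome q (r - c) * q])
    (pochCoeff (nome q (r - c)) [(q : ℂ) ^ 2, (q : ℂ)⁻¹]
      [nome q (r - c) / q ^ 2, nome q (r - c) * q])
  /-- `F(z₁) F(z₂) = -[u₁-u₂-1] [u₁-u₂+1/2] / ([u₁-u₂+1] [u₁-u₂-1/2]) F(z₂) F(z₁)`. -/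
  F_F : Exchange q F F
    (fun u => -(br q r (u - 1) * br q r (u + 1 / 2)))
    (fun u => br q r (u + 1) * br q r (u - 1 / 2))
    (-1) (-1 / r - 2)
    (pochCoeff (nome q r) [1 / (q : ℂ) ^ 2, (q : ℂ)] [nome q r * q ^ 2, nome q r / q])
    (pochCoeff (nome q r) [1 / (q : ℂ) ^ 2, (q : ℂ)] [nome q r * q ^ 2, nome q r / q])
  /-- `[E(z₁), F(z₂)]
  = (q - q⁻¹)⁻¹ (H⁺(q^{c/2} z₂) δ(q^{-c} z₁/z₂) - H⁻(q^{-c/2} z₂) δ(q^c z₁/z₂))` with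
  `H^±(z) = H(q^{±(r-c/2)} z)`, read at `z₁^s z₂^t`; the formal delta function is the sum over
  the exponents `s ∈ -P/r^* + ℤ` that occur in `E(z₁)`. -/
  E_F : ∀ (l : ℂ) (v : M), P v = l • v → ∀ (n : ℤ) (s t : ℂ), s = n - l / (r - c) →
    E s (F t v) - F t (E s v) = (((q : ℂ) - (q : ℂ)⁻¹)⁻¹) •
      (((q : ℂ) ^ ((r - c / 2) * (s + t)) * (q : ℂ) ^ (c / 2 * (s + t)) * (q : ℂ) ^ (-c * s)) •
          H (s + t) v -
        ((q : ℂ) ^ (-(r - c / 2) * (s + t)) * (q : ℂ) ^ (-c / 2 * (s + t)) * (q : ℂ) ^ (c * s)) •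
          H (s + t) v)
  serre_E : Serre E (-2 / (r - c)) (-1 / (r - c)) q
    (pochCoeff (nome q (r - c)) [(q : ℂ) ^ 2, nome q (r - c) / q]
      [nome q (r - c) / q ^ 2, nome q (r - c) * q]).series
    (pochCoeff (nome q (r - c)) [nome q (r - c) * q ^ 2, nome q (r - c) / q]
      [nome q (r - c) / q ^ 2, nome q (r - c) * q]).series
  serre_F : Serre F (2 / r) (1 / r) (q : ℂ)⁻¹
    (pochCoeff (nome q r) [1 / (q : ℂ) ^ 2, nome q r * q]
      [nome q r * q ^ 2, nome q r / q]).series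
    (pochCoeff (nome q r) [nome q r / q ^ 2, nome q r * q]
      [nome q r * q ^ 2, nome q r / q]).series

end Relations

end EllipticA22

end

open EllipticA22

/-!
All relations are checked on joint eigenvectors of `P` and `h`. There each current is the product
of a field `Y(z) = ∑ Y_n z^{-n}` with integral modes, built from `x^±(z)` and the bosons `a_m`, and
of zero modes `T z^{χ(P, h)}` (`HasModes`, `exists_current`). The fields and the zero modes are
treated separately and put together in `exchange_series`, `serre_current` and `commutator_E_F`: the
exponents `χ` produce the powers of `z₁/z₂`, the relation `e^{-Q} e^ᾱ = -e^ᾱ e^{-Q}` produces the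
signs for `KE` and `KF` and turns the anticommutator of `x⁺` and `x⁻` into a commutator.

*Dressing.* The fields `x^±`, `e`, `f`, `k` are primary: `[a_m, Y(z)] = γ_m z^m Y(z)` for scalars
`γ_m`. Hence `exp (∑ u_m a_{-m} z^m)` and `exp (∑ v_m a_m z^{-m})` move past such a field at the
cost of the scalar series `exp (∑ u_m γ_{-m} w^m)`, respectively `exp (-∑ v_m γ_m w^m)`, in the
ratio `w` of the two variables (`expCoeff_mul_primary`, `HeisData.leftComm`, `HeisData.rightComm`).
This follows from the uniqueness of solutions of the Euler equation `w dy/dw = β y`. Dressing a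
factor of an exchange relation therefore multiplies its structure functions by these series
(`Exch.lD_left`, `Exch.lD_right`, `Exch.rD_left`, `Exch.rD_right`). Applied to the quadratic
relations of `x^±`, and to the trivial exchange relation of `1` with a primary field, this gives
the exchange relations of `e`, `f` and `k` (`exch_E_E`, `exch_F_F`, `exch_K_E`, `exch_K_F`,
`exch_K_K`). The structure functions are identified with the expansions of the infinite products
by comparing logarithms (`pochSeries_eq`, `poch₂Series_eq`), which is a rational identity in
`q^m`, `q^{rm}`, `q^{r^*m}` for each `m` (`ScalarForms`). That they represent the theta quotients
of the relations is a consequence of `Θ_p` being a product of two halves exchanged by `z ↦ p/z`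
(`br_exchange`, `br_exchange₂`), and for `ρ` of `{a} = (a; q^6)_∞ {pa}` (`rho_exchange`).

*The commutator of `E` and `F`.* Dressing the relation of `x⁺` and `x⁻`, the two scalar series
cancel, and the dressed `ψ` and `φ` are both rescalings of `ψ(z, p)` (`anticomm_e_f`).

*Serre relations.* The factors `B(w_{ji})` are exactly the series needed to bring a product of
three dressed currents to normal order, with all exponentials on one side of a product of three
currents `x^±` (`triple_lD`, `triple_rD'`). The exponentials commute with each other, so that the
symmetrized sum reduces to the Serre relation of `x^±` (`serre_reindex`, `serre_of_triple`).

*Products of `K` at the same point.* The modes of a product of two vertex operators are obtained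
from those of the normally ordered product, only finitely many of which are non-zero on a given
vector in a given total degree, by the action of the contraction, a scalar power series. When the
contraction is absolutely summable at the ratio of the two points, the sum over the modes converges
against every linear functional, to the normally ordered product times the value of the contraction
(`hasSum_vertexOp_mul`, `hasSum_vertexOp_mul_mul`). The contraction of `k(z)` and `:k(wz)⁻¹:` has
the value `rhoVal w`, a quotient of convergent products for `|w| ≤ 1` (`logRho_sum`). So the
inverse of `K(z)` is the normally ordered inverse divided by `rhoVal 1`, and
`:k(q⁻¹z) k(z)⁻¹ k(qz): = ψ(z, p)` gives `H(z)` up to the constant `κ`, by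
`κ rhoVal(q)² = rhoVal(1) rhoVal(q²)` (`kappa_eq`).
-/

noncomputable section

namespace EllipticA22

/-! ### Exponentials of power series over a noncommutative algebra -/

section Exp

open PowerSeries Finset

variable {A : Type*} [Ring A]

lemma coeff_pow_eq_zero {f : PowerSeries A} (hf : coeff 0 f = 0) {n k : ℕ} (h : n < k) :
    coeff n (f ^ k) = 0 := by
  induction k generalizing n with
  | zero => omega
  | succ k ih =>
    rw [pow_succ', coeff_mul]
    refine Finset.sum_eq_zero fun p hp => ?_
    rw [Finset.HasAntidiagonal.mem_antidiagonal] at hp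
    rcases Nat.eq_zero_or_pos p.1 with h0 | h0
    · rw [h0, hf, zero_mul]
    · rw [ih (by omega), mul_zero]

lemma commute_mk {f g : PowerSeries A} (h : ∀ i j, Commute (coeff i f) (coeff j g)) :
    Commute f g := by
  ext n
  rw [coeff_mul, coeff_mul, ← Finset.Nat.sum_antidiagonal_swap]
  exact Finset.sum_congr rfl fun p _ => h _ _

variable [Algebra ℂ A]

/-- The Euler operator `w d/dw` on power series with coefficients in a possibly noncommutative
algebra. -/
def eulerD (f : PowerSeries A) : PowerSeries A := PowerSeries.mk fun n => (n : ℂ) • coeff n f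

@[simp] lemma coeff_eulerD (f : PowerSeries A) (n : ℕ) :
    coeff n (eulerD f) = (n : ℂ) • coeff n f := by simp [eulerD]

lemma eulerD_add (f g : PowerSeries A) : eulerD (f + g) = eulerD f + eulerD g := by
  ext n; simp

lemma eulerD_sub (f g : PowerSeries A) : eulerD (f - g) = eulerD f - eulerD g := by
  ext n; simp [smul_sub]

lemma eulerD_mul (f g : PowerSeries A) : eulerD (f * g) = eulerD f * g + f * eulerD g := by
  ext n
  simp only [coeff_eulerD, map_add, coeff_mul, Finset.smul_sum, ← Finset.sum_add_distrib]
  refine Finset.sum_congr rfl fun p hp => ?_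
  rw [← Finset.HasAntidiagonal.mem_antidiagonal.mp hp]
  simp only [smul_mul_assoc, mul_smul_comm, ← add_smul]
  push_cast; rfl

lemma eulerD_C (a : A) : eulerD (C a) = 0 := by
  ext n
  rcases n with _ | n
  · simp
  · simp

/-- A solution of `w dy/dw = β y` with `β(0) = 0` is determined by its value at `0`. -/
lemma eq_zero_of_eulerD {β y : PowerSeries A} (hβ : coeff 0 β = 0) (h : eulerD y = β * y)
    (h0 : coeff 0 y = 0) : y = 0 := by
  ext n
  induction n using Nat.strong_induction_on with
  | _ n ih =>
    rcases Nat.eq_zero_or_pos n with rfl | hn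
    · simpa using h0
    · have h1 := congrArg (coeff n) h
      rw [coeff_eulerD, coeff_mul, Finset.sum_eq_zero] at h1
      · exact (smul_eq_zero.mp h1).resolve_left (by exact_mod_cast hn.ne')
      · rintro ⟨i, j⟩ hij
        rw [Finset.HasAntidiagonal.mem_antidiagonal] at hij
        rcases Nat.eq_zero_or_pos i with rfl | hi
        · simp only [hβ, zero_mul]
        · rw [ih j (by simp at hij; omega)]; simp

/-- The form of `eq_zero_of_eulerD` for `w dy/dw = y β`. -/
lemma eq_zero_of_eulerD' {β y : PowerSeries A} (hβ : coeff 0 β = 0) (h : eulerD y = y * β)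
    (h0 : coeff 0 y = 0) : y = 0 := by
  ext n
  induction n using Nat.strong_induction_on with
  | _ n ih =>
    rcases Nat.eq_zero_or_pos n with rfl | hn
    · simpa using h0
    · have h1 := congrArg (coeff n) h
      rw [coeff_eulerD, coeff_mul, Finset.sum_eq_zero] at h1
      · exact (smul_eq_zero.mp h1).resolve_left (by exact_mod_cast hn.ne')
      · rintro ⟨i, j⟩ hij
        rw [Finset.HasAntidiagonal.mem_antidiagonal] at hij
        rcases Nat.eq_zero_or_pos j with rfl | hj
        · simp only [hβ, mul_zero]
        · rw [ih i (by simp at hij; omega)]; simp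

lemma eq_of_eulerD {β y y' : PowerSeries A} (hβ : coeff 0 β = 0) (h : eulerD y = β * y)
    (h' : eulerD y' = β * y') (h0 : coeff 0 y = coeff 0 y') : y = y' := by
  rw [← sub_eq_zero]
  exact eq_zero_of_eulerD hβ (by rw [eulerD_sub, h, h', mul_sub]) (by rw [map_sub, h0, sub_self])

/-- The power series `exp (∑_{m > 0} b_m w^m)`. -/
def expSeries (b : ℕ → A) : PowerSeries A := PowerSeries.mk (expCoeff b)

@[simp] lemma coeff_expSeries (b : ℕ → A) (n : ℕ) : coeff n (expSeries b) = expCoeff b n := by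
  simp [expSeries]

@[simp] lemma expCoeff_zero (b : ℕ → A) : expCoeff b 0 = 1 := by
  simp [expCoeff]

lemma eulerD_pow {f : PowerSeries A} (hf : Commute f (eulerD f)) (k : ℕ) :
    eulerD (f ^ (k + 1)) = ((k : ℂ) + 1) • (eulerD f * f ^ k) := by
  induction k with
  | zero => simp
  | succ k ih =>
    rw [pow_succ', eulerD_mul, ih, mul_smul_comm, ← mul_assoc, hf.eq, mul_assoc, ← pow_succ']
    push_cast
    rw [add_smul ((k : ℂ) + 1), one_smul, add_comm]

lemma expCoeff_eq_sum (b : ℕ → A) {n N : ℕ} (h : n ≤ N) :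
    expCoeff b n = ∑ k ∈ range (N + 1), ((k.factorial : ℂ)⁻¹) •
      coeff n ((PowerSeries.mk fun m => if m = 0 then 0 else b m) ^ k) := by
  rw [expCoeff]
  refine Finset.sum_subset (by intro x; simp; omega) fun k _ hk => ?_
  rw [coeff_pow_eq_zero (by simp) (by simp at hk; omega), smul_zero]

/-- The exponential of a commuting family satisfies `w dE/dw = (∑ m b_m w^m) E`. -/
lemma eulerD_expSeries {b : ℕ → A} (hb : ∀ i j, Commute (b i) (b j)) :
    eulerD (expSeries b) = eulerD (PowerSeries.mk b) * expSeries b := by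
  set f : PowerSeries A := PowerSeries.mk fun m => if m = 0 then 0 else b m with hf
  have hD : eulerD (PowerSeries.mk b) = eulerD f := by
    ext n; rcases n with _ | n <;> simp [hf]
  have hc : Commute f (eulerD f) := by
    refine commute_mk fun i j => ?_
    simp only [hf, coeff_eulerD, coeff_mk]
    refine Commute.smul_right ?_ _
    split_ifs <;> simp [hb]
  have key : ∀ N : ℕ, eulerD (∑ k ∈ range (N + 1), ((k.factorial : ℂ)⁻¹) • f ^ k) =
      eulerD f * ∑ k ∈ range N, ((k.factorial : ℂ)⁻¹) • f ^ k := by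
    intro N
    have hlin : ∀ (s : Finset ℕ) (F : ℕ → PowerSeries A) (c : ℕ → ℂ),
        eulerD (∑ k ∈ s, c k • F k) = ∑ k ∈ s, c k • eulerD (F k) := by
      intro s F c; ext n
      simp only [coeff_eulerD, map_sum, PowerSeries.coeff_smul, Finset.smul_sum]
      exact Finset.sum_congr rfl fun _ _ => smul_comm _ _ _
    rw [hlin, Finset.sum_range_succ', Finset.mul_sum]
    have h1 : eulerD (f ^ 0) = 0 := by
      rw [pow_zero, ← map_one C, eulerD_C]
    rw [h1, smul_zero, add_zero]
    refine Finset.sum_congr rfl fun k _ => ?_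
    rw [eulerD_pow hc, smul_smul, mul_smul_comm]
    congr 1
    rw [Nat.factorial_succ]
    have : ((k : ℂ) + 1) ≠ 0 := by exact_mod_cast Nat.succ_ne_zero k
    have h2 : (k.factorial : ℂ) ≠ 0 := by exact_mod_cast Nat.factorial_ne_zero k
    push_cast; field_simp
  ext n
  have h1 := congrArg (coeff n) (key n)
  rw [coeff_eulerD, map_sum] at h1
  rw [coeff_eulerD, coeff_expSeries, expCoeff_eq_sum b le_rfl, hD]
  simp only [PowerSeries.coeff_smul] at h1
  rw [h1, coeff_mul, coeff_mul]
  refine Finset.sum_congr rfl fun p hp => ?_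
  rw [Finset.HasAntidiagonal.mem_antidiagonal] at hp
  rcases Nat.eq_zero_or_pos p.1 with h0 | h0
  · rw [h0]; simp
  · obtain ⟨N, rfl⟩ : ∃ N, n = N + 1 := ⟨n - 1, by omega⟩
    congr 1
    rw [coeff_expSeries, expCoeff_eq_sum b (show p.2 ≤ N by omega), map_sum]
    simp only [PowerSeries.coeff_smul]
    rfl

/-- An exponential is characterized by its Euler equation and its constant term; identities
between exponentials are proved by checking these two. -/
lemma expSeries_unique {b : ℕ → A} (hb : ∀ i j, Commute (b i) (b j)) {y : PowerSeries A}
    (h : eulerD y = eulerD (PowerSeries.mk b) * y) (h0 : coeff 0 y = 1) : y = expSeries b :=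
  eq_of_eulerD (by simp) h (eulerD_expSeries hb) (by simp [h0])

lemma expCoeff_rec {b : ℕ → A} (hb : ∀ i j, Commute (b i) (b j)) (n : ℕ) :
    (n : ℂ) • expCoeff b n = ∑ p ∈ antidiagonal n, (p.1 : ℂ) • (b p.1 * expCoeff b p.2) := by
  have := congrArg (coeff n) (eulerD_expSeries hb)
  rw [coeff_eulerD, coeff_expSeries, coeff_mul] at this
  rw [this]
  simp

@[simp] lemma constantCoeff_expSeries (b : ℕ → A) : constantCoeff (expSeries b) = 1 := by
  rw [← coeff_zero_eq_constantCoeff_apply, coeff_expSeries, expCoeff_zero]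

/-- Anything commuting with all `b_m` commutes with `exp (∑ b_m w^m)`. -/
lemma commute_expCoeff {b : ℕ → A} {x : A} (h : ∀ m, Commute x (b m)) (n : ℕ) :
    Commute x (expCoeff b n) := by
  refine Commute.sum_right _ _ _ fun k _ => Commute.smul_right ?_ _
  have hp : Commute (C x) ((PowerSeries.mk fun m => if m = 0 then 0 else b m) ^ k) := by
    refine Commute.pow_right (commute_mk fun i j => ?_) k
    rw [coeff_C, coeff_mk]
    split_ifs <;> simp [h]
  have := congrArg (coeff n) hp.eq
  rwa [coeff_C_mul, coeff_mul_C] at this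

lemma commute_expCoeff_expCoeff {b c : ℕ → A} (h : ∀ i j, Commute (b i) (c j)) (n k : ℕ) :
    Commute (expCoeff b n) (expCoeff c k) :=
  commute_expCoeff (fun _ => (commute_expCoeff (fun i => (h i _).symm) n).symm) k

lemma expSeries_add {b c : ℕ → A} (hb : ∀ i j, Commute (b i) (b j))
    (hc : ∀ i j, Commute (c i) (c j)) (hbc : ∀ i j, Commute (b i) (c j)) :
    expSeries (fun m => b m + c m) = expSeries b * expSeries c := by
  symm
  refine expSeries_unique (fun i j => ?_) ?_ ?_
  · exact ((hb i j).add_right (hbc i j)).add_left ((hbc j i).symm.add_right (hc i j))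
  · have hcomm : Commute (expSeries b) (eulerD (PowerSeries.mk c)) := by
      refine commute_mk fun i j => ?_
      rw [coeff_expSeries, coeff_eulerD, coeff_mk]
      exact (commute_expCoeff (fun m => (hbc m j).symm) i).symm.smul_right _
    have hsplit : eulerD (PowerSeries.mk fun m => b m + c m) =
        eulerD (PowerSeries.mk b) + eulerD (PowerSeries.mk c) := by
      rw [← eulerD_add]; congr 1
    rw [eulerD_mul, eulerD_expSeries hb, eulerD_expSeries hc, hsplit, add_mul, mul_assoc,
      ← mul_assoc (expSeries b), hcomm.eq, mul_assoc]
  · simp [coeff_mul]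

@[simp] lemma expSeries_zero : expSeries (fun _ => (0 : A)) = 1 := by
  symm
  refine expSeries_unique (by simp) ?_ (by simp)
  rw [← map_one C, eulerD_C]
  ext n; simp

lemma expCoeff_congr {b c : ℕ → A} (h : ∀ m, 0 < m → b m = c m) (n : ℕ) :
    expCoeff b n = expCoeff c n := by
  have : (fun m => if m = 0 then 0 else b m) = fun m => if m = 0 then 0 else c m := by
    ext m; split_ifs with hm
    · rfl
    · exact h m (Nat.pos_of_ne_zero hm)
  simp only [expCoeff, this]

lemma expSeries_congr {b c : ℕ → A} (h : ∀ m, 0 < m → b m = c m) :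
    expSeries b = expSeries c := by
  ext n; simp [expCoeff_congr h n]

lemma expCoeff_rescale {b : ℕ → A} (hb : ∀ i j, Commute (b i) (b j)) (t : ℂ) (n : ℕ) :
    expCoeff (fun m => t ^ m • b m) n = t ^ n • expCoeff b n := by
  have : (PowerSeries.mk fun n => t ^ n • expCoeff b n) = expSeries (fun m => t ^ m • b m) := by
    refine expSeries_unique (fun i j => ((hb i j).smul_right _).smul_left _) ?_ (by simp)
    ext n
    rw [coeff_eulerD, coeff_mk, coeff_mul, smul_comm, expCoeff_rec hb, Finset.smul_sum]
    refine Finset.sum_congr rfl fun p hp => ?_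
    rw [← Finset.HasAntidiagonal.mem_antidiagonal.mp hp]
    simp only [coeff_eulerD, coeff_mk, smul_mul_assoc, mul_smul_comm, smul_smul, pow_add]
    congr 1; ring
  have h2 := congrArg (coeff n) this
  simpa using h2.symm

lemma map_expCoeff {B : Type*} [Ring B] [Algebra ℂ B] (φ : A →ₐ[ℂ] B) (b : ℕ → A) (n : ℕ) :
    φ (expCoeff b n) = expCoeff (fun m => φ (b m)) n := by
  simp only [expCoeff, map_sum, map_smul]
  refine Finset.sum_congr rfl fun k _ => ?_
  congr 1
  have h1 : PowerSeries.map (φ : A →+* B) (PowerSeries.mk fun m => if m = 0 then 0 else b m) =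
      PowerSeries.mk fun m => if m = 0 then 0 else φ (b m) := by
    ext m; by_cases hm : m = 0 <;> simp [hm]
  rw [← h1, ← map_pow, coeff_map]; rfl

/-- The operator `∑_m m b_m w^m` acts on `∑_i c_i w^i X_{j+i}` as multiplication of `c` by the
scalar series `∑_m m γ_m w^m`, up to moving it to the right. -/
lemma eulerD_mk_mul_primary {b : ℕ → A} {X : ℤ → A} {γ : ℕ → ℂ}
    (h : ∀ m : ℕ, 0 < m → ∀ j, b m * X j - X j * b m = γ m • X (j + m)) (c : PowerSeries ℂ)
    (j : ℤ) :
    eulerD (PowerSeries.mk b) * (PowerSeries.mk fun i => coeff i c • X (j + i)) =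
      (PowerSeries.mk fun i => coeff i c • X (j + i)) * eulerD (PowerSeries.mk b) +
      PowerSeries.mk fun i => coeff i (eulerD (PowerSeries.mk γ) * c) • X (j + i) := by
  ext k
  rw [map_add, coeff_mul, coeff_mul, coeff_mk, coeff_mul, ← Finset.Nat.sum_antidiagonal_swap (n := k)
    (f := fun p : ℕ × ℕ => coeff p.1 (PowerSeries.mk fun i => coeff i c • X (j + i)) *
      coeff p.2 (eulerD (PowerSeries.mk b))),
    ← sub_eq_iff_eq_add', ← Finset.sum_sub_distrib, Finset.sum_smul]
  simp only [coeff_eulerD, coeff_mk]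
  refine Finset.sum_congr rfl fun p hp => ?_
  rw [← Finset.HasAntidiagonal.mem_antidiagonal.mp hp]
  simp only [Prod.fst_swap, Prod.snd_swap]
  rcases Nat.eq_zero_or_pos p.1 with h0 | h0
  · simp [h0]
  · rw [smul_mul_smul_comm, smul_mul_smul_comm, mul_comm (coeff p.2 c), ← smul_sub, h _ h0,
      smul_smul]
    push_cast
    congr 1
    · simp only [smul_eq_mul]; ring
    · congr 1; ring

/-- If `[b_m, X_j] = γ_m X_{j+m}` then `exp (∑ b_m w^m) X_j = (∑_i exp(γ)_i w^i X_{j+i})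
exp (∑ b_m w^m)`. -/
lemma expCoeff_mul_primary {b : ℕ → A} (hb : ∀ i j, Commute (b i) (b j)) {X : ℤ → A} {γ : ℕ → ℂ}
    (h : ∀ m : ℕ, 0 < m → ∀ j, b m * X j - X j * b m = γ m • X (j + m)) (n : ℕ) (j : ℤ) :
    expCoeff b n * X j =
      ∑ p ∈ antidiagonal n, expCoeff γ p.1 • (X (j + p.1) * expCoeff b p.2) := by
  have h1 := eulerD_mk_mul_primary h (expSeries γ) j
  set G : PowerSeries A := PowerSeries.mk fun i => coeff i (expSeries γ) • X (j + i) with hG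
  rw [← eulerD_expSeries (fun _ _ => Commute.all _ _)] at h1
  have hDG : (PowerSeries.mk fun i => coeff i (eulerD (expSeries γ)) • X (j + i)) = eulerD G := by
    ext k; simp [hG, mul_smul]
  rw [hDG] at h1
  -- both sides solve `w dy/dw = (∑ m b_m w^m) y` and agree at `w = 0`
  have key : expSeries b * C (X j) = G * expSeries b := by
    refine eq_of_eulerD (β := eulerD (PowerSeries.mk b)) (by simp) ?_ ?_ ?_
    · rw [eulerD_mul, eulerD_C, mul_zero, add_zero, eulerD_expSeries hb, mul_assoc]
    · rw [eulerD_mul, eulerD_expSeries hb, ← mul_assoc, ← add_mul, add_comm, ← h1, mul_assoc]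
    · simp [coeff_mul, hG]
  have := congrArg (coeff n) key
  rw [coeff_mul_C, coeff_expSeries, coeff_mul] at this
  rw [this]
  refine Finset.sum_congr rfl fun p _ => ?_
  simp [hG]

/-- The inverse form of `expCoeff_mul_primary`. -/
lemma primary_mul_expCoeff {b : ℕ → A} (hb : ∀ i j, Commute (b i) (b j)) {X : ℤ → A} {γ : ℕ → ℂ}
    (h : ∀ m : ℕ, 0 < m → ∀ j, b m * X j - X j * b m = γ m • X (j + m)) (n : ℕ) (j : ℤ) :
    X j * expCoeff b n =
      ∑ p ∈ antidiagonal n, expCoeff (fun m => -γ m) p.1 • (expCoeff b p.2 * X (j + p.1)) := by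
  have h1 := eulerD_mk_mul_primary h (expSeries fun m => -γ m) j
  set G : PowerSeries A := PowerSeries.mk fun i => coeff i (expSeries fun m => -γ m) • X (j + i)
    with hG
  have hDG : (PowerSeries.mk fun i => coeff i (eulerD (PowerSeries.mk γ) *
      expSeries fun m => -γ m) • X (j + i)) = - eulerD G := by
    have h2 : eulerD (PowerSeries.mk γ) = - eulerD (PowerSeries.mk fun m => -γ m) := by
      ext k; simp
    rw [h2, neg_mul, ← eulerD_expSeries (fun _ _ => Commute.all _ _)]
    ext k; simp [hG, mul_smul]
  rw [hDG, ← sub_eq_add_neg, eq_sub_iff_add_eq] at h1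
  have hcomm : Commute (expSeries b) (eulerD (PowerSeries.mk b)) := by
    refine commute_mk fun i j => ?_
    rw [coeff_expSeries, coeff_eulerD, coeff_mk]
    exact (commute_expCoeff (fun m => (hb j m)) i).symm.smul_right _
  have key : C (X j) * expSeries b = expSeries b * G := by
    rw [← sub_eq_zero]
    refine eq_zero_of_eulerD' (β := eulerD (PowerSeries.mk b)) (by simp) ?_ ?_
    · rw [eulerD_sub, eulerD_mul, eulerD_C, zero_mul, zero_add, eulerD_mul, eulerD_expSeries hb,
        ← hcomm.eq, mul_assoc (expSeries b), ← mul_add, h1, sub_mul, mul_assoc, mul_assoc]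
    · simp [hG]
  have := congrArg (coeff n) key
  rw [coeff_C_mul, coeff_expSeries, coeff_mul, ← Finset.Nat.sum_antidiagonal_swap] at this
  rw [this]
  refine Finset.sum_congr rfl fun p _ => ?_
  simp [hG]

/-- If `[x, b_m] = λ δ_{m,k}` then `[x, exp (∑ b_m w^m)] = λ w^k exp (∑ b_m w^m)`. -/
lemma bracket_expCoeff {b : ℕ → A} (hb : ∀ i j, Commute (b i) (b j)) {x : A} {k : ℕ} {ν : ℂ}
    (hk : 0 < k) (h : ∀ m, 0 < m → x * b m - b m * x = if m = k then algebraMap ℂ A ν else 0)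
    (n : ℕ) :
    x * expCoeff b n - expCoeff b n * x = if k ≤ n then ν • expCoeff b (n - k) else 0 := by
  have hβ : C x * eulerD (PowerSeries.mk b) - eulerD (PowerSeries.mk b) * C x =
      (k : ℂ) • ν • (X : PowerSeries A) ^ k := by
    ext m
    rw [map_sub, coeff_C_mul, coeff_mul_C, coeff_eulerD, coeff_mk, mul_smul_comm, smul_mul_assoc,
      ← smul_sub]
    rcases Nat.eq_zero_or_pos m with h0 | h0
    · subst h0
      simp [coeff_X_pow, hk.ne]
    · rw [h m h0, PowerSeries.coeff_smul, PowerSeries.coeff_smul, coeff_X_pow]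
      split_ifs with hmk
      · rw [hmk, Algebra.algebraMap_eq_smul_one]
      · simp
  set E := expSeries b
  -- the difference of the two sides solves `w dy/dw = (∑ m b_m w^m) y` with `y(0) = 0`
  have key : C x * E - E * C x - ν • (X ^ k * E) = 0 := by
    refine eq_zero_of_eulerD (β := eulerD (PowerSeries.mk b)) (by simp) ?_ ?_
    · have hX : eulerD (ν • ((X : PowerSeries A) ^ k * E)) =
          (k : ℂ) • ν • ((X : PowerSeries A) ^ k * E) + ν • (X ^ k * eulerD E) := by
        have h1 : eulerD ((X : PowerSeries A) ^ k) = (k : ℂ) • X ^ k := by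
          ext m
          rw [coeff_eulerD, PowerSeries.coeff_smul, coeff_X_pow]
          split_ifs with hm
          · rw [hm]
          · simp
        have h2 : ∀ f : PowerSeries A, eulerD (ν • f) = ν • eulerD f := by
          intro f; ext m; simp [smul_comm ν]
        rw [h2, eulerD_mul, h1, smul_add, smul_mul_assoc, smul_comm]
      rw [eulerD_sub, eulerD_sub, eulerD_mul, eulerD_mul, eulerD_C, hX, eulerD_expSeries hb,
        zero_mul, zero_add, mul_zero, add_zero, mul_sub, mul_sub, mul_smul_comm,
        ← mul_assoc _ (X ^ k) E, (commute_X_pow (eulerD (PowerSeries.mk b)) k).eq]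
      have h3 : (k : ℂ) • ν • (X ^ k * E) = (C x * eulerD (PowerSeries.mk b) -
          eulerD (PowerSeries.mk b) * C x) * E := by
        rw [hβ, smul_mul_assoc, smul_mul_assoc]
      rw [h3]
      noncomm_ring
    · simp [E, zero_pow hk.ne']
  have := congrArg (coeff n) (sub_eq_zero.mp key)
  rw [map_sub, coeff_C_mul, coeff_mul_C, PowerSeries.coeff_smul, coeff_X_pow_mul',
    coeff_expSeries] at this
  rw [this]
  split_ifs <;> simp [E]

/-- If the commuting family `b` is locally nilpotent and finite on `v`, then the exponential of
`b` is polynomial on `v`. -/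
lemma exists_expCoeff_apply_eq_zero {M : Type*} [AddCommGroup M] [Module ℂ M]
    {b : ℕ → Module.End ℂ M} (hb : ∀ i j, Commute (b i) (b j)) (v : M)
    (hN : ∃ N, ∀ m ≥ N, b m v = 0) (hnil : ∀ m, 0 < m → ∃ k : ℕ, (b m ^ k) v = 0) :
    ∃ N, ∀ n ≥ N, expCoeff b n v = 0 := by
  obtain ⟨N, hN⟩ := hN
  have hk : ∀ m, ∃ k : ℕ, 0 < m → (b m ^ k) v = 0 := fun m => by
    by_cases hm : 0 < m
    · obtain ⟨k, hk⟩ := hnil m hm; exact ⟨k, fun _ => hk⟩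
    · exact ⟨0, fun h => absurd h hm⟩
  choose k hk using hk
  -- induction on the total order of nilpotency
  have main : ∀ (K : ℕ) (k : ℕ → ℕ) (v : M), ∑ m ∈ range N, k m = K → (∀ m ≥ N, b m v = 0) →
      (∀ m, 0 < m → (b m ^ k m) v = 0) → ∀ n > N * K, expCoeff b n v = 0 := by
    intro K
    induction K with
    | zero =>
      intro k v hK hNv hkv n hn
      have h1 : ∀ m, 0 < m → b m v = 0 := by
        intro m hm
        by_cases hmN : m < N
        · have : k m = 0 := (Finset.sum_eq_zero_iff.mp hK) m (by simpa using hmN)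
          have h2 := hkv m hm
          rw [this] at h2
          simp only [pow_zero, Module.End.one_apply] at h2
          rw [h2, map_zero]
        · exact hNv m (by omega)
      have h2 := LinearMap.congr_fun (expCoeff_rec hb n) v
      rw [LinearMap.smul_apply, LinearMap.sum_apply, Finset.sum_eq_zero] at h2
      · exact (smul_eq_zero.mp h2).resolve_left (by norm_cast; omega)
      · intro p _
        rcases Nat.eq_zero_or_pos p.1 with h0 | h0
        · simp [h0]
        · rw [(commute_expCoeff (hb p.1) p.2).eq]
          simp [h1 _ h0]
    | succ K ih =>
      intro k v hK hNv hkv n hn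
      have h2 := LinearMap.congr_fun (expCoeff_rec hb n) v
      rw [LinearMap.smul_apply, LinearMap.sum_apply, Finset.sum_eq_zero] at h2
      · exact (smul_eq_zero.mp h2).resolve_left (by norm_cast; omega)
      · intro p hp
        rw [HasAntidiagonal.mem_antidiagonal] at hp
        rcases Nat.eq_zero_or_pos p.1 with h0 | h0
        · simp [h0]
        rw [(commute_expCoeff (hb p.1) p.2).eq, LinearMap.smul_apply, Module.End.mul_apply]
        by_cases hpN : p.1 < N
        · rcases Nat.eq_zero_or_pos (k p.1) with hk0 | hk0
          · have h3 := hkv _ h0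
            rw [hk0] at h3
            simp only [pow_zero, Module.End.one_apply] at h3
            simp [h3]
          · rw [ih (Function.update k p.1 (k p.1 - 1)), smul_zero]
            · have h4 := Finset.sum_update_of_mem (Finset.mem_range.mpr hpN) k (k p.1 - 1)
              have h5 := Finset.add_sum_erase (range N) k (Finset.mem_range.mpr hpN)
              rw [h4, Finset.sdiff_singleton_eq_erase]
              omega
            · intro m hm
              rw [← Module.End.mul_apply, (hb m p.1).eq, Module.End.mul_apply, hNv m hm, map_zero]
            · intro m hm
              by_cases hmp : m = p.1
              · subst hmp
                rw [Function.update_self, ← Module.End.mul_apply, ← pow_succ,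
                  Nat.sub_add_cancel hk0, hkv _ h0]
              · rw [Function.update_of_ne hmp, ← Module.End.mul_apply,
                  ((hb m p.1).pow_left _).eq, Module.End.mul_apply, hkv m hm, map_zero]
            · have : N * (K + 1) = N * K + N := by ring
              omega
        · rw [hNv _ (by omega), map_zero, smul_zero]
  exact ⟨N * ∑ m ∈ range N, k m + 1, fun n hn => main _ k v rfl hN hk n (by omega)⟩

end Exp

/-! ### Finite sums indexed by `ℕ` -/

section FiniteSums

open Finset

variable {M : Type*} [AddCommGroup M]

/-- The sequence `f` vanishes from some index on. -/
def EvZero (f : ℕ → M) : Prop := ∃ N, ∀ k ≥ N, f k = 0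

/-- The double sequence `f` vanishes outside some finite box. -/
def BoxZero (f : ℕ → ℕ → M) : Prop := ∃ N, ∀ i j, N ≤ i ∨ N ≤ j → f i j = 0

lemma finsum_eq_sum_range {f : ℕ → M} {N : ℕ} (h : ∀ k ≥ N, f k = 0) :
    ∑ᶠ k, f k = ∑ k ∈ range N, f k := by
  refine finsum_eq_sum_of_support_subset _ fun k hk => ?_
  by_contra hkN
  exact hk (h k (by simpa using hkN))

lemma EvZero.finite {f : ℕ → M} (h : EvZero f) : f.support.Finite := by
  obtain ⟨N, hN⟩ := h
  refine (Set.finite_lt_nat N).subset fun k hk => ?_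
  by_contra hkN
  exact hk (hN k (by simpa using hkN))

lemma EvZero.map {f : ℕ → M} (h : EvZero f) {M' : Type*} [AddCommGroup M'] (g : ℕ → M → M')
    (hg : ∀ k, g k 0 = 0) : EvZero fun k => g k (f k) := by
  obtain ⟨N, hN⟩ := h
  exact ⟨N, fun k hk => by simp only [hN k hk, hg]⟩

lemma EvZero.add {f g : ℕ → M} (hf : EvZero f) (hg : EvZero g) : EvZero fun k => f k + g k := by
  obtain ⟨N, hN⟩ := hf
  obtain ⟨N', hN'⟩ := hg
  exact ⟨max N N', fun k hk => by
    simp only [hN k (le_of_max_le_left hk), hN' k (le_of_max_le_right hk), add_zero]⟩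

lemma EvZero.shift {f : ℕ → M} (hf : EvZero f) (k : ℕ) :
    EvZero fun j => if k ≤ j then f (j - k) else 0 := by
  obtain ⟨N, hN⟩ := hf
  refine ⟨N + k, fun j hj => ?_⟩
  simp only [if_pos (show k ≤ j by omega)]
  exact hN _ (by omega)

lemma finsum_add_of_evZero {f g : ℕ → M} (hf : EvZero f) (hg : EvZero g) :
    ∑ᶠ k, (f k + g k) = ∑ᶠ k, f k + ∑ᶠ k, g k :=
  finsum_add_distrib hf.finite hg.finite

lemma finsum_sub_of_evZero {f g : ℕ → M} (hf : EvZero f) (hg : EvZero g) :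
    ∑ᶠ k, (f k - g k) = ∑ᶠ k, f k - ∑ᶠ k, g k :=
  finsum_sub_distrib hf.finite hg.finite

lemma map_finsum_of_evZero {M' : Type*} [AddCommGroup M'] [Module ℂ M] [Module ℂ M']
    (φ : M →ₗ[ℂ] M') {f : ℕ → M} (hf : EvZero f) : φ (∑ᶠ k, f k) = ∑ᶠ k, φ (f k) := by
  obtain ⟨N, hN⟩ := hf
  rw [finsum_eq_sum_range hN, map_sum, finsum_eq_sum_range fun k hk => by rw [hN k hk, map_zero]]

lemma BoxZero.of_nested {f : ℕ → ℕ → M} (h₁ : ∃ N, ∀ i ≥ N, ∀ j, f i j = 0)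
    (h₂ : ∀ i, EvZero (f i)) : BoxZero f := by
  obtain ⟨N, hN⟩ := h₁
  choose K hK using h₂
  refine ⟨max N (∑ i ∈ range N, K i), fun i j hij => ?_⟩
  by_cases hi : N ≤ i
  · exact hN i hi j
  · refine hK i j (le_trans ?_ ((le_max_right _ _).trans (hij.resolve_left
      fun h => hi ((le_max_left _ _).trans h))))
    exact Finset.single_le_sum (fun _ _ => Nat.zero_le _) (by simpa using hi)

lemma BoxZero.swap {f : ℕ → ℕ → M} (h : BoxZero f) : BoxZero fun j i => f i j := by
  obtain ⟨N, hN⟩ := h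
  exact ⟨N, fun i j hij => hN j i hij.symm⟩

lemma BoxZero.map {f : ℕ → ℕ → M} (h : BoxZero f) {M' : Type*} [AddCommGroup M']
    (g : ℕ → ℕ → M → M') (hg : ∀ i j, g i j 0 = 0) : BoxZero fun i j => g i j (f i j) := by
  obtain ⟨N, hN⟩ := h
  exact ⟨N, fun i j hij => by simp only [hN i j hij, hg]⟩

lemma BoxZero.outer {f : ℕ → ℕ → M} (h : BoxZero f) : EvZero fun i => ∑ᶠ j, f i j := by
  obtain ⟨N, hN⟩ := h
  exact ⟨N, fun i hi => by simp [hN i _ (.inl hi)]⟩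

lemma BoxZero.finsum_eq {f : ℕ → ℕ → M} {N : ℕ} (hN : ∀ i j, N ≤ i ∨ N ≤ j → f i j = 0) :
    ∑ᶠ i, ∑ᶠ j, f i j = ∑ p ∈ range N ×ˢ range N, f p.1 p.2 := by
  rw [finsum_eq_sum_range (N := N) (fun i hi => by simp [hN i _ (.inl hi)]), Finset.sum_product]
  exact Finset.sum_congr rfl fun i _ => finsum_eq_sum_range fun j hj => hN i j (.inr hj)

lemma finsum_swap {f : ℕ → ℕ → M} (h : BoxZero f) :
    ∑ᶠ i, ∑ᶠ j, f i j = ∑ᶠ j, ∑ᶠ i, f i j := by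
  obtain ⟨N, hN⟩ := h
  rw [BoxZero.finsum_eq hN, BoxZero.finsum_eq (f := fun j i => f i j) (N := N)
    fun i j hij => hN j i hij.symm, Finset.sum_product, Finset.sum_product, Finset.sum_comm]

lemma finsum_antidiagonal {f : ℕ → ℕ → M} (h : BoxZero f) :
    ∑ᶠ n, ∑ p ∈ antidiagonal n, f p.1 p.2 = ∑ᶠ i, ∑ᶠ j, f i j := by
  obtain ⟨N, hN⟩ := h
  rw [BoxZero.finsum_eq hN, finsum_eq_sum_range (N := 2 * N), ← Finset.sum_fiberwise_of_maps_to
    (s := range N ×ˢ range N) (t := range (2 * N)) (g := fun p => p.1 + p.2)]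
  · refine Finset.sum_congr rfl fun n _ => (Finset.sum_subset ?_ ?_).symm
    · intro p hp
      simp only [mem_filter] at hp
      simpa using hp.2
    · intro p hp hp'
      refine hN _ _ ?_
      by_contra! hcon
      rw [HasAntidiagonal.mem_antidiagonal] at hp
      exact hp' (by simp [hp, hcon.1, hcon.2])
  · intro p hp
    simp only [mem_product, mem_range] at hp ⊢
    omega
  · intro n hn
    refine Finset.sum_eq_zero fun p hp => hN _ _ ?_
    rw [HasAntidiagonal.mem_antidiagonal] at hp
    omega

lemma finsum_shift {f : ℕ → M} (hf : EvZero f) (k : ℕ) :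
    ∑ᶠ j, (if k ≤ j then f (j - k) else 0) = ∑ᶠ j, f j := by
  obtain ⟨N, hN⟩ := hf
  rw [finsum_eq_sum_range hN, finsum_eq_sum_range (N := k + N), Finset.sum_range_add,
    Finset.sum_eq_zero, zero_add]
  · exact Finset.sum_congr rfl fun j _ => by simp
  · intro j hj
    rw [if_neg (by simpa using hj)]
  · intro j hj
    rw [if_pos (by omega)]
    exact hN _ (by omega)

/-- A sequence of vectors that vanishes for all large indices. -/
def Trunc (β : ℤ → M) : Prop := ∃ N : ℤ, ∀ n ≥ N, β n = 0

lemma Trunc.evZero {β : ℤ → M} (h : Trunc β) (n : ℤ) : EvZero fun j : ℕ => β (n + j) := by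
  obtain ⟨N, hN⟩ := h
  exact ⟨(N - n).toNat, fun k hk => hN _ (by omega)⟩

lemma Trunc.box {β : ℤ → M} (h : Trunc β) (n : ℤ) : BoxZero fun i j : ℕ => β (n + i + j) := by
  obtain ⟨N, hN⟩ := h
  exact ⟨(N - n).toNat, fun i j hij => hN _ (by omega)⟩

end FiniteSums

/-! ### Truncated fields and their dressings -/

section Fields

open Finset PowerSeries

variable {M : Type*} [AddCommGroup M] [Module ℂ M]

/-- A field `Y(z) = ∑_n Y_n z^{-n}` of operators on `M` whose modes `Y_n` kill every given vector
for all large `n`. -/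
@[ext]
structure TField (M : Type*) [AddCommGroup M] [Module ℂ M] where
  /-- The coefficient of `z^{-n}`. -/
  mode : ℤ → Module.End ℂ M
  trunc : ∀ v : M, ∃ N : ℤ, ∀ n ≥ N, mode n v = 0

instance : CoeFun (TField M) (fun _ => ℤ → Module.End ℂ M) := ⟨TField.mode⟩

/-- A series `V(z) = ∑_{j ≥ 0} V_j z^{-j}` of operators on `M` that is a polynomial in `z⁻¹` on
every vector. -/
structure FinSeq (M : Type*) [AddCommGroup M] [Module ℂ M] where
  /-- The coefficient of `z^{-j}`. -/
  mode : ℕ → Module.End ℂ M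
  fin : ∀ v : M, EvZero fun j => mode j v

instance : CoeFun (FinSeq M) (fun _ => ℕ → Module.End ℂ M) := ⟨FinSeq.mode⟩

lemma TField.evZero (Y : TField M) (n : ℤ) (v : M) : EvZero fun j : ℕ => Y (n + j) v :=
  Trunc.evZero (Y.trunc v) n

/-- The field `U(z) Y(z)`, where `U(z) = ∑_{j ≥ 0} U_j z^j`. -/
def lD (U : ℕ → Module.End ℂ M) (Y : TField M) : TField M where
  mode n :=
    { toFun := fun v => ∑ᶠ j : ℕ, U j (Y (n + j) v)
      map_add' := fun v w => by
        simp only [map_add]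
        exact finsum_add_of_evZero ((Y.evZero n v).map (fun k => U k) (by simp))
          ((Y.evZero n w).map (fun k => U k) (by simp))
      map_smul' := fun c v => by
        simp only [map_smul, RingHom.id_apply]
        rw [smul_finsum] }
  trunc v := by
    obtain ⟨N, hN⟩ := Y.trunc v
    refine ⟨N, fun n hn => ?_⟩
    refine finsum_eq_zero_of_forall_eq_zero fun j => ?_
    rw [hN (n + j) (by omega), map_zero]

lemma lD_apply (U : ℕ → Module.End ℂ M) (Y : TField M) (n : ℤ) (v : M) :
    lD U Y n v = ∑ᶠ j : ℕ, U j (Y (n + j) v) := rfl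

/-- The field `Y(z) V(z)`. -/
def rD (Y : TField M) (V : FinSeq M) : TField M where
  mode n :=
    { toFun := fun v => ∑ᶠ j : ℕ, Y (n - j) (V j v)
      map_add' := fun v w => by
        simp only [map_add]
        exact finsum_add_of_evZero ((V.fin v).map (fun k => Y (n - k)) (by simp))
          ((V.fin w).map (fun k => Y (n - k)) (by simp))
      map_smul' := fun c v => by
        simp only [map_smul, RingHom.id_apply]
        rw [smul_finsum] }
  trunc v := by
    obtain ⟨J, hJ⟩ := V.fin v
    choose N hN using fun j : ℕ => Y.trunc (V j v)
    refine ⟨∑ j ∈ range J, (|N j| + J), fun n hn => ?_⟩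
    simp only [LinearMap.coe_mk, AddHom.coe_mk]
    refine finsum_eq_zero_of_forall_eq_zero fun j => ?_
    by_cases hj : J ≤ j
    · have := hJ j hj
      simp only at this
      rw [this, map_zero]
    · refine hN j _ ?_
      have h1 := Finset.single_le_sum (f := fun j => |N j| + (J : ℤ)) (fun i _ => by positivity)
        (show j ∈ range J by simpa using hj)
      have h2 := le_abs_self (N j)
      have h3 : (j : ℤ) < J := by exact_mod_cast not_le.mp hj
      linarith

lemma rD_apply (Y : TField M) (V : FinSeq M) (n : ℤ) (v : M) :
    rD Y V n v = ∑ᶠ j : ℕ, Y (n - j) (V j v) := rfl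

/-- The constant field `1`. -/
def oneField : TField M where
  mode n := if n = 0 then 1 else 0
  trunc v := ⟨1, fun n hn => by rw [if_neg (by omega)]; rfl⟩

lemma oneField_apply (n : ℤ) (v : M) : (oneField : TField M) n v = if n = 0 then v else 0 := by
  change (if n = 0 then (1 : Module.End ℂ M) else 0) v = _
  split_ifs <;> rfl

lemma lD_box (U : ℕ → Module.End ℂ M) (Y : TField M) (V : FinSeq M) (n : ℤ) (v : M) :
    BoxZero fun j i : ℕ => U i (Y (n + i - j) (V j v)) := by
  refine BoxZero.of_nested ?_ fun j => ?_
  · obtain ⟨N, hN⟩ := V.fin v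
    exact ⟨N, fun j hj i => by simp [hN j hj]⟩
  · have h := (Y.evZero (n - j) (V j v)).map (fun i => U i) (by simp)
    simpa only [sub_add_eq_add_sub] using h

lemma lD_rD (U : ℕ → Module.End ℂ M) (Y : TField M) (V : FinSeq M) :
    lD U (rD Y V) = rD (lD U Y) V := by
  ext n v
  rw [lD_apply, rD_apply]
  have h : ∀ i : ℕ, U i (rD Y V (n + i) v) = ∑ᶠ j : ℕ, U i (Y (n + i - j) (V j v)) := fun i =>
    map_finsum_of_evZero (U i) ((V.fin v).map (fun k => Y (n + i - k)) (by simp))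
  simp only [h, lD_apply, sub_add_eq_add_sub]
  exact (finsum_swap (lD_box U Y V n v)).symm

/-- `[a_m, Y(z)] = γ_m z^m Y(z)` for all `m ≠ 0`. -/
def Primary (a : ℤ → Module.End ℂ M) (Y : TField M) (γ : ℤ → ℂ) : Prop :=
  ∀ m : ℤ, m ≠ 0 → ∀ n, a m * Y n - Y n * a m = γ m • Y (n + m)

lemma primary_oneField (a : ℤ → Module.End ℂ M) : Primary a oneField 0 := by
  intro m _ n
  ext v
  simp only [LinearMap.sub_apply, Module.End.mul_apply, oneField_apply, Pi.zero_apply, zero_smul,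
    LinearMap.zero_apply]
  split_ifs <;> simp

/-- `U_J A_m = ∑_{b + i = J} g_b A_{m-b} U_i`, that is `U(z₂) A(z₁) = g(z₂/z₁) A(z₁) U(z₂)`. -/
def LeftComm (U : ℕ → Module.End ℂ M) (A : TField M) (g : PowerSeries ℂ) : Prop :=
  ∀ (J : ℕ) (m : ℤ), U J * A m =
    ∑ p ∈ antidiagonal J, coeff p.1 g • (A (m - p.1) * U p.2)

/-- `B_n V_J = ∑_{b + i = J} g_b V_i B_{n+b}`, that is `B(z₂) V(z₁) = g(z₂/z₁) V(z₁) B(z₂)`. -/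
def RightComm (B : TField M) (V : FinSeq M) (g : PowerSeries ℂ) : Prop :=
  ∀ (J : ℕ) (n : ℤ), B n * V J =
    ∑ p ∈ antidiagonal J, coeff p.1 g • (V p.2 * B (n + p.1))

/-- Summing `U(z₂) A(z₁) = g(z₂/z₁) A(z₁) U(z₂)` over the modes of `U`: for a sequence `β`,
thought of as a series in `z₂`, the factor `g` is absorbed when `U` is moved to the left of `A`.
-/
lemma LeftComm.contract {U : ℕ → Module.End ℂ M} {A : TField M} {g : PowerSeries ℂ}
    (h : LeftComm U A g) {β : ℤ → M} (hβ : Trunc β) (m n : ℤ) :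
    ∑ᶠ b : ℕ, coeff b g • A (m - b) (∑ᶠ i : ℕ, U i (β (n + b + i))) =
      ∑ᶠ J : ℕ, U J (A m (β (n + J))) := by
  have hbox : BoxZero fun b i : ℕ => coeff b g • A (m - b) (U i (β (n + b + i))) :=
    (hβ.box n).map (fun b i x => coeff b g • A (m - b) (U i x)) (by simp)
  have h1 : ∀ b : ℕ, coeff b g • A (m - b) (∑ᶠ i : ℕ, U i (β (n + b + i))) =
      ∑ᶠ i : ℕ, coeff b g • A (m - b) (U i (β (n + b + i))) := fun b => by
    rw [map_finsum_of_evZero _ ((hβ.evZero (n + b)).map (fun i => U i) (by simp)), smul_finsum]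
  rw [finsum_congr h1, ← finsum_antidiagonal hbox]
  refine finsum_congr fun J => ?_
  rw [← Module.End.mul_apply, h J m, LinearMap.sum_apply]
  refine Finset.sum_congr rfl fun p hp => ?_
  rw [← HasAntidiagonal.mem_antidiagonal.mp hp]
  push_cast
  rw [← add_assoc]
  rfl

/-- Summing `B(z₂) V(z₁) = g(z₂/z₁) V(z₁) B(z₂)` over the modes of `V`: the factor `g` is absorbed
when `V` is moved to the right of `B`. -/
lemma RightComm.contract {B : TField M} {V : FinSeq M} {g : PowerSeries ℂ}
    (h : RightComm B V g) (Y : ℤ → Module.End ℂ M) (m n : ℤ) (v : M) :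
    ∑ᶠ b : ℕ, coeff b g • (∑ᶠ j : ℕ, Y (m - b - j) (V j (B (n + b) v))) =
      ∑ᶠ J : ℕ, Y (m - J) (B n (V J v)) := by
  have hbox : BoxZero fun b j : ℕ => coeff b g • Y (m - b - j) (V j (B (n + b) v)) := by
    refine BoxZero.of_nested ?_ fun b =>
      (V.fin (B (n + b) v)).map (fun j x => coeff b g • Y (m - b - j) x) (by simp)
    obtain ⟨N, hN⟩ := B.evZero n v
    exact ⟨N, fun b hb j => by simp [hN b hb]⟩
  simp only [smul_finsum]
  rw [← finsum_antidiagonal hbox]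
  refine finsum_congr fun J => ?_
  rw [← Module.End.mul_apply (B n), h J n, LinearMap.sum_apply, map_sum]
  refine Finset.sum_congr rfl fun p hp => ?_
  rw [← HasAntidiagonal.mem_antidiagonal.mp hp]
  push_cast
  rw [LinearMap.smul_apply, map_smul, ← sub_sub]
  rfl

/-- The coefficient of `z₁^{-m} z₂^{-n}` in `L(z₂/z₁) A(z₁) B(z₂) v`. -/
def pair (L : PowerSeries ℂ) (A B : TField M) (m n : ℤ) (v : M) : M :=
  ∑ᶠ k : ℕ, coeff k L • A (m - k) (B (n + k) v)

lemma pair_evZero (L : PowerSeries ℂ) (A B : TField M) (m n : ℤ) (v : M) :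
    EvZero fun k : ℕ => coeff k L • A (m - k) (B (n + k) v) :=
  (B.evZero n v).map (fun k x => coeff k L • A (m - k) x) (by simp)

lemma pair_one (A B : TField M) (m n : ℤ) (v : M) : pair 1 A B m n v = A m (B n v) := by
  rw [pair, finsum_eq_single _ 0]
  · simp
  · intro k hk; simp [coeff_one, hk]

/-- Multiplication by `L(z₂/z₁) g(z₂/z₁)` is multiplication by `g`, then by `L`. -/
lemma pair_mul (L g : PowerSeries ℂ) (A B : TField M) (m n : ℤ) (v : M) :
    pair (L * g) A B m n v = ∑ᶠ k : ℕ, coeff k L • pair g A B (m - k) (n + k) v := by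
  simp only [pair, smul_finsum, smul_smul]
  have hbox : BoxZero fun k i : ℕ =>
      (coeff k L * coeff i g) • A (m - k - i) (B (n + k + i) v) :=
    (Trunc.box (B.trunc v) n).map (fun k i x => (coeff k L * coeff i g) • A (m - k - i) x) (by simp)
  rw [← finsum_antidiagonal hbox]
  refine finsum_congr fun k => ?_
  rw [coeff_mul, Finset.sum_smul]
  refine Finset.sum_congr rfl fun p hp => ?_
  rw [← HasAntidiagonal.mem_antidiagonal.mp hp]
  push_cast
  rw [sub_sub, add_assoc]

/-- Dressing the second factor on the left. -/
lemma pair_lD_right {U : ℕ → Module.End ℂ M} {A : TField M} {g : PowerSeries ℂ}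
    (h : LeftComm U A g) (L : PowerSeries ℂ) (B : TField M) (m n : ℤ) (v : M) :
    pair (L * g) A (lD U B) m n v = ∑ᶠ J : ℕ, U J (pair L A B m (n + J) v) := by
  have h1 : ∀ k : ℕ, coeff k L • pair g A (lD U B) (m - k) (n + k) v =
      ∑ᶠ J : ℕ, coeff k L • U J (A (m - k) (B (n + k + J) v)) := fun k => by
    rw [← smul_finsum, ← h.contract (B.trunc v)]; rfl
  have hbox : BoxZero fun k J : ℕ => coeff k L • U J (A (m - k) (B (n + k + J) v)) :=
    (Trunc.box (B.trunc v) n).map (fun k J x => coeff k L • U J (A (m - k) x)) (by simp)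
  rw [pair_mul, finsum_congr h1, finsum_swap hbox]
  refine finsum_congr fun J => ?_
  rw [pair, map_finsum_of_evZero _ (pair_evZero ..)]
  refine finsum_congr fun k => ?_
  rw [map_smul, add_right_comm]

/-- Dressing the first factor on the left. -/
lemma pair_lD_left (U : ℕ → Module.End ℂ M) (L : PowerSeries ℂ) (A B : TField M) (m n : ℤ)
    (v : M) : pair L (lD U A) B m n v = ∑ᶠ J : ℕ, U J (pair L A B (m + J) n v) := by
  have hbox : BoxZero fun k J : ℕ => coeff k L • U J (A (m - k + J) (B (n + k) v)) := by
    refine BoxZero.of_nested ?_ fun k =>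
      (A.evZero (m - k) (B (n + k) v)).map (fun J x => coeff k L • U J x) (by simp)
    obtain ⟨N, hN⟩ := B.evZero n v
    exact ⟨N, fun b hb j => by simp [hN b hb]⟩
  simp only [pair, lD_apply, smul_finsum]
  rw [finsum_swap hbox]
  refine finsum_congr fun J => ?_
  have h2 := pair_evZero L A B (m + J) n v
  rw [map_finsum_of_evZero _ h2]
  refine finsum_congr fun k => ?_
  rw [map_smul, sub_add_eq_add_sub]

/-- Dressing the second factor on the right. -/
lemma pair_rD_right (L : PowerSeries ℂ) (A B : TField M) (V : FinSeq M) (m n : ℤ) (v : M) :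
    pair L A (rD B V) m n v = ∑ᶠ J : ℕ, pair L A B m (n - J) (V J v) := by
  have hbox : BoxZero fun J k : ℕ => coeff k L • A (m - k) (B (n + k - J) (V J v)) := by
    refine BoxZero.of_nested ?_ fun J => ?_
    · obtain ⟨N, hN⟩ := V.fin v
      exact ⟨N, fun b hb j => by simp [hN b hb]⟩
    · have := (B.evZero (n - J) (V J v)).map (fun k x => coeff k L • A (m - k) x) (by simp)
      simpa only [sub_add_eq_add_sub] using this
  have h1 : ∀ k : ℕ, coeff k L • A (m - k) (rD B V (n + k) v) =
      ∑ᶠ J : ℕ, coeff k L • A (m - k) (B (n + k - J) (V J v)) := fun k => by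
    rw [rD_apply, map_finsum_of_evZero _ ((V.fin v).map (fun J => B (n + k - J)) (by simp)),
      smul_finsum]
  rw [pair, finsum_congr h1, ← finsum_swap hbox]
  simp only [pair, sub_add_eq_add_sub]

/-- Dressing the first factor on the right. -/
lemma pair_rD_left {B : TField M} {V : FinSeq M} {g : PowerSeries ℂ} (h : RightComm B V g)
    (L : PowerSeries ℂ) (A : TField M) (m n : ℤ) (v : M) :
    pair (L * g) (rD A V) B m n v = ∑ᶠ J : ℕ, pair L A B (m - J) n (V J v) := by
  have h1 : ∀ k : ℕ, coeff k L • pair g (rD A V) B (m - k) (n + k) v =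
      ∑ᶠ J : ℕ, coeff k L • A (m - k - J) (B (n + k) (V J v)) := fun k => by
    rw [← smul_finsum, ← h.contract]; rfl
  have hbox : BoxZero fun J k : ℕ => coeff k L • A (m - k - J) (B (n + k) (V J v)) := by
    refine BoxZero.of_nested ?_ fun J =>
      (B.evZero n (V J v)).map (fun k x => coeff k L • A (m - k - J) x) (by simp)
    obtain ⟨N, hN⟩ := V.fin v
    exact ⟨N, fun b hb j => by simp [hN b hb]⟩
  rw [pair_mul, finsum_congr h1, ← finsum_swap hbox]
  simp only [pair, sub_right_comm]

end Fields

/-! ### Exchange relations under dressing -/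

section Exchange

open Finset PowerSeries

variable {M : Type*} [AddCommGroup M] [Module ℂ M]

lemma pair_evZero_right (L : PowerSeries ℂ) (A B : TField M) (m n : ℤ) (v : M) :
    EvZero fun J : ℕ => pair L A B m (n + J) v :=
  BoxZero.outer (((Trunc.box (B.trunc v) n)).map (fun _ k x => coeff k L • A (m - k) x) (by simp))

lemma pair_evZero_left (L : PowerSeries ℂ) (A B : TField M) (m n : ℤ) (v : M) :
    EvZero fun J : ℕ => pair L A B (m + J) n v := by
  refine BoxZero.outer (BoxZero.swap (BoxZero.of_nested
    (f := fun k J : ℕ => coeff k L • A (m + J - k) (B (n + k) v)) ?_ fun k => ?_))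
  · obtain ⟨N, hN⟩ := B.evZero n v
    exact ⟨N, fun b hb j => by simp [hN b hb]⟩
  · have := (A.evZero (m - k) (B (n + k) v)).map (fun _ x => coeff k L • x) (by simp)
    simpa only [sub_add_eq_add_sub] using this

lemma pair_zero (L : PowerSeries ℂ) (A B : TField M) (m n : ℤ) : pair L A B m n 0 = 0 := by
  simp [pair]

/-- `L(z₂/z₁) A(z₁) B(z₂) - C (z₂/z₁)^{-e} R(z₁/z₂) B(z₂) A(z₁) = D(z₁, z₂)` as an identity of
formal series. -/
def Exch (A B : TField M) (L R : PowerSeries ℂ) (C : ℂ) (e : ℤ) (D : ℤ → ℤ → M → M) : Prop :=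
  ∀ m n v, pair L A B m n v - C • pair R B A (n + e) (m - e) v = D m n v

variable {A B : TField M} {L R : PowerSeries ℂ} {C : ℂ} {e : ℤ} {D : ℤ → ℤ → M → M}

/-- Dressing `B(z₂)` by `U(z₂)` on the left: moving `U(z₂)` past `A(z₁)` multiplies the structure
function `L` by `g(z₂/z₁)`. -/
lemma Exch.lD_right (h : Exch A B L R C e D) {U : ℕ → Module.End ℂ M} {g : PowerSeries ℂ}
    (hU : LeftComm U A g) :
    Exch A (lD U B) (L * g) R C e fun m n v => ∑ᶠ J : ℕ, U J (D m (n + J) v) := by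
  intro m n v
  rw [pair_lD_right hU, pair_lD_left, smul_finsum, ← finsum_sub_of_evZero
    ((pair_evZero_right ..).map (fun J => U J) (by simp))
    ((pair_evZero_left ..).map (fun J x => C • U J x) (by simp))]
  refine finsum_congr fun J => ?_
  rw [← h m (n + J) v, map_sub, map_smul, add_right_comm]

/-- Dressing `A(z₁)` by `U(z₁)` on the left: moving `U(z₁)` past `B(z₂)` multiplies the structure
function `R` by `g(z₁/z₂)`. -/
lemma Exch.lD_left (h : Exch A B L R C e D) {U : ℕ → Module.End ℂ M} {g : PowerSeries ℂ}
    (hU : LeftComm U B g) :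
    Exch (lD U A) B L (R * g) C e fun m n v => ∑ᶠ J : ℕ, U J (D (m + J) n v) := by
  intro m n v
  rw [pair_lD_right hU, pair_lD_left, smul_finsum, ← finsum_sub_of_evZero
    ((pair_evZero_left ..).map (fun J => U J) (by simp))
    ((pair_evZero_right ..).map (fun J x => C • U J x) (by simp))]
  refine finsum_congr fun J => ?_
  rw [← h (m + J) n v, map_sub, map_smul, sub_add_eq_add_sub]

lemma FinSeq.evZero_map (V : FinSeq M) (v : M) (f : ℕ → M → M) (hf : ∀ k, f k 0 = 0) :
    EvZero fun J => f J (V J v) := (V.fin v).map f hf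

/-- Dressing `B(z₂)` by `V(z₂)` on the right: moving `V(z₂)` past `A(z₁)` multiplies the structure
function `R` by `g(z₁/z₂)`. -/
lemma Exch.rD_right (h : Exch A B L R C e D) {V : FinSeq M} {g : PowerSeries ℂ}
    (hV : RightComm A V g) :
    Exch A (rD B V) L (R * g) C e fun m n v => ∑ᶠ J : ℕ, D m (n - J) (V J v) := by
  intro m n v
  rw [pair_rD_left hV, pair_rD_right, smul_finsum, ← finsum_sub_of_evZero
    (V.evZero_map v (fun J x => pair L A B m (n - J) x) fun J => pair_zero ..)
    (V.evZero_map v (fun J x => C • pair R B A (n + e - J) (m - e) x) fun J => by simp [pair_zero])]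
  refine finsum_congr fun J => ?_
  rw [← h m (n - J), sub_add_eq_add_sub]

/-- Dressing `A(z₁)` by `V(z₁)` on the right: moving `V(z₁)` past `B(z₂)` multiplies the structure
function `L` by `g(z₂/z₁)`. -/
lemma Exch.rD_left (h : Exch A B L R C e D) {V : FinSeq M} {g : PowerSeries ℂ}
    (hV : RightComm B V g) :
    Exch (rD A V) B (L * g) R C e fun m n v => ∑ᶠ J : ℕ, D (m - J) n (V J v) := by
  intro m n v
  rw [pair_rD_left hV, pair_rD_right, smul_finsum, ← finsum_sub_of_evZero
    (V.evZero_map v (fun J x => pair L A B (m - J) n x) fun J => pair_zero ..)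
    (V.evZero_map v (fun J x => C • pair R B A (n + e) (m - e - J) x) fun J => by simp [pair_zero])]
  refine finsum_congr fun J => ?_
  rw [← h (m - J) n, sub_right_comm]

lemma Exch.congr_zero {D' : ℤ → ℤ → M → M} (h : Exch A B L R C e D)
    (hD : ∀ m n v, D m n v = D' m n v) : Exch A B L R C e D' := fun m n v => by
  rw [h m n v, hD]

lemma exch_oneField (B : TField M) : Exch oneField B 1 1 1 0 fun _ _ _ => 0 := by
  intro m n v
  rw [pair_one, pair_one, oneField_apply, oneField_apply, one_smul, sub_zero, add_zero]
  split_ifs <;> simp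

end Exchange

/-! ### Heisenberg algebras and their vertex operators -/

section Heisenberg

open Finset PowerSeries

variable {M : Type*} [AddCommGroup M] [Module ℂ M]

/-- Operators `a_m`, `m ≠ 0`, with `[a_m, a_n] = β_m δ_{m+n,0}`, such that every vector is killed
by `a_m` for large `m` and by a power of each `a_m`, `m > 0`. -/
structure HeisData (M : Type*) [AddCommGroup M] [Module ℂ M] where
  /-- The operator `a_m`, with the convention `a_0 = 0`. -/
  a : ℤ → Module.End ℂ M
  /-- The central term. -/
  β : ℤ → ℂ
  a_zero : a 0 = 0
  bracket : ∀ m n, m ≠ 0 → n ≠ 0 →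
    a m * a n - a n * a m = if m + n = 0 then algebraMap ℂ _ (β m) else 0
  trunc : ∀ v : M, ∃ N : ℤ, ∀ m ≥ N, a m v = 0
  nilp : ∀ (v : M) (m : ℤ), 0 < m → ∃ k : ℕ, ((a m) ^ k) v = 0

namespace HeisData

variable (𝔥 : HeisData M)

lemma commute_of_ne {m n : ℤ} (h : m + n ≠ 0) : Commute (𝔥.a m) (𝔥.a n) := by
  by_cases hm : m = 0
  · rw [hm, 𝔥.a_zero]; exact Commute.zero_left _
  by_cases hn : n = 0
  · rw [hn, 𝔥.a_zero]; exact Commute.zero_right _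
  have := 𝔥.bracket m n hm hn
  rw [if_neg h, sub_eq_zero] at this
  exact this

lemma commute_pos (i j : ℕ) : Commute (𝔥.a i) (𝔥.a j) := by
  by_cases h : (i : ℤ) + j = 0
  · have : i = j := by omega
    rw [this]
  · exact 𝔥.commute_of_ne h

lemma commute_neg (i j : ℕ) : Commute (𝔥.a (-i)) (𝔥.a (-j)) := by
  by_cases h : (-i : ℤ) + -j = 0
  · have : i = j := by omega
    rw [this]
  · exact 𝔥.commute_of_ne h

lemma commute_up (u w : ℕ → ℂ) (i j : ℕ) : Commute (u i • 𝔥.a (-i)) (w j • 𝔥.a (-j)) :=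
  ((𝔥.commute_neg i j).smul_right _).smul_left _

lemma commute_dn (u w : ℕ → ℂ) (i j : ℕ) : Commute (u i • 𝔥.a i) (w j • 𝔥.a j) :=
  ((𝔥.commute_pos i j).smul_right _).smul_left _

/-- `exp (∑_{m > 0} u_m a_{-m} z^m)`. -/
def up (u : ℕ → ℂ) : ℕ → Module.End ℂ M := expCoeff fun m => u m • 𝔥.a (-m)

/-- `exp (∑_{m > 0} v_m a_m z^{-m})`. -/
def dn (v : ℕ → ℂ) : FinSeq M where
  mode := expCoeff fun m : ℕ => v m • 𝔥.a m
  fin x := by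
    refine exists_expCoeff_apply_eq_zero (𝔥.commute_dn v v) x ?_ fun m hm => ?_
    · obtain ⟨N, hN⟩ := 𝔥.trunc x
      exact ⟨N.toNat, fun m hm => by
        rw [LinearMap.smul_apply, hN m (by omega), smul_zero]⟩
    · obtain ⟨k, hk⟩ := 𝔥.nilp x m (by exact_mod_cast hm)
      exact ⟨k, by rw [smul_pow, LinearMap.smul_apply, hk, smul_zero]⟩

variable {𝔥}

/-- A creation exponential moves past a primary field at the cost of a scalar exponential. -/
lemma leftComm {A : TField M} {γ : ℤ → ℂ} (h : Primary 𝔥.a A γ) (u : ℕ → ℂ) :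
    LeftComm (𝔥.up u) A (expSeries fun m => u m * γ (-m)) := by
  intro J m
  have := expCoeff_mul_primary (𝔥.commute_up u u) (X := fun j => A (-j))
    (γ := fun m => u m * γ (-m)) (fun m hm j => by
      rw [smul_mul_assoc, mul_smul_comm, ← smul_sub, h (-m) (by omega), smul_smul]
      congr 2; ring) J (-m)
  simp only [neg_neg] at this
  rw [up, this]
  refine Finset.sum_congr rfl fun p _ => ?_
  rw [coeff_expSeries]
  congr 3; ring

/-- A primary field moves past an annihilation exponential at the cost of a scalar exponential. -/
lemma rightComm {B : TField M} {γ : ℤ → ℂ} (h : Primary 𝔥.a B γ) (v : ℕ → ℂ) :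
    RightComm B (𝔥.dn v) (expSeries fun m => -(v m * γ m)) := by
  intro J n
  have := primary_mul_expCoeff (𝔥.commute_dn v v) (X := fun j => B j)
    (γ := fun m => v m * γ m) (fun m hm j => by
      rw [smul_mul_assoc, mul_smul_comm, ← smul_sub, h m (by omega), smul_smul]) J n
  simp only [coeff_expSeries]
  exact this

lemma bracket_up_pos (u : ℕ → ℂ) {m : ℕ} (hm : 0 < m) (j : ℕ) :
    𝔥.a m * 𝔥.up u j - 𝔥.up u j * 𝔥.a m =
      if m ≤ j then (u m * 𝔥.β m) • 𝔥.up u (j - m) else 0 := by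
  refine bracket_expCoeff (𝔥.commute_up u u) hm (fun k hk => ?_) j
  rw [mul_smul_comm, smul_mul_assoc, ← smul_sub, 𝔥.bracket m (-k) (by omega) (by omega)]
  by_cases hkm : k = m
  · subst hkm
    rw [if_pos (by ring), if_pos rfl, Algebra.algebraMap_eq_smul_one, smul_smul,
      Algebra.algebraMap_eq_smul_one]
  · rw [if_neg (by omega), if_neg hkm, smul_zero]

lemma commute_up_neg (u : ℕ → ℂ) (m j : ℕ) : Commute (𝔥.a (-m)) (𝔥.up u j) :=
  commute_expCoeff (fun i => (𝔥.commute_neg m i).smul_right _) j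

lemma bracket_dn_neg (v : ℕ → ℂ) {m : ℕ} (hm : 0 < m) (j : ℕ) :
    𝔥.a (-m) * 𝔥.dn v j - 𝔥.dn v j * 𝔥.a (-m) =
      if m ≤ j then (v m * 𝔥.β (-m)) • 𝔥.dn v (j - m) else 0 := by
  refine bracket_expCoeff (𝔥.commute_dn v v) hm (fun k hk => ?_) j
  rw [mul_smul_comm, smul_mul_assoc, ← smul_sub, 𝔥.bracket (-m) k (by omega) (by omega)]
  by_cases hkm : k = m
  · subst hkm
    rw [if_pos (by ring), if_pos rfl, Algebra.algebraMap_eq_smul_one, smul_smul,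
      Algebra.algebraMap_eq_smul_one]
  · rw [if_neg (by omega), if_neg hkm, smul_zero]

lemma commute_dn_pos (v : ℕ → ℂ) (m j : ℕ) : Commute (𝔥.a m) (𝔥.dn v j) :=
  commute_expCoeff (fun i => (𝔥.commute_pos m i).smul_right _) j

/-- The charges of `exp (∑ u_m a_{-m} z^m) Y(z)`. -/
lemma primary_lD {Y : TField M} {γ : ℤ → ℂ} (h : Primary 𝔥.a Y γ) (u : ℕ → ℂ) :
    Primary 𝔥.a (lD (𝔥.up u) Y)
      fun m => γ m + if 0 < m then u m.toNat * 𝔥.β m else 0 := by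
  intro m hm n
  ext x
  simp only [LinearMap.sub_apply, Module.End.mul_apply, LinearMap.smul_apply, lD_apply]
  have hY : ∀ n, 𝔥.a m (Y n x) = Y n (𝔥.a m x) + γ m • Y (n + m) x := fun n => by
    have := LinearMap.congr_fun (h m hm n) x
    simp only [LinearMap.sub_apply, Module.End.mul_apply, LinearMap.smul_apply] at this
    rw [← this]; abel
  have e1 := Y.evZero n x
  have e2 := (Y.evZero n (𝔥.a m x)).map (fun j => 𝔥.up u j) (by simp)
  have e3 := (Y.evZero (n + m) x).map (fun j => 𝔥.up u j) (by simp)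
  rw [map_finsum_of_evZero _ (e1.map (fun j => 𝔥.up u j) (by simp))]
  rcases lt_or_gt_of_ne hm with hneg | hpos
  · obtain ⟨k, rfl⟩ : ∃ k : ℕ, m = -k := ⟨m.natAbs, by omega⟩
    rw [if_neg (by omega), add_zero]
    have h1 : ∀ j : ℕ, 𝔥.a (-k) (𝔥.up u j (Y (n + j) x)) =
        𝔥.up u j (Y (n + j) (𝔥.a (-k) x)) + γ (-k) • 𝔥.up u j (Y (n + -k + j) x) := fun j => by
      rw [← Module.End.mul_apply, (commute_up_neg u k j).eq, Module.End.mul_apply, hY, map_add,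
        map_smul, add_right_comm]
    rw [finsum_congr h1, finsum_add_of_evZero e2 (e3.map (fun _ y => γ (-k) • y) (by simp)),
      add_sub_cancel_left, smul_finsum]
  · obtain ⟨k, rfl⟩ : ∃ k : ℕ, m = k := ⟨m.toNat, by omega⟩
    have hk : 0 < k := by exact_mod_cast hpos
    rw [if_pos hpos, Int.toNat_natCast]
    have h1 : ∀ j : ℕ, 𝔥.a k (𝔥.up u j (Y (n + j) x)) =
        (𝔥.up u j (Y (n + j) (𝔥.a k x)) + γ k • 𝔥.up u j (Y (n + k + j) x)) +
        if k ≤ j then (u k * 𝔥.β k) • 𝔥.up u (j - k) (Y (n + k + (j - k : ℕ)) x) else 0 :=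
      fun j => by
        have := LinearMap.congr_fun (bracket_up_pos (𝔥 := 𝔥) u hk j) (Y (n + j) x)
        rw [LinearMap.sub_apply, Module.End.mul_apply, Module.End.mul_apply, sub_eq_iff_eq_add,
          hY, map_add, map_smul] at this
        rw [this, add_comm, add_right_comm n]
        congr 1
        split_ifs with hkj
        · rw [LinearMap.smul_apply]
          congr 4; push_cast [hkj]; ring
        · rfl
    have e4 := e3.map (fun _ y => (u k * 𝔥.β k) • y) (by simp)
    have e5 : EvZero fun j : ℕ => if k ≤ j then (u k * 𝔥.β k) • 𝔥.up u (j - k)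
        (Y (n + k + (j - k : ℕ)) x) else 0 := e4.shift k
    have e6 := e3.map (fun _ y => γ k • y) (by simp)
    have e7 : EvZero fun j : ℕ => 𝔥.up u j (Y (n + j) (𝔥.a k x)) +
        γ k • 𝔥.up u j (Y (n + k + j) x) := e2.add e6
    rw [finsum_congr h1, finsum_add_of_evZero e7 e5, finsum_add_of_evZero e2 e6,
      finsum_shift (f := fun j : ℕ => (u k * 𝔥.β k) • 𝔥.up u j (Y (n + k + j) x)) e4, add_assoc,
      add_sub_cancel_left, ← smul_finsum, ← smul_finsum, ← add_smul]

/-- The charges of `Y(z) exp (∑ v_m a_m z^{-m})`. -/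
lemma primary_rD {Y : TField M} {γ : ℤ → ℂ} (h : Primary 𝔥.a Y γ) (v : ℕ → ℂ) :
    Primary 𝔥.a (rD Y (𝔥.dn v))
      fun m => γ m + if m < 0 then v (-m).toNat * 𝔥.β m else 0 := by
  intro m hm n
  ext x
  simp only [LinearMap.sub_apply, Module.End.mul_apply, LinearMap.smul_apply, rD_apply]
  have hY : ∀ n x, 𝔥.a m (Y n x) = Y n (𝔥.a m x) + γ m • Y (n + m) x := fun n x => by
    have := LinearMap.congr_fun (h m hm n) x
    simp only [LinearMap.sub_apply, Module.End.mul_apply, LinearMap.smul_apply] at this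
    rw [← this]; abel
  have e2 := (𝔥.dn v).evZero_map (𝔥.a m x) (fun j => Y (n - j)) (by simp)
  have e3 := (𝔥.dn v).evZero_map x (fun j => Y (n + m - j)) (by simp)
  rw [map_finsum_of_evZero _ ((𝔥.dn v).evZero_map x (fun j => Y (n - j)) (by simp))]
  rcases lt_or_gt_of_ne hm with hneg | hpos
  · obtain ⟨k, rfl⟩ : ∃ k : ℕ, m = -k := ⟨m.natAbs, by omega⟩
    have hk : 0 < k := by omega
    rw [if_pos hneg, neg_neg, Int.toNat_natCast]
    have h1 : ∀ j : ℕ, 𝔥.a (-k) (Y (n - j) (𝔥.dn v j x)) =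
        (Y (n - j) (𝔥.dn v j (𝔥.a (-k) x)) + γ (-k) • Y (n + -k - j) (𝔥.dn v j x)) +
        if k ≤ j then (v k * 𝔥.β (-k)) • Y (n + -k - (j - k : ℕ)) (𝔥.dn v (j - k) x) else 0 :=
      fun j => by
        have := LinearMap.congr_fun (bracket_dn_neg (𝔥 := 𝔥) v hk j) x
        rw [LinearMap.sub_apply, Module.End.mul_apply, Module.End.mul_apply,
          sub_eq_iff_eq_add] at this
        rw [hY, this, map_add, add_comm, add_comm (Y (n - j) _), ← add_assoc]
        congr 1
        · rw [add_comm, sub_add_eq_add_sub]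
        · split_ifs with hkj
          · rw [LinearMap.smul_apply, map_smul]
            congr 3; push_cast [hkj]; ring
          · simp
    have e4 := e3.map (fun _ y => (v k * 𝔥.β (-k)) • y) (by simp)
    have e5 : EvZero fun j : ℕ => if k ≤ j then (v k * 𝔥.β (-k)) •
        Y (n + -k - (j - k : ℕ)) (𝔥.dn v (j - k) x) else 0 := e4.shift k
    have e6 := e3.map (fun _ y => γ (-k) • y) (by simp)
    have e7 : EvZero fun j : ℕ => Y (n - j) (𝔥.dn v j (𝔥.a (-k) x)) +
        γ (-k) • Y (n + -k - j) (𝔥.dn v j x) := e2.add e6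
    rw [finsum_congr h1, finsum_add_of_evZero e7 e5, finsum_add_of_evZero e2 e6,
      finsum_shift (f := fun j : ℕ => (v k * 𝔥.β (-k)) • Y (n + -k - j) (𝔥.dn v j x)) e4,
      add_assoc, add_sub_cancel_left, ← smul_finsum, ← smul_finsum, ← add_smul]
  · obtain ⟨k, rfl⟩ : ∃ k : ℕ, m = k := ⟨m.toNat, by omega⟩
    rw [if_neg (by omega), add_zero]
    have h1 : ∀ j : ℕ, 𝔥.a k (Y (n - j) (𝔥.dn v j x)) =
        Y (n - j) (𝔥.dn v j (𝔥.a k x)) + γ k • Y (n + k - j) (𝔥.dn v j x) := fun j => by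
      rw [hY, ← Module.End.mul_apply (𝔥.a k), (commute_dn_pos v k j).eq, Module.End.mul_apply,
        sub_add_eq_add_sub]
    rw [finsum_congr h1, finsum_add_of_evZero e2 (e3.map (fun _ y => γ k • y) (by simp)),
      add_sub_cancel_left, smul_finsum]

end HeisData

end Heisenberg

/-! ### Triple products -/

section Triple

open Finset PowerSeries

variable {M : Type*} [AddCommGroup M]

/-- The triple sequence `F` vanishes outside some finite box. -/
def Box3 (F : ℕ → ℕ → ℕ → M) : Prop := ∃ N, ∀ i j k, N ≤ i ∨ N ≤ j ∨ N ≤ k → F i j k = 0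

lemma Box3.finite {F : ℕ → ℕ → ℕ → M} (h : Box3 F) :
    (fun n : ℕ × ℕ × ℕ => F n.1 n.2.1 n.2.2).HasFiniteSupport := by
  obtain ⟨N, hN⟩ := h
  refine ((Set.finite_lt_nat N).prod ((Set.finite_lt_nat N).prod (Set.finite_lt_nat N))).subset
    fun n hn => ?_
  simp only [Set.mem_prod, Set.mem_ofPred_eq]
  by_contra hcon
  exact hn (hN _ _ _ (by omega))

lemma Box3.rev {F : ℕ → ℕ → ℕ → M} (h : Box3 F) : Box3 fun k j i => F i j k := by
  obtain ⟨N, hN⟩ := h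
  exact ⟨N, fun i j k hij => hN _ _ _ (by tauto)⟩

lemma Box3.outer {F : ℕ → ℕ → ℕ → M} (h : Box3 F) : EvZero fun i => ∑ᶠ j, ∑ᶠ k, F i j k := by
  obtain ⟨N, hN⟩ := h
  exact ⟨N, fun i hi => by simp [hN i _ _ (.inl hi)]⟩

lemma Box3.finsum_eq {F : ℕ → ℕ → ℕ → M} (h : Box3 F) :
    ∑ᶠ n : ℕ × ℕ × ℕ, F n.1 n.2.1 n.2.2 = ∑ᶠ i, ∑ᶠ j, ∑ᶠ k, F i j k :=
  finsum_curry₃ _ h.finite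

lemma Box3.finsum_eq_rev {F : ℕ → ℕ → ℕ → M} (h : Box3 F) :
    ∑ᶠ n : ℕ × ℕ × ℕ, F n.1 n.2.1 n.2.2 = ∑ᶠ k, ∑ᶠ j, ∑ᶠ i, F i j k := by
  rw [← h.rev.finsum_eq]
  let e : ℕ × ℕ × ℕ ≃ ℕ × ℕ × ℕ :=
    ⟨fun n => (n.2.2, n.2.1, n.1), fun n => (n.2.2, n.2.1, n.1), fun _ => rfl, fun _ => rfl⟩
  exact (finsum_comp_equiv e (f := fun n : ℕ × ℕ × ℕ => F n.2.2 n.2.1 n.1))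

/-- Triples of naturals as functions on `Fin 3`. -/
def tripleEquiv : ℕ × ℕ × ℕ ≃ (Fin 3 → ℕ) where
  toFun n := ![n.1, n.2.1, n.2.2]
  invFun J := (J 0, J 1, J 2)
  left_inv n := by simp
  right_inv J := by ext i; fin_cases i <;> rfl

lemma Box3.finsum_eq_fin {F : ℕ → ℕ → ℕ → M} (h : Box3 F) :
    ∑ᶠ i, ∑ᶠ j, ∑ᶠ k, F i j k = ∑ᶠ J : Fin 3 → ℕ, F (J 0) (J 1) (J 2) := by
  rw [← h.finsum_eq]
  exact (finsum_comp_equiv tripleEquiv (f := fun J => F (J 0) (J 1) (J 2)))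

lemma Box3.finite_fin {F : ℕ → ℕ → ℕ → M} (h : Box3 F) :
    (fun J : Fin 3 → ℕ => F (J 0) (J 1) (J 2)).HasFiniteSupport := by
  obtain ⟨N, hN⟩ := h
  refine (Set.Finite.pi' (ι := Fin 3) (t := fun _ => {k : ℕ | k < N})
    fun _ => Set.finite_lt_nat N).subset fun J hJ => ?_
  simp only [Set.mem_ofPred_eq]
  intro i
  by_contra hcon
  refine hJ (hN _ _ _ ?_)
  fin_cases i <;> simp only [Fin.mk_zero, Fin.mk_one, Fin.reduceFinMk] at hcon <;> omega

variable [Module ℂ M]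

/-- A factor `1 - c w` of a structure function becomes a difference of shifted sums. -/
lemma finsum_one_sub_mul (c : ℂ) (g : PowerSeries ℂ) {Φ : ℕ → M} (hΦ : EvZero Φ) :
    ∑ᶠ n, coeff n ((1 - PowerSeries.C c * X) * g) • Φ n =
      ∑ᶠ n, coeff n g • Φ n - c • ∑ᶠ n, coeff n g • Φ (n + 1) := by
  have hs : EvZero fun n => (c * coeff n g) • Φ (n + 1) := by
    obtain ⟨N, hN⟩ := hΦ
    exact ⟨N, fun k hk => by simp only [hN (k + 1) (by omega), smul_zero]⟩
  have h1 : ∀ n, coeff n ((1 - PowerSeries.C c * X) * g) • Φ n = coeff n g • Φ n -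
      if 1 ≤ n then (c * coeff (n - 1) g) • Φ (n - 1 + 1) else 0 := by
    intro n
    rw [sub_mul, one_mul, map_sub, mul_assoc, coeff_C_mul, sub_smul]
    rcases n with _ | n
    · simp
    · simp [coeff_succ_X_mul]
  rw [finsum_congr h1, finsum_sub_of_evZero (hΦ.map (fun n x => coeff n g • x) (by simp))
    (hs.shift 1), finsum_shift hs, smul_finsum]
  simp only [mul_smul]

/-- The coefficient of `z₁^{-m₁} z₂^{-m₂} z₃^{-m₃}` in
`L₂₁(z₂/z₁) L₃₁(z₃/z₁) L₃₂(z₃/z₂) A(z₁) B(z₂) C(z₃) v`. -/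
def triple (L₂₁ L₃₁ L₃₂ : PowerSeries ℂ) (A B C : TField M) (m₁ m₂ m₃ : ℤ) (v : M) : M :=
  ∑ᶠ n : ℕ × ℕ × ℕ, (coeff n.1 L₂₁ * coeff n.2.1 L₃₁ * coeff n.2.2 L₃₂) •
    A (m₁ - n.1 - n.2.1) (B (m₂ + n.1 - n.2.2) (C (m₃ + n.2.1 + n.2.2) v))

lemma triple_box (L₂₁ L₃₁ L₃₂ : PowerSeries ℂ) (A B C : TField M) (m₁ m₂ m₃ : ℤ) (v : M) :
    Box3 fun i j k : ℕ => (coeff i L₂₁ * coeff j L₃₁ * coeff k L₃₂) •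
      A (m₁ - i - j) (B (m₂ + i - k) (C (m₃ + j + k) v)) := by
  obtain ⟨N, hN⟩ := Trunc.box (C.trunc v) m₃
  have h2 : ∀ j k : ℕ, ∃ K : ℕ, ∀ i ≥ K, B (m₂ + i - k) (C (m₃ + j + k) v) = 0 := fun j k => by
    obtain ⟨K, hK⟩ := B.evZero (m₂ - k) (C (m₃ + j + k) v)
    exact ⟨K, fun i hi => by
      have := hK i hi
      simp only [sub_add_eq_add_sub] at this
      exact this⟩
  choose K hK using h2
  refine ⟨max N (∑ j ∈ range N, ∑ k ∈ range N, K j k), fun i j k h => ?_⟩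
  by_cases hj : N ≤ j ∨ N ≤ k
  · have := hN j k hj
    simp only at this
    simp [this]
  · simp only
    rw [hK j k i, map_zero, smul_zero]
    have h4 : K j k ≤ ∑ k ∈ range N, K j k :=
      Finset.single_le_sum (f := fun k => K j k) (fun _ _ => Nat.zero_le _)
        (show k ∈ range N by simp; omega)
    have h5 : ∑ k ∈ range N, K j k ≤ ∑ j ∈ range N, ∑ k ∈ range N, K j k :=
      Finset.single_le_sum (f := fun j => ∑ k ∈ range N, K j k) (fun _ _ => Nat.zero_le _)
        (show j ∈ range N by simp; omega)
    omega

lemma triple_eq (L₂₁ L₃₁ L₃₂ : PowerSeries ℂ) (A B C : TField M) (m₁ m₂ m₃ : ℤ) (v : M) :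
    triple L₂₁ L₃₁ L₃₂ A B C m₁ m₂ m₃ v =
      ∑ᶠ i : ℕ, coeff i L₂₁ • ∑ᶠ j : ℕ, coeff j L₃₁ • ∑ᶠ k : ℕ, coeff k L₃₂ •
        A (m₁ - i - j) (B (m₂ + i - k) (C (m₃ + j + k) v)) := by
  rw [triple, (triple_box L₂₁ L₃₁ L₃₂ A B C m₁ m₂ m₃ v).finsum_eq]
  simp only [smul_finsum, mul_smul]

lemma triple_eq_rev (L₂₁ L₃₁ L₃₂ : PowerSeries ℂ) (A B C : TField M) (m₁ m₂ m₃ : ℤ) (v : M) :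
    triple L₂₁ L₃₁ L₃₂ A B C m₁ m₂ m₃ v =
      ∑ᶠ k : ℕ, coeff k L₃₂ • ∑ᶠ j : ℕ, coeff j L₃₁ • ∑ᶠ i : ℕ, coeff i L₂₁ •
        A (m₁ - i - j) (B (m₂ + i - k) (C (m₃ + j + k) v)) := by
  rw [triple, (triple_box L₂₁ L₃₁ L₃₂ A B C m₁ m₂ m₃ v).finsum_eq_rev]
  simp only [smul_finsum, smul_smul]
  refine finsum_congr fun k => finsum_congr fun j => finsum_congr fun i => ?_
  congr 1; ring

/-- Multiplying the structure function in `z₂/z₁` by `1 - c z₂/z₁`. -/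
lemma triple_one_sub_left (c : ℂ) (L₂₁ L₃₁ L₃₂ : PowerSeries ℂ) (A B C : TField M)
    (m₁ m₂ m₃ : ℤ) (v : M) :
    triple ((1 - PowerSeries.C c * X) * L₂₁) L₃₁ L₃₂ A B C m₁ m₂ m₃ v =
      triple L₂₁ L₃₁ L₃₂ A B C m₁ m₂ m₃ v -
        c • triple L₂₁ L₃₁ L₃₂ A B C (m₁ - 1) (m₂ + 1) m₃ v := by
  have h := (triple_box (PowerSeries.mk 1) L₃₁ L₃₂ A B C m₁ m₂ m₃ v).outer
  simp only [coeff_mk, Pi.one_apply, one_mul, mul_smul, ← smul_finsum] at h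
  rw [triple_eq, finsum_one_sub_mul c L₂₁ h, triple_eq, triple_eq]
  congr 2
  refine finsum_congr fun i => ?_
  congr 1
  refine finsum_congr fun j => ?_
  congr 1
  refine finsum_congr fun k => ?_
  push_cast
  congr 2
  · congr 1; ring
  · congr 2; ring

/-- Multiplying the structure function in `z₃/z₂` by `1 - c z₃/z₂`. -/
lemma triple_one_sub_right (c : ℂ) (L₂₁ L₃₁ L₃₂ : PowerSeries ℂ) (A B C : TField M)
    (m₁ m₂ m₃ : ℤ) (v : M) :
    triple L₂₁ L₃₁ ((1 - PowerSeries.C c * X) * L₃₂) A B C m₁ m₂ m₃ v =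
      triple L₂₁ L₃₁ L₃₂ A B C m₁ m₂ m₃ v -
        c • triple L₂₁ L₃₁ L₃₂ A B C m₁ (m₂ - 1) (m₃ + 1) v := by
  have h := (triple_box L₂₁ L₃₁ (PowerSeries.mk 1) A B C m₁ m₂ m₃ v).rev.outer
  simp only [coeff_mk, Pi.one_apply, mul_one, mul_comm (coeff _ L₂₁), mul_smul,
    ← smul_finsum] at h
  rw [triple_eq_rev, finsum_one_sub_mul c L₃₂ h, triple_eq_rev, triple_eq_rev]
  congr 2
  refine finsum_congr fun k => ?_
  congr 1
  refine finsum_congr fun j => ?_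
  congr 1
  refine finsum_congr fun i => ?_
  push_cast
  congr 3
  · congr 1; ring
  · congr 2; ring

/-- Three fields `U(z) X(z)` in normal order. -/
lemma triple_lD {U : ℕ → Module.End ℂ M} {X : TField M} {g : PowerSeries ℂ}
    (h : LeftComm U (lD U X) g) (m₁ m₂ m₃ : ℤ) (v : M) :
    triple g g g (lD U X) (lD U X) (lD U X) m₁ m₂ m₃ v =
      ∑ᶠ J₃ : ℕ, ∑ᶠ J₂ : ℕ, ∑ᶠ J₁ : ℕ,
        U J₃ (U J₂ (U J₁ (X (m₁ + J₁) (X (m₂ + J₂) (X (m₃ + J₃) v))))) := by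
  set E := lD U X with hE
  have hp : ∀ m n v, pair g E E m n v = ∑ᶠ J : ℕ, U J (E m (X (n + J) v)) := fun m n v => by
    have := pair_lD_right h 1 X m n v
    rw [one_mul, ← hE] at this
    simpa only [pair_one] using this
  -- the series in `z₃/z₂` moves the dressing of the third factor past the second, the series in
  -- `z₃/z₁` moves it past the first; the series in `z₂/z₁` does the same for the second factor
  have h1 : ∀ i j : ℕ, ∑ᶠ k : ℕ, coeff k g • E (m₁ - i - j) (E (m₂ + i - k) (E (m₃ + j + k) v)) =
      E (m₁ - i - j) (∑ᶠ J : ℕ, U J (E (m₂ + i) (X (m₃ + j + J) v))) := fun i j => by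
    rw [← hp, pair, map_finsum_of_evZero _ (pair_evZero ..)]
    simp only [map_smul]
  have hβ : ∀ i : ℕ, Trunc fun x => E (m₂ + i) (X x v) := fun i => by
    obtain ⟨N, hN⟩ := X.trunc v
    exact ⟨N, fun n hn => by simp only [hN n hn, map_zero]⟩
  have h2 : ∀ i : ℕ, ∑ᶠ j : ℕ, coeff j g •
      E (m₁ - i - j) (∑ᶠ J : ℕ, U J (E (m₂ + i) (X (m₃ + j + J) v))) =
      ∑ᶠ J : ℕ, U J (E (m₁ - i) (E (m₂ + i) (X (m₃ + J) v))) := fun i =>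
    h.contract (hβ i) (m₁ - i) m₃
  have hbox : BoxZero fun i J : ℕ =>
      coeff i g • U J (E (m₁ - i) (E (m₂ + i) (X (m₃ + J) v))) := by
    refine BoxZero.swap (BoxZero.of_nested
      (f := fun J i : ℕ => coeff i g • U J (E (m₁ - i) (E (m₂ + i) (X (m₃ + J) v)))) ?_ fun J => ?_)
    · obtain ⟨N, hN⟩ := X.evZero m₃ v
      exact ⟨N, fun J hJ i => by simp [hN J hJ]⟩
    · exact (E.evZero m₂ (X (m₃ + J) v)).map (fun i x => coeff i g • U J (E (m₁ - i) x)) (by simp)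
  rw [triple_eq]
  simp only [h1, h2]
  simp only [smul_finsum]
  rw [finsum_swap hbox]
  refine finsum_congr fun J₃ => ?_
  have h3 := hp m₁ m₂ (X (m₃ + J₃) v)
  have e2 := (X.evZero m₂ (X (m₃ + J₃) v)).map (fun J x => U J (E m₁ x)) (by simp)
  calc _ = U J₃ (pair g E E m₁ m₂ (X (m₃ + J₃) v)) := by
        rw [pair, map_finsum_of_evZero _ (pair_evZero ..)]
        simp only [map_smul]
    _ = _ := by
        rw [h3, map_finsum_of_evZero _ e2]
        refine finsum_congr fun J₂ => ?_
        rw [hE, lD_apply]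
        have e3 := (X.evZero m₁ (X (m₂ + J₂) (X (m₃ + J₃) v))).map (fun J => U J) (by simp)
        rw [map_finsum_of_evZero _ e3,
          map_finsum_of_evZero _ (e3.map (fun _ => U J₂) (by simp))]

lemma triple_lD_box (U : ℕ → Module.End ℂ M) (X : TField M) (m₁ m₂ m₃ : ℤ) (v : M) :
    Box3 fun J₃ J₂ J₁ : ℕ =>
      U J₃ (U J₂ (U J₁ (X (m₁ + J₁) (X (m₂ + J₂) (X (m₃ + J₃) v))))) := by
  obtain ⟨N, hN⟩ := X.evZero m₃ v
  choose K hK using fun J₃ : ℕ => X.evZero m₂ (X (m₃ + J₃) v)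
  choose T hT using fun J₃ J₂ : ℕ => X.evZero m₁ (X (m₂ + J₂) (X (m₃ + J₃) v))
  refine ⟨N + ∑ j ∈ range N, (K j + ∑ k ∈ range (K j), T j k), fun J₃ J₂ J₁ h => ?_⟩
  by_cases h₃ : N ≤ J₃
  · have := hN J₃ h₃
    simp only at this
    simp [this]
  have h5 := Finset.single_le_sum (f := fun j => K j + ∑ k ∈ range (K j), T j k)
    (fun _ _ => Nat.zero_le _) (show J₃ ∈ range N by simp; omega)
  by_cases h₂ : K J₃ ≤ J₂
  · have := hK J₃ J₂ h₂
    simp only at this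
    simp [this]
  have h6 := Finset.single_le_sum (f := fun k => T J₃ k)
    (fun _ _ => Nat.zero_le _) (show J₂ ∈ range (K J₃) by simp; omega)
  have := hT J₃ J₂ J₁ (by omega)
  simp only at this
  simp [this]

/-- Three fields, the first two of the form `X(z) V(z)`, in normal order. -/
lemma triple_rD {X₁ X₂ Y : TField M} {V₁ V₂ : FinSeq M} {g₂₁ g₃₁ g₃₂ : PowerSeries ℂ}
    (h₂₁ : RightComm (rD X₂ V₂) V₁ g₂₁) (h₃₁ : RightComm Y V₁ g₃₁) (h₃₂ : RightComm Y V₂ g₃₂)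
    (m₁ m₂ m₃ : ℤ) (v : M) :
    triple g₂₁ g₃₁ g₃₂ (rD X₁ V₁) (rD X₂ V₂) Y m₁ m₂ m₃ v =
      ∑ᶠ J₁ : ℕ, ∑ᶠ J₂ : ℕ, X₁ (m₁ - J₁) (X₂ (m₂ - J₂) (Y m₃ (V₂ J₂ (V₁ J₁ v)))) := by
  set F := rD X₂ V₂ with hF
  -- the series in `z₂/z₁` and `z₃/z₁` move the dressing of the first factor past the second and the
  -- third, the series in `z₃/z₂` moves that of the second past the third
  have h1 : ∀ j k : ℕ, ∑ᶠ i : ℕ, coeff i g₂₁ •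
      rD X₁ V₁ (m₁ - i - j) (F (m₂ + i - k) (Y (m₃ + j + k) v)) =
      ∑ᶠ J : ℕ, X₁ (m₁ - j - J) (F (m₂ - k) (V₁ J (Y (m₃ + k + j) v))) := fun j k => by
    rw [← h₂₁.contract]
    refine finsum_congr fun i => ?_
    rw [rD_apply, sub_right_comm m₁, add_sub_right_comm, add_right_comm m₃]
  have h2 : ∀ k : ℕ, ∑ᶠ j : ℕ, coeff j g₃₁ •
      ∑ᶠ J : ℕ, X₁ (m₁ - j - J) (F (m₂ - k) (V₁ J (Y (m₃ + k + j) v))) =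
      ∑ᶠ J : ℕ, X₁ (m₁ - J) (F (m₂ - k) (Y (m₃ + k) (V₁ J v))) := fun k =>
    h₃₁.contract (fun x => X₁ x * F (m₂ - k)) m₁ (m₃ + k) v
  have hbox : BoxZero fun J k : ℕ =>
      coeff k g₃₂ • X₁ (m₁ - J) (F (m₂ - k) (Y (m₃ + k) (V₁ J v))) := by
    refine BoxZero.of_nested ?_ fun J => ?_
    · obtain ⟨N, hN⟩ := V₁.fin v
      exact ⟨N, fun J hJ i => by simp [hN J hJ]⟩
    · exact (Y.evZero m₃ (V₁ J v)).map (fun k x => coeff k g₃₂ • X₁ (m₁ - J) (F (m₂ - k) x))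
        (by simp)
  rw [triple_eq_rev]
  simp only [h1, h2]
  simp only [smul_finsum]
  rw [← finsum_swap hbox]
  refine finsum_congr fun J₁ => ?_
  calc _ = X₁ (m₁ - J₁) (pair g₃₂ F Y m₂ m₃ (V₁ J₁ v)) := by
        rw [pair, map_finsum_of_evZero _ (pair_evZero ..)]
        simp only [map_smul]
    _ = _ := by
        have h3 := pair_rD_left h₃₂ 1 X₂ m₂ m₃ (V₁ J₁ v)
        rw [one_mul, ← hF] at h3
        simp only [pair_one] at h3
        rw [h3, map_finsum_of_evZero]
        exact V₂.evZero_map (V₁ J₁ v) (fun J x => X₂ (m₂ - J) (Y m₃ x)) (by simp)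

lemma triple_rD_box (X₁ X₂ X₃ : TField M) (V₁ V₂ V₃ : FinSeq M) (m₁ m₂ m₃ : ℤ) (v : M) :
    Box3 fun J₁ J₂ J₃ : ℕ =>
      X₁ (m₁ - J₁) (X₂ (m₂ - J₂) (X₃ (m₃ - J₃) (V₃ J₃ (V₂ J₂ (V₁ J₁ v))))) := by
  obtain ⟨N, hN⟩ := V₁.fin v
  choose K hK using fun J : ℕ => V₂.fin (V₁ J v)
  choose T hT using fun J J' : ℕ => V₃.fin (V₂ J' (V₁ J v))
  refine ⟨N + ∑ j ∈ range N, (K j + ∑ k ∈ range (K j), T j k), fun J₃ J₂ J₁ h => ?_⟩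
  by_cases h₃ : N ≤ J₃
  · have := hN J₃ h₃
    simp only at this
    simp [this]
  have h5 := Finset.single_le_sum (f := fun j => K j + ∑ k ∈ range (K j), T j k)
    (fun _ _ => Nat.zero_le _) (show J₃ ∈ range N by simp; omega)
  by_cases h₂ : K J₃ ≤ J₂
  · have := hK J₃ J₂ h₂
    simp only at this
    simp [this]
  have h6 := Finset.single_le_sum (f := fun k => T J₃ k)
    (fun _ _ => Nat.zero_le _) (show J₂ ∈ range (K J₃) by simp; omega)
  have := hT J₃ J₂ J₁ (by omega)
  simp only at this
  simp [this]

/-- Three fields `X(z) V(z)` in normal order. -/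
lemma triple_rD' {X₁ X₂ X₃ : TField M} {V₁ V₂ V₃ : FinSeq M} {g₂₁ g₃₁ g₃₂ : PowerSeries ℂ}
    (h₂₁ : RightComm (rD X₂ V₂) V₁ g₂₁) (h₃₁ : RightComm (rD X₃ V₃) V₁ g₃₁)
    (h₃₂ : RightComm (rD X₃ V₃) V₂ g₃₂) (m₁ m₂ m₃ : ℤ) (v : M) :
    triple g₂₁ g₃₁ g₃₂ (rD X₁ V₁) (rD X₂ V₂) (rD X₃ V₃) m₁ m₂ m₃ v =
      ∑ᶠ J₁ : ℕ, ∑ᶠ J₂ : ℕ, ∑ᶠ J₃ : ℕ,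
        X₁ (m₁ - J₁) (X₂ (m₂ - J₂) (X₃ (m₃ - J₃) (V₃ J₃ (V₂ J₂ (V₁ J₁ v))))) := by
  rw [triple_rD h₂₁ h₃₁ h₃₂]
  refine finsum_congr fun J₁ => finsum_congr fun J₂ => ?_
  have e := V₃.evZero_map (V₂ J₂ (V₁ J₁ v)) (fun J => X₃ (m₃ - J)) (by simp)
  rw [rD_apply, map_finsum_of_evZero _ e, map_finsum_of_evZero _ (e.map (fun _ x => X₂ (m₂ - J₂) x)
    (by simp))]

end Triple

/-! ### Infinite products and their expansions -/

section Products

open Finset PowerSeries Filter Topology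

lemma expSeries_commute (b c : ℕ → ℂ) :
    expSeries (fun m => b m + c m) = expSeries b * expSeries c :=
  expSeries_add (fun _ _ => Commute.all _ _) (fun _ _ => Commute.all _ _)
    (fun _ _ => Commute.all _ _)

lemma expSeries_neg_mul (b : ℕ → ℂ) : expSeries (fun m => -b m) * expSeries b = 1 := by
  rw [← expSeries_commute]; simp

lemma expSeries_inv (b : ℕ → ℂ) : (expSeries b)⁻¹ = expSeries fun m => -b m := by
  rw [PowerSeries.inv_eq_iff_mul_eq_one (by simp), expSeries_neg_mul]

lemma expSeries_sum {ι : Type*} (s : Finset ι) (b : ι → ℕ → ℂ) :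
    expSeries (fun m => ∑ i ∈ s, b i m) = ∏ i ∈ s, expSeries (b i) := by
  classical
  induction s using Finset.induction_on with
  | empty => simp
  | insert i s hi ih =>
    simp only [Finset.sum_insert hi, Finset.prod_insert hi]
    rw [expSeries_commute, ih]

lemma one_sub_eq_expSeries (x : ℂ) :
    1 - PowerSeries.C x * X = expSeries fun m : ℕ => -(x ^ m / m) := by
  refine expSeries_unique (fun _ _ => Commute.all _ _) ?_ (by simp)
  rw [mul_sub, mul_one, mul_comm (PowerSeries.C x), ← mul_assoc]
  ext n
  rw [coeff_eulerD, map_sub, map_sub, coeff_mul_C, mul_comm _ X, coeff_mul_C, coeff_eulerD, coeff_mk]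
  rcases n with _ | _ | n
  · simp
  · simp [coeff_succ_X_mul, coeff_X, coeff_one]
  · have h1 : ((n : ℂ) + 1 + 1) ≠ 0 := by exact_mod_cast Nat.succ_ne_zero (n + 1)
    have h2 : ((n : ℂ) + 1) ≠ 0 := by exact_mod_cast Nat.succ_ne_zero n
    simp only [coeff_succ_X_mul, coeff_eulerD, coeff_mk, coeff_X, coeff_one]
    push_cast
    simp only [smul_eq_mul]
    field_simp
    simp
    ring

/-- Each coefficient of an exponential is a polynomial in the coefficients of its argument, hence
continuous. -/
lemma tendsto_expCoeff {b : ℕ → ℕ → ℂ} {b' : ℕ → ℂ}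
    (h : ∀ m, Tendsto (fun N => b N m) atTop (𝓝 (b' m))) (n : ℕ) :
    Tendsto (fun N => expCoeff (b N) n) atTop (𝓝 (expCoeff b' n)) := by
  have key : ∀ k n, Tendsto (fun N => coeff n ((PowerSeries.mk fun m => if m = 0 then 0 else b N m)
      ^ k)) atTop (𝓝 (coeff n ((PowerSeries.mk fun m => if m = 0 then 0 else b' m) ^ k))) := by
    intro k
    induction k with
    | zero => intro n; simp only [pow_zero]; exact tendsto_const_nhds
    | succ k ih =>
      intro n
      simp only [pow_succ', coeff_mul]
      refine tendsto_finsetSum _ fun p _ => Tendsto.mul ?_ (ih p.2)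
      simp only [coeff_mk]
      split_ifs
      · exact tendsto_const_nhds
      · exact h p.1
  exact tendsto_finsetSum _ fun k _ => (key k n).const_smul _

lemma norm_pow_lt_one {p : ℂ} (hp : ‖p‖ < 1) {m : ℕ} (hm : 0 < m) : ‖p ^ m‖ < 1 := by
  rw [norm_pow]; exact pow_lt_one₀ (norm_nonneg _) hp hm.ne'

/-- `(a w; p)_∞ = exp (-∑_{m > 0} a^m w^m / (m (1 - p^m)))`. -/
lemma pochSeries_eq {p : ℂ} (hp : ‖p‖ < 1) (a : ℂ) :
    pochSeries a p = expSeries fun m : ℕ => -(a ^ m / (m * (1 - p ^ m))) := by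
  ext k
  rw [pochSeries, coeff_mk, coeff_expSeries]
  refine Tendsto.limUnder_eq ?_
  simp only [one_sub_eq_expSeries, ← expSeries_sum, coeff_expSeries]
  refine tendsto_expCoeff (fun m => ?_) k
  rcases Nat.eq_zero_or_pos m with rfl | hm
  · simp
  · have h := ((hasSum_geometric_of_norm_lt_one (norm_pow_lt_one hp hm)).mul_left
      (-(a ^ m / m))).tendsto_sum_nat
    convert h using 2
    · refine Finset.sum_congr rfl fun i _ => ?_
      rw [mul_pow, ← pow_mul, ← pow_mul, mul_comm m i]; ring
    · rw [div_mul_eq_div_div]; ring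

/-- `(a w; p, t)_∞ = exp (-∑_{m > 0} a^m w^m / (m (1 - p^m) (1 - t^m)))`. -/
lemma poch₂Series_eq {p t : ℂ} (hp : ‖p‖ < 1) (ht : ‖t‖ < 1) (a : ℂ) :
    poch₂Series a p t =
      expSeries fun m : ℕ => -(a ^ m / (m * ((1 - p ^ m) * (1 - t ^ m)))) := by
  ext k
  rw [poch₂Series, coeff_mk, coeff_expSeries]
  refine Tendsto.limUnder_eq ?_
  simp only [one_sub_eq_expSeries, ← expSeries_sum, coeff_expSeries]
  refine tendsto_expCoeff (fun m => ?_) k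
  rcases Nat.eq_zero_or_pos m with rfl | hm
  · simp
  · have h := (((hasSum_geometric_of_norm_lt_one (norm_pow_lt_one hp hm)).tendsto_sum_nat).mul
      ((hasSum_geometric_of_norm_lt_one (norm_pow_lt_one ht hm)).tendsto_sum_nat)).const_mul
      (-(a ^ m / m))
    convert h using 2
    · rw [Finset.sum_mul_sum, ← Finset.sum_product', Finset.mul_sum]
      refine Finset.sum_congr rfl fun i _ => ?_
      rw [mul_pow, mul_pow, ← pow_mul, ← pow_mul, ← pow_mul, ← pow_mul, mul_comm m, mul_comm m]
      ring
    · rw [div_mul_eq_div_div, div_eq_mul_inv _ ((1 - p ^ m) * _), mul_inv]; ring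

/-- Evaluation at `w = 1` of the exponential of an absolutely summable series. -/
lemma hasSum_expCoeff {b : ℕ → ℂ} (h0 : b 0 = 0) (hb : Summable fun m => ‖b m‖) :
    (Summable fun n => ‖expCoeff b n‖) ∧ HasSum (expCoeff b) (Complex.exp (∑' m, b m)) := by
  set f : PowerSeries ℂ := PowerSeries.mk fun m => if m = 0 then 0 else b m with hf
  have hfb : ∀ m, coeff m f = b m := by
    intro m; rw [hf, coeff_mk]; split_ifs with hm
    · rw [hm, h0]
    · rfl
  have hfs : Summable fun m => ‖coeff m f‖ := by simpa only [hfb] using hb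
  have key : ∀ k : ℕ, (Summable fun n => ‖coeff n (f ^ k)‖) ∧
      ∑' n, coeff n (f ^ k) = (∑' m, b m) ^ k ∧
      ∑' n, ‖coeff n (f ^ k)‖ ≤ (∑' m, ‖b m‖) ^ k := by
    intro k
    induction k with
    | zero =>
      have h1 : ∀ n, n ≠ 0 → coeff n (f ^ 0) = 0 := fun n hn => by simp [coeff_one, hn]
      refine ⟨(hasSum_single 0 fun n hn => by rw [h1 n hn, norm_zero]).summable, ?_, ?_⟩
      · rw [tsum_eq_single 0 h1]; simp
      · rw [tsum_eq_single 0 fun n hn => by rw [h1 n hn, norm_zero]]; simp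
    | succ k ih =>
      obtain ⟨ih1, ih2, ih3⟩ := ih
      have e : ∀ n, coeff n (f ^ (k + 1)) =
          ∑ p ∈ antidiagonal n, coeff p.1 f * coeff p.2 (f ^ k) := fun n => by
        rw [pow_succ', coeff_mul]
      have hsum := summable_norm_sum_mul_antidiagonal_of_summable_norm hfs ih1
      have hfs' : Summable fun m => ‖‖coeff m f‖‖ := by simpa using hfs
      have ih1' : Summable fun m => ‖‖coeff m (f ^ k)‖‖ := by simpa using ih1
      have hsum' := summable_norm_sum_mul_antidiagonal_of_summable_norm hfs' ih1'
      have heq' := tsum_mul_tsum_eq_tsum_sum_antidiagonal_of_summable_norm hfs' ih1'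
      simp only [e]
      refine ⟨hsum, ?_, ?_⟩
      · rw [← tsum_mul_tsum_eq_tsum_sum_antidiagonal_of_summable_norm hfs ih1, ih2, pow_succ']
        simp only [hfb]
      · have hle : ∀ n, ‖∑ p ∈ antidiagonal n, coeff p.1 f * coeff p.2 (f ^ k)‖ ≤
            ∑ p ∈ antidiagonal n, ‖coeff p.1 f‖ * ‖coeff p.2 (f ^ k)‖ := fun n =>
          (norm_sum_le _ _).trans (Finset.sum_le_sum fun p _ => (norm_mul_le _ _))
        refine (hsum.tsum_le_tsum hle hsum'.of_norm).trans ?_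
        rw [← heq', pow_succ']
        simp only [hfb]
        exact mul_le_mul_of_nonneg_left ih3 (tsum_nonneg fun _ => norm_nonneg _)
  -- the double series `∑_{k, n} (1/k!) [w^n] f^k` converges absolutely
  set G : ℕ × ℕ → ℂ := fun x => ((x.1.factorial : ℂ)⁻¹) • coeff x.2 (f ^ x.1) with hG
  have hGn : ∀ x, ‖G x‖ = (x.1.factorial : ℝ)⁻¹ * ‖coeff x.2 (f ^ x.1)‖ := fun x => by
    rw [hG]; simp
  have hGs : Summable fun x => ‖G x‖ := by
    refine (summable_prod_of_nonneg fun x => norm_nonneg _).mpr ⟨fun k => ?_, ?_⟩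
    · simp only [hGn]; exact (key k).1.mul_left _
    · simp only [hGn, tsum_mul_left]
      refine Summable.of_nonneg_of_le (fun k => mul_nonneg (by positivity)
        (tsum_nonneg fun _ => norm_nonneg _)) (fun k => mul_le_mul_of_nonneg_left (key k).2.2
        (by positivity)) ?_
      simpa [div_eq_inv_mul] using Real.summable_pow_div_factorial (∑' m, ‖b m‖)
  have hrow : ∀ n, HasSum (fun k => G (k, n)) (expCoeff b n) := fun n => by
    rw [expCoeff]
    refine hasSum_sum_of_ne_finset_zero fun k hk => ?_
    simp only [hG]
    rw [coeff_pow_eq_zero (by simp [hf]) (by simpa using hk), smul_zero]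
  have hcol : ∀ k, HasSum (fun n => G (k, n)) ((∑' m, b m) ^ k / k.factorial) := fun k => by
    have h1 := ((key k).1.of_norm.hasSum).mul_left ((k.factorial : ℂ)⁻¹)
    rw [(key k).2.1, inv_mul_eq_div] at h1
    exact h1
  have hexp : HasSum (fun k : ℕ => (∑' m, b m) ^ k / k.factorial) (Complex.exp (∑' m, b m)) := by
    rw [Complex.exp_eq_exp_ℂ]
    exact NormedSpace.expSeries_div_hasSum_exp _
  have htot : HasSum G (Complex.exp (∑' m, b m)) := by
    have h1 := hGs.of_norm.hasSum
    have h2 := h1.prod_fiberwise hcol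
    rwa [h2.unique hexp] at h1
  refine ⟨?_, ?_⟩
  · have h1 : Summable fun x : ℕ × ℕ => ‖G x.swap‖ := hGs.prod_symm
    have h2 := (summable_prod_of_nonneg fun x => norm_nonneg _).mp h1
    refine Summable.of_nonneg_of_le (fun _ => norm_nonneg _) (fun n => ?_) h2.2
    rw [← (hrow n).tsum_eq]
    exact norm_tsum_le_tsum_norm (h2.1 n)
  · have h1 : HasSum (fun x : ℕ × ℕ => G x.swap) (Complex.exp (∑' m, b m)) :=
      (Equiv.prodComm ℕ ℕ).hasSum_iff.mpr htot
    exact h1.prod_fiberwise hrow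

lemma summable_geom_norm {p : ℂ} (hp : ‖p‖ < 1) : Summable fun n : ℕ => ‖p ^ n‖ := by
  simpa only [norm_pow] using summable_geometric_of_lt_one (norm_nonneg p) hp

lemma multipliable_poch (a : ℂ) {p : ℂ} (hp : ‖p‖ < 1) :
    Multipliable fun n : ℕ => 1 - a * p ^ n := by
  have h : Summable fun n : ℕ => ‖-(a * p ^ n)‖ := by
    simpa only [norm_neg, norm_mul] using (summable_geom_norm hp).mul_left ‖a‖
  simpa only [sub_eq_add_neg] using multipliable_one_add_of_summable h

lemma multipliable_poch₂ (a : ℂ) {p t : ℂ} (hp : ‖p‖ < 1) (ht : ‖t‖ < 1) :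
    Multipliable fun n : ℕ × ℕ => 1 - a * p ^ n.1 * t ^ n.2 := by
  have h : Summable fun n : ℕ × ℕ => ‖-(a * p ^ n.1 * t ^ n.2)‖ := by
    have := ((summable_geom_norm hp).mul_norm (summable_geom_norm ht)).mul_left ‖a‖
    simpa only [norm_neg, mul_assoc, norm_mul] using this
  simpa only [sub_eq_add_neg] using multipliable_one_add_of_summable h

lemma poch_eq_mul (a : ℂ) {p : ℂ} (hp : ‖p‖ < 1) :
    poch a p = (1 - a) * poch (p * a) p := by
  have hs : ∀ n : ℕ, 1 - a * p ^ (n + 1) = 1 - p * a * p ^ n := fun n => by ring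
  have h : Multipliable fun n : ℕ => 1 - a * p ^ (n + 1) :=
    (multipliable_poch (p * a) hp).congr fun n => (hs n).symm
  have h1 := tprod_eq_zero_mul' (f := fun n : ℕ => 1 - a * p ^ n) h
  rw [pow_zero, mul_one, tprod_congr hs] at h1
  exact h1

lemma poch₂_eq_mul (a : ℂ) {p t : ℂ} (hp : ‖p‖ < 1) (ht : ‖t‖ < 1) :
    poch₂ a p t = poch a t * poch₂ (p * a) p t := by
  have hfac : ∀ a, poch₂ a p t = ∏' i : ℕ, poch (a * p ^ i) t := fun a =>
    (multipliable_poch₂ a hp ht).tprod_prod' fun i => multipliable_poch (a * p ^ i) ht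
  have hm : ∀ a, Multipliable fun i : ℕ => poch (a * p ^ i) t := fun a =>
    ((multipliable_poch₂ a hp ht).hasProd.prod_fiberwise fun i =>
      (multipliable_poch (a * p ^ i) ht).hasProd).multipliable
  have hs : ∀ i : ℕ, poch (a * p ^ (i + 1)) t = poch (p * a * p ^ i) t := fun i => by
    congr 1; ring
  have h : Multipliable fun i : ℕ => poch (a * p ^ (i + 1)) t :=
    (hm (p * a)).congr fun i => (hs i).symm
  have h1 := tprod_eq_zero_mul' (f := fun i : ℕ => poch (a * p ^ i) t) h
  rw [pow_zero, mul_one, tprod_congr hs] at h1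
  rw [hfac, hfac]
  exact h1

/-- The logarithm of `(a; p, t)_∞` for `|a| < 1`. -/
lemma poch₂_eq_exp {a p t : ℂ} (ha : ‖a‖ < 1) (hp : ‖p‖ < 1) (ht : ‖t‖ < 1) :
    (Summable fun m : ℕ => ‖-(a ^ m / (m * ((1 - p ^ m) * (1 - t ^ m))))‖) ∧
    poch₂ a p t = Complex.exp (∑' m : ℕ, -(a ^ m / (m * ((1 - p ^ m) * (1 - t ^ m))))) := by
  set G : ℕ × (ℕ × ℕ) → ℂ := fun x => -((a * p ^ x.2.1 * t ^ x.2.2) ^ x.1 / x.1) with hG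
  have hGs : Summable fun x => ‖G x‖ := by
    have hs := (summable_geom_norm ha).mul_norm
      ((summable_geom_norm hp).mul_norm (summable_geom_norm ht)).of_norm.norm
    refine Summable.of_nonneg_of_le (fun _ => norm_nonneg _) (fun x => ?_) hs
    obtain ⟨m, i, j⟩ := x
    simp only [hG, norm_neg, norm_div, norm_pow, norm_mul, Complex.norm_natCast]
    rcases Nat.eq_zero_or_pos m with rfl | hm
    · simp only [Nat.cast_zero, div_zero]; positivity
    · refine (div_le_self (by positivity) (by exact_mod_cast hm)).trans ?_
      rw [mul_pow, mul_pow, mul_assoc]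
      gcongr ‖a‖ ^ m * (?_ * ?_)
      · exact pow_le_of_le_one (by positivity) (pow_le_one₀ (norm_nonneg _) hp.le) hm.ne'
      · exact pow_le_of_le_one (by positivity) (pow_le_one₀ (norm_nonneg _) ht.le) hm.ne'
  -- the double series of the logarithms of all factors: summed by rows it gives the exponent, by
  -- columns it gives the logarithms of the factors
  have hrow : ∀ m, HasSum (fun y => G (m, y)) (-(a ^ m / (m * ((1 - p ^ m) * (1 - t ^ m))))) := by
    intro m
    rcases Nat.eq_zero_or_pos m with rfl | hm
    · simp only [hG, Nat.cast_zero, div_zero, zero_mul, neg_zero]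
      exact hasSum_zero
    · have h1 := (hasSum_geometric_of_norm_lt_one (norm_pow_lt_one hp hm)).mul
        (hasSum_geometric_of_norm_lt_one (norm_pow_lt_one ht hm))
        ((summable_geom_norm (norm_pow_lt_one hp hm)).mul_norm
          (summable_geom_norm (norm_pow_lt_one ht hm))).of_norm
      have e1 : (fun y => G (m, y)) =
          fun y : ℕ × ℕ => -(a ^ m / m) * ((p ^ m) ^ y.1 * (t ^ m) ^ y.2) := by
        funext y
        simp only [hG]
        rw [mul_pow, mul_pow, pow_right_comm p, pow_right_comm t]
        ring
      have e2 : -(a ^ m / (m * ((1 - p ^ m) * (1 - t ^ m)))) =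
          -(a ^ m / m) * ((1 - p ^ m)⁻¹ * (1 - t ^ m)⁻¹) := by
        rw [← mul_inv, ← div_eq_mul_inv, neg_div, div_div]
      rw [e1, e2]
      exact h1.mul_left _
  have hlt : ∀ y : ℕ × ℕ, ‖a * p ^ y.1 * t ^ y.2‖ < 1 := fun y => by
    rw [norm_mul, norm_mul, norm_pow, norm_pow, mul_assoc]
    refine lt_of_le_of_lt (mul_le_of_le_one_right (norm_nonneg _) ?_) ha
    exact mul_le_one₀ (pow_le_one₀ (norm_nonneg _) hp.le) (by positivity)
      (pow_le_one₀ (norm_nonneg _) ht.le)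
  have hcol : ∀ y : ℕ × ℕ, HasSum (fun m => G (m, y)) (Complex.log (1 - a * p ^ y.1 * t ^ y.2)) :=
    fun y => by
      have h1 := (Complex.hasSum_taylorSeries_neg_log (hlt y)).neg
      rwa [neg_neg] at h1
  have htot := hGs.of_norm.hasSum
  have h1 := htot.prod_fiberwise hrow
  have h2 : HasSum (fun y : ℕ × ℕ => Complex.log (1 - a * p ^ y.1 * t ^ y.2)) (∑' x, G x) := by
    have h3 : HasSum (fun x : (ℕ × ℕ) × ℕ => G x.swap) (∑' x, G x) :=
      (Equiv.prodComm _ _).hasSum_iff.mpr htot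
    exact h3.prod_fiberwise hcol
  refine ⟨?_, ?_⟩
  · have h4 := (summable_prod_of_nonneg fun x => norm_nonneg _).mp hGs
    refine Summable.of_nonneg_of_le (fun _ => norm_nonneg _) (fun m => ?_) h4.2
    rw [← (hrow m).tsum_eq]
    exact norm_tsum_le_tsum_norm (h4.1 m)
  · rw [h1.tsum_eq, poch₂, ← h2.cexp.tprod_eq]
    refine tprod_congr fun y => ?_
    rw [Function.comp_apply, Complex.exp_log]
    intro h0
    have := hlt y
    rw [← sub_eq_zero.mp h0, norm_one] at this
    exact lt_irrefl _ this

end Products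

/-! ### Vertex operators and the dressed exchange relations -/

section Vertex
open Finset PowerSeries
variable {M : Type*} [AddCommGroup M] [Module ℂ M]

/-- The vertex operator `exp (∑_{m > 0} u_m a_{-m} z^m) exp (∑_{m > 0} v_m a_m z^{-m})`. -/
def vertexOp (𝔥 : HeisData M) (u v : ℕ → ℂ) : TField M :=
  lD (𝔥.up u) (rD oneField (𝔥.dn v))

lemma rD_oneField_apply (V : FinSeq M) (n : ℤ) (x : M) :
    rD oneField V n x = if 0 ≤ n then V n.toNat x else 0 := by
  rw [rD_apply]
  simp only [oneField_apply]
  split_ifs with h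
  · rw [finsum_eq_single _ n.toNat]
    · rw [if_pos (by omega)]
    · intro j hj
      rw [if_neg (by omega)]
  · refine finsum_eq_zero_of_forall_eq_zero fun j => ?_
    rw [if_neg (by omega)]

lemma vertexOp_apply (𝔥 : HeisData M) (u v : ℕ → ℂ) (n : ℤ) (x : M) :
    vertexOp 𝔥 u v n x =
      ∑ᶠ j : ℕ, 𝔥.up u j (if 0 ≤ n + j then 𝔥.dn v (n + j).toNat x else 0) := by
  rw [vertexOp, lD_apply]
  simp only [rD_oneField_apply]

lemma normalExpMode_eq (𝔥 : HeisData M) {u v : ℕ → ℂ} {b : ℤ → Module.End ℂ M}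
    (hu : ∀ m : ℕ, 0 < m → b (-m) = u m • 𝔥.a (-m)) (hv : ∀ m : ℕ, 0 < m → b m = v m • 𝔥.a m)
    (n : ℤ) (x : M) : normalExpMode b n x = vertexOp 𝔥 u v n x := by
  rw [vertexOp_apply, normalExpMode]
  refine finsum_congr fun j => ?_
  have h1 : expCoeff (fun m : ℕ => b (-m)) j = 𝔥.up u j := expCoeff_congr hu j
  have h2 : expCoeff (fun m : ℕ => b m) (n + j).toNat = 𝔥.dn v (n + j).toNat :=
    expCoeff_congr hv _
  rw [h1, h2]
  split_ifs with h
  · rfl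
  · rw [map_zero]

variable {𝔥 : HeisData M}

/-- The charges of a vertex operator. -/
lemma primary_vertexOp (u v : ℕ → ℂ) :
    Primary 𝔥.a (vertexOp 𝔥 u v) fun m =>
      (if m < 0 then v (-m).toNat * 𝔥.β m else 0) + if 0 < m then u m.toNat * 𝔥.β m else 0 := by
  have h := HeisData.primary_lD (HeisData.primary_rD (primary_oneField 𝔥.a) v) u
  simp only [Pi.zero_apply, zero_add] at h
  exact h

/-- A vertex operator and a primary field exchange up to a scalar series, because the trivial
field exchanges with everything. -/
lemma exch_vertexOp {X : TField M} {γ : ℤ → ℂ} (h : Primary 𝔥.a X γ) (u v : ℕ → ℂ) :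
    Exch (vertexOp 𝔥 u v) X (expSeries fun m => -(v m * γ m)) (expSeries fun m => u m * γ (-m))
      1 0 fun _ _ _ => 0 := by
  have h1 := (exch_oneField X).rD_left (HeisData.rightComm h v)
  have h2 := h1.lD_left (HeisData.leftComm h u)
  rw [one_mul, one_mul] at h2
  refine h2.congr_zero fun m n x => ?_
  simp

/-- Dressing both factors of a homogeneous exchange relation on the left. Since `U` changes only
the commutators with `a_m`, `m > 0`, both structure functions receive the same series. -/
lemma exch_lD {X : TField M} {γ : ℤ → ℂ} (h : Primary 𝔥.a X γ) (u : ℕ → ℂ) {L₀ : PowerSeries ℂ}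
    {C : ℂ} {e : ℤ} (h₀ : Exch X X L₀ L₀ C e fun _ _ _ => 0) :
    Exch (lD (𝔥.up u) X) (lD (𝔥.up u) X) (L₀ * expSeries fun m => u m * γ (-m))
      (L₀ * expSeries fun m => u m * γ (-m)) C e fun _ _ _ => 0 := by
  have h1 := h₀.lD_right (HeisData.leftComm h u)
  have h2 := h1.lD_left (HeisData.leftComm (HeisData.primary_lD h u) u)
  rw [expSeries_congr (b := fun m : ℕ => u m * (γ (-m) + _)) (c := fun m => u m * γ (-m))
    fun m hm => by rw [if_neg (by omega), add_zero]] at h2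
  refine h2.congr_zero fun m n x => ?_
  simp

/-- Dressing both factors of a homogeneous exchange relation on the right. Since `V` changes only
the commutators with `a_m`, `m < 0`, both structure functions receive the same series. -/
lemma exch_rD {X : TField M} {γ : ℤ → ℂ} (h : Primary 𝔥.a X γ) (v : ℕ → ℂ) {L₀ : PowerSeries ℂ}
    {C : ℂ} {e : ℤ} (h₀ : Exch X X L₀ L₀ C e fun _ _ _ => 0) :
    Exch (rD X (𝔥.dn v)) (rD X (𝔥.dn v)) (L₀ * expSeries fun m => -(v m * γ m))
      (L₀ * expSeries fun m => -(v m * γ m)) C e fun _ _ _ => 0 := by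
  have h1 := h₀.rD_left (HeisData.rightComm h v)
  have h2 := h1.rD_right (HeisData.rightComm (HeisData.primary_rD h v) v)
  rw [expSeries_congr (b := fun m : ℕ => -(v m * (γ m + _))) (c := fun m => -(v m * γ m))
    fun m hm => by rw [if_neg (by omega), add_zero]] at h2
  refine h2.congr_zero fun m n x => ?_
  simp

/-- The pairing with a quadratic polynomial has three terms. -/
lemma pair_quadratic (a b : ℂ) (A B : TField M) (m n : ℤ) (v : M) :
    pair ((1 - PowerSeries.C a * X) * (1 - PowerSeries.C b * X)) A B m n v =
      A m (B n v) - (a + b) • A (m - 1) (B (n + 1) v) + (a * b) • A (m - 2) (B (n + 2) v) := by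
  have key : ∀ Φ : ℕ → M, EvZero Φ → ∑ᶠ k, coeff k ((1 - PowerSeries.C a * X) *
      ((1 - PowerSeries.C b * X) * 1)) • Φ k = Φ 0 - (a + b) • Φ 1 + (a * b) • Φ 2 := by
    intro Φ hΦ
    have hs : ∀ i, EvZero fun n => Φ (n + i) := fun i => by
      obtain ⟨N, hN⟩ := hΦ
      exact ⟨N, fun k hk => hN _ (by omega)⟩
    have h1 : ∀ Ψ : ℕ → M, ∑ᶠ k, coeff k (1 : PowerSeries ℂ) • Ψ k = Ψ 0 := fun Ψ => by
      rw [finsum_eq_single _ 0 fun k hk => by rw [coeff_one, if_neg hk, zero_smul]]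
      simp
    rw [finsum_one_sub_mul a _ hΦ, finsum_one_sub_mul b _ hΦ, finsum_one_sub_mul b _ (hs 1),
      h1, h1, h1]
    module
  have h := key (fun k => A (m - k) (B (n + k) v)) ((B.evZero n v).map (fun k => A (m - k))
    (by simp))
  rw [mul_one] at h
  rw [pair, h]
  simp

end Vertex

/-! ### The operators of a restricted module -/

section Concrete
open Finset PowerSeries
variable {q r c : ℝ} {M : Type*} [AddCommGroup M] [Module ℂ M]

/-- The action of the free algebra on the Drinfeld generators. -/
def repU (π : Uq q c ⊗[ℂ] Heis →ₐ[ℂ] Module.End ℂ M) :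
    FreeAlgebra ℂ UqGen →ₐ[ℂ] Module.End ℂ M :=
  (π.comp Algebra.TensorProduct.includeLeft).comp (RingQuot.mkAlgHom ℂ (UqRel q c))

/-- The action of the free algebra on the generators of the Heisenberg algebra. -/
def repH (π : Uq q c ⊗[ℂ] Heis →ₐ[ℂ] Module.End ℂ M) :
    FreeAlgebra ℂ HeisGen →ₐ[ℂ] Module.End ℂ M :=
  (π.comp Algebra.TensorProduct.includeRight).comp (RingQuot.mkAlgHom ℂ HeisRel)

variable (π : Uq q c ⊗[ℂ] Heis →ₐ[ℂ] Module.End ℂ M)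

lemma opU_eq (y : FreeAlgebra ℂ UqGen) : opU π y = repU π y := rfl

lemma repU_rel {x y : FreeAlgebra ℂ UqGen} (h : UqRel q c x y) : repU π x = repU π y := by
  simp only [repU, AlgHom.comp_apply, RingQuot.mkAlgHom_rel ℂ h]

lemma repH_rel {x y : FreeAlgebra ℂ HeisGen} (h : HeisRel x y) : repH π x = repH π y := by
  simp only [repH, AlgHom.comp_apply, RingQuot.mkAlgHom_rel ℂ h]

lemma commute_repU_repH (x : FreeAlgebra ℂ UqGen) (y : FreeAlgebra ℂ HeisGen) :
    Commute (repU π x) (repH π y) := by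
  simp only [repU, repH, AlgHom.comp_apply]
  refine Commute.map ?_ π
  simp [Commute, SemiconjBy]

lemma commute_opU_opH (x : FreeAlgebra ℂ UqGen) (g : HeisGen) :
    Commute (opU π x) (opH π g) := commute_repU_repH π x (gH g)

lemma ga_zero : ga 0 = 0 := by simp [ga]

variable {π}

/-- The bosons `a_m` acting on a restricted module. -/
def heis (hπ : IsRestricted π) : HeisData M where
  a m := opU π (ga m)
  β m := ((1 / (m : ℝ) * dn q m * q ^ (-c * |(m : ℝ)|) * qn q (c * m) : ℝ) : ℂ)
  a_zero := by rw [ga_zero, opU_eq, map_zero]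
  bracket m n hm hn := by
    have h := repU_rel π (UqRel.a_a m n hm hn)
    rw [map_sub, map_mul, map_mul] at h
    simp only [opU_eq]
    rw [h]
    split_ifs
    · rw [AlgHom.commutes]
    · rw [map_zero]
  trunc v := by
    obtain ⟨N, hN⟩ := hπ.trunc v
    exact ⟨N, fun m hm => (hN m hm).2⟩
  nilp := hπ.nilp

/-- The Drinfeld current `x^ε(z)`. -/
def xField (hπ : IsRestricted π) (ε : ℤˣ) : TField M where
  mode n := opU π (gx ε n)
  trunc v := by
    obtain ⟨N, hN⟩ := hπ.trunc v
    exact ⟨N, fun m hm => (hN m hm).1 ε⟩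

/-- The charges of `x⁺(z)`. -/
def chargeP (q c : ℝ) (m : ℤ) : ℂ := ((1 / (m : ℝ) * dn q m * q ^ (-c * |(m : ℝ)|) : ℝ) : ℂ)

/-- The charges of `x⁻(z)`. -/
def chargeM (q : ℝ) (m : ℤ) : ℂ := ((-(1 / (m : ℝ) * dn q m) : ℝ) : ℂ)

lemma primary_xp (hπ : IsRestricted π) : Primary (heis hπ).a (xField hπ 1) (chargeP q c) := by
  intro m hm n
  have h := repU_rel π (UqRel.a_xp m n hm)
  rw [map_sub, map_mul, map_mul, map_smul] at h
  exact h

lemma primary_xm (hπ : IsRestricted π) : Primary (heis hπ).a (xField hπ (-1)) (chargeM q) := by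
  intro m hm n
  have h := repU_rel π (UqRel.a_xm m n hm)
  rw [map_sub, map_mul, map_mul, map_smul] at h
  exact h

/-- The quadratic relation of the Drinfeld currents as an exchange relation. -/
lemma exch_x (hπ : IsRestricted π) (ε : ℤˣ) {A B : ℂ} (hA : A = (q : ℂ) ^ (2 * (ε : ℤ)))
    (hB : B = (q : ℂ) ^ (-(ε : ℤ))) :
    Exch (xField hπ ε) (xField hπ ε) ((1 - PowerSeries.C A * X) * (1 - PowerSeries.C B * X))
      ((1 - PowerSeries.C A * X) * (1 - PowerSeries.C B * X)) (-1) 2 fun _ _ _ => 0 := by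
  intro m n v
  have h := congrArg (fun f : Module.End ℂ M => f v)
    (repU_rel π (UqRel.x_x ε (m - 2) n A B hA hB))
  simp only [map_add, map_sub, map_mul, map_smul, map_neg, LinearMap.add_apply,
    LinearMap.sub_apply, LinearMap.smul_apply, LinearMap.neg_apply, Module.End.mul_apply] at h
  have e : ∀ (k : ℤ) (w : M), xField hπ ε k w = repU π (gx ε k) w := fun _ _ => rfl
  rw [pair_quadratic, pair_quadratic]
  simp only [e]
  rw [show m - 2 + 2 = m by ring, show m - 2 + 1 = m - 1 by ring] at h
  rw [show n + 2 - 1 = n + 1 by ring, show n + 2 - 2 = n by ring, show m - 2 + 1 = m - 1 by ring,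
    show m - 2 + 2 = m by ring, neg_one_smul, sub_neg_eq_add, h]
  abel

/-! ### The coefficients of the dressing exponentials -/

/-- Coefficients of `u⁺(z, p)`. -/
def uE (q r c : ℝ) (m : ℕ) : ℂ := ((q ^ (r * m) / qn q ((r - c) * m) : ℝ) : ℂ)
/-- Coefficients of `u⁻(z, p)`. -/
def vF (q r : ℝ) (m : ℕ) : ℂ := ((-(q ^ (r * m) / qn q (r * m)) : ℝ) : ℂ)
/-- Coefficients of the creation part of `k(z, p)`. -/
def uK (q r c : ℝ) (m : ℕ) : ℂ :=
  ((qn q m / (qn q ((r - c) * m) * dn q m) * q ^ (c * m) : ℝ) : ℂ)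
/-- Coefficients of the annihilation part of `k(z, p)`. -/
def vK (q r : ℝ) (m : ℕ) : ℂ := ((-(qn q m / (qn q (r * m) * dn q m)) : ℝ) : ℂ)
/-- Coefficients of the creation part of `ψ(z, p)`. -/
def uH (q r c : ℝ) (m : ℕ) : ℂ := ((q ^ (c * m) / qn q ((r - c) * m) : ℝ) : ℂ)
/-- Coefficients of the annihilation part of `ψ(z, p)`. -/
def vH (q r : ℝ) (m : ℕ) : ℂ := ((-(1 / qn q (r * m)) : ℝ) : ℂ)

/-- `e(z, p)`. -/
def eField (r : ℝ) (hπ : IsRestricted π) : TField M :=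
  lD ((heis hπ).up (uE q r c)) (xField hπ 1)
/-- `f(z, p)`. -/
def fField (r : ℝ) (hπ : IsRestricted π) : TField M :=
  rD (xField hπ (-1)) ((heis hπ).dn (vF q r))
/-- `k(z, p)`. -/
def kField (r : ℝ) (hπ : IsRestricted π) : TField M := vertexOp (heis hπ) (uK q r c) (vK q r)
/-- The normally ordered inverse of `k(z, p)`. -/
def kinvField (r : ℝ) (hπ : IsRestricted π) : TField M :=
  vertexOp (heis hπ) (fun m => -uK q r c m) (fun m => -vK q r m)
/-- `ψ(z, p)`. -/
def psiField (r : ℝ) (hπ : IsRestricted π) : TField M :=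
  vertexOp (heis hπ) (uH q r c) (vH q r)

lemma eMode_eq (hπ : IsRestricted π) (n : ℤ) (v : M) : eMode r π n v = eField r hπ n v := rfl

lemma fMode_eq (hπ : IsRestricted π) (n : ℤ) (v : M) : fMode r π n v = fField r hπ n v := rfl

lemma qn_neg (q x : ℝ) : qn q (-x) = -qn q x := by
  rw [qn, qn, neg_neg]; ring

lemma dn_neg (q x : ℝ) : dn q (-x) = -dn q x := by
  rw [dn, dn, mul_neg, qn_neg, qn_neg]; ring

lemma psiMode_eq (hπ : IsRestricted π) (n : ℤ) (v : M) :
    psiMode r π n v = psiField r hπ n v := by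
  refine normalExpMode_eq (heis hπ) (fun m hm => ?_) (fun m hm => ?_) n v
  · rw [if_neg (by omega), uH]
    have h1 : |((-(m : ℤ) : ℤ) : ℝ)| = m := by push_cast; rw [abs_neg, Nat.abs_cast]
    rw [h1]
    rfl
  · rw [if_pos (by omega), vH]
    rfl

lemma kMode_eq (hπ : IsRestricted π) (hr : ∀ m : ℕ, 0 < m → qn q (r * m) ≠ 0) (n : ℤ) (v : M) :
    kMode r π n v = kField r hπ n v := by
  refine normalExpMode_eq (heis hπ) (fun m hm => ?_) (fun m hm => ?_) n v
  · rw [alphaOp, if_neg (by omega), smul_smul, uK, ← Complex.ofReal_mul]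
    congr 2
    push_cast
    rw [abs_neg, Nat.abs_cast, mul_neg, mul_neg, qn_neg, qn_neg, qn_neg, dn_neg]
    have := hr m hm
    rw [neg_mul_neg, neg_div_neg_eq, neg_div, neg_neg]
    field_simp
  · rw [alphaOp, if_pos (by omega), vK]
    rfl

end Concrete

/-! ### The structure functions as exponentials -/

section Scalars
open Finset PowerSeries

lemma prod_pochSeries {p : ℂ} (hp : ‖p‖ < 1) (L : List ℂ) :
    (L.map fun a => pochSeries a p).prod =
      expSeries fun m : ℕ => -((L.map fun a => a ^ m).sum / (m * (1 - p ^ m))) := by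
  induction L with
  | nil => simp
  | cons a L ih =>
    rw [List.map_cons, List.prod_cons, ih, pochSeries_eq hp, ← expSeries_commute]
    congr 1
    funext m
    rw [List.map_cons, List.sum_cons]
    ring

lemma pochCoeff_series {p : ℂ} (hp : ‖p‖ < 1) (N D : List ℂ) :
    (pochCoeff p N D).series = expSeries fun m : ℕ =>
      ((D.map fun a => a ^ m).sum - (N.map fun a => a ^ m).sum) / (m * (1 - p ^ m)) := by
  simp only [pochCoeff]
  rw [prod_pochSeries hp, prod_pochSeries hp, expSeries_inv, ← expSeries_commute]
  congr 1
  funext m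
  ring

lemma nome_eq {q : ℝ} (hq₀ : 0 < q) (r : ℝ) : nome q r = ((q ^ (2 * r) : ℝ) : ℂ) := by
  rw [nome, Complex.ofReal_cpow hq₀.le]
  norm_cast

lemma norm_nome_lt {q r : ℝ} (hq₀ : 0 < q) (hq₁ : q < 1) (hr : 0 < r) : ‖nome q r‖ < 1 := by
  rw [nome_eq hq₀, Complex.norm_real, Real.norm_of_nonneg (by positivity)]
  exact Real.rpow_lt_one hq₀.le hq₁ (by positivity)

lemma norm_q_pow_lt {q : ℝ} (hq₀ : 0 < q) (hq₁ : q < 1) {n : ℕ} (hn : n ≠ 0) :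
    ‖(q : ℂ) ^ n‖ < 1 := by
  rw [norm_pow, Complex.norm_real, Real.norm_of_nonneg hq₀.le]
  exact pow_lt_one₀ hq₀.le hq₁ hn

lemma prod_poch₂Series {p t : ℂ} (hp : ‖p‖ < 1) (ht : ‖t‖ < 1) (L : List ℂ) :
    (L.map fun a => poch₂Series a p t).prod = expSeries fun m : ℕ =>
      -((L.map fun a => a ^ m).sum / (m * ((1 - p ^ m) * (1 - t ^ m)))) := by
  induction L with
  | nil => simp
  | cons a L ih =>
    rw [List.map_cons, List.prod_cons, ih, poch₂Series_eq hp ht, ← expSeries_commute]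
    congr 1
    funext m
    rw [List.map_cons, List.sum_cons]
    ring

lemma rhoCoeff_series {q r r' : ℝ} (hq₀ : 0 < q) (hq₁ : q < 1) (hr : 0 < r) (hr' : 0 < r') :
    (rhoCoeff q r r').series = expSeries fun m : ℕ =>
      (((rhoList₂ q r).map fun a => a ^ m).sum - ((rhoList₁ q r).map fun a => a ^ m).sum) /
          (m * ((1 - nome q r ^ m) * (1 - ((q : ℂ) ^ 6) ^ m))) +
        (((rhoList₁ q r').map fun a => a ^ m).sum - ((rhoList₂ q r').map fun a => a ^ m).sum) /
          (m * ((1 - nome q r' ^ m) * (1 - ((q : ℂ) ^ 6) ^ m))) := by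
  have h6 := norm_q_pow_lt hq₀ hq₁ (n := 6) (by norm_num)
  have h1 := norm_nome_lt hq₀ hq₁ hr
  have h2 := norm_nome_lt hq₀ hq₁ hr'
  simp only [rhoCoeff, braceSeries]
  rw [prod_poch₂Series h1 h6, prod_poch₂Series h1 h6, prod_poch₂Series h2 h6,
    prod_poch₂Series h2 h6, ← expSeries_commute, ← expSeries_commute, expSeries_inv,
    ← expSeries_commute]
  congr 1
  funext m
  ring

/-- The scalars attached to the `m`-th boson, as rational functions of `Q = q^m`, `R = q^{rm}`,
`S = q^{(r-c)m}` and `δ = q - q⁻¹`. -/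
structure ScalarForms (q r c : ℝ) (m : ℕ) where
  /-- `q^m` -/
  Q : ℂ
  /-- `q^{rm}` -/
  R : ℂ
  /-- `q^{(r-c)m}` -/
  S : ℂ
  /-- `q - q⁻¹` -/
  δ : ℂ
  hm : (m : ℂ) ≠ 0
  hQ : Q ≠ 0
  hR : R ≠ 0
  hS : S ≠ 0
  hδ : δ ≠ 0
  hR2 : 1 - R ^ 2 ≠ 0
  hS2 : 1 - S ^ 2 ≠ 0
  hQ2' : Q ^ 2 - 1 ≠ 0
  hR2' : R ^ 2 - 1 ≠ 0
  hS2' : S ^ 2 - 1 ≠ 0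
  hQ3 : Q ^ 2 + 1 - Q ≠ 0
  hQ6 : 1 - Q ^ 6 ≠ 0
  δ_eq : (q : ℂ) - (q : ℂ)⁻¹ = δ
  q_pow : (q : ℂ) ^ m = Q
  nome_pow : nome q r ^ m = R ^ 2
  nome'_pow : nome q (r - c) ^ m = S ^ 2
  qrp : ((q : ℂ) ^ (r + 1 : ℂ)) ^ m = R * Q
  qrm : ((q : ℂ) ^ (r - 1 : ℂ)) ^ m = R / Q
  qsp : ((q : ℂ) ^ (r - c + 1 : ℂ)) ^ m = S * Q
  qsm : ((q : ℂ) ^ (r - c - 1 : ℂ)) ^ m = S / Q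
  qc : ((q ^ (c * m) : ℝ) : ℂ) = R / S
  qr : ((q ^ (r * m) : ℝ) : ℂ) = R
  uE_eq : uE q r c m = R / ((S - S⁻¹) / δ)
  vF_eq : vF q r m = -(R / ((R - R⁻¹) / δ))
  uK_eq : uK q r c m = ((Q - Q⁻¹) / δ) / (((S - S⁻¹) / δ) * ((Q - Q⁻¹) * (Q + Q⁻¹ - 1) / δ)) * (R / S)
  vK_eq : vK q r m = -(((Q - Q⁻¹) / δ) / (((R - R⁻¹) / δ) * ((Q - Q⁻¹) * (Q + Q⁻¹ - 1) / δ)))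
  uH_eq : uH q r c m = (R / S) / ((S - S⁻¹) / δ)
  vH_eq : vH q r m = -(1 / ((R - R⁻¹) / δ))
  chargeP_pos : chargeP q c m = 1 / m * ((Q - Q⁻¹) * (Q + Q⁻¹ - 1) / δ) * (S / R)
  chargeP_neg : chargeP q c (-m) = 1 / m * ((Q - Q⁻¹) * (Q + Q⁻¹ - 1) / δ) * (S / R)
  chargeM_pos : chargeM q m = -(1 / m * ((Q - Q⁻¹) * (Q + Q⁻¹ - 1) / δ))
  chargeM_neg : chargeM q (-m) = -(1 / m * ((Q - Q⁻¹) * (Q + Q⁻¹ - 1) / δ))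

lemma ScalarForms.nz {q r c : ℝ} {m : ℕ} (s : ScalarForms q r c m) :
    (m : ℂ) ≠ 0 ∧ s.Q ≠ 0 ∧ s.R ≠ 0 ∧ s.S ≠ 0 ∧ s.δ ≠ 0 ∧ s.Q ^ 2 - 1 ≠ 0 ∧ s.R ^ 2 - 1 ≠ 0 ∧
      s.S ^ 2 - 1 ≠ 0 ∧ 1 - s.R ^ 2 ≠ 0 ∧ 1 - s.S ^ 2 ≠ 0 ∧ s.Q ^ 2 + 1 - s.Q ≠ 0 ∧
      1 - s.Q ^ 6 ≠ 0 :=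
  ⟨s.hm, s.hQ, s.hR, s.hS, s.hδ, s.hQ2', s.hR2', s.hS2', s.hR2, s.hS2, s.hQ3, s.hQ6⟩

lemma qn_eq {q : ℝ} (hq₀ : 0 < q) (x : ℝ) : qn q x = (q ^ x - (q ^ x)⁻¹) / (q - q⁻¹) := by
  rw [qn, Real.rpow_neg hq₀.le]

lemma dn_eq {q : ℝ} (hq₀ : 0 < q) (x : ℝ) :
    dn q x = (q ^ x - (q ^ x)⁻¹) * (q ^ x + (q ^ x)⁻¹ - 1) / (q - q⁻¹) := by
  have h : q ^ x ≠ 0 := (Real.rpow_pos_of_pos hq₀ x).ne'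
  rw [dn, qn_eq hq₀, qn_eq hq₀, mul_comm 2 x, Real.rpow_mul hq₀.le, Real.rpow_two, ← sub_div]
  congr 1
  field_simp
  ring

lemma q_sub_inv_ne {q : ℝ} (hq₀ : 0 < q) (hq₁ : q < 1) : q - q⁻¹ ≠ 0 := by
  have := (one_lt_inv₀ hq₀).mpr hq₁
  linarith

lemma scalarForms {q r c : ℝ} (hq₀ : 0 < q) (hq₁ : q < 1) (hr : 0 < r) (hrc : 0 < r - c)
    {m : ℕ} (hm : 0 < m) : Nonempty (ScalarForms q r c m) := by
  have hm' : (0 : ℝ) < m := by exact_mod_cast hm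
  have pos : ∀ x : ℝ, 0 < q ^ x := fun x => Real.rpow_pos_of_pos hq₀ x
  have lt : ∀ x : ℝ, 0 < x → q ^ x < 1 := fun x hx => Real.rpow_lt_one hq₀.le hq₁ hx
  have ne : ∀ x : ℝ, ((q ^ x : ℝ) : ℂ) ≠ 0 := fun x => by exact_mod_cast (pos x).ne'
  have sq : ∀ x : ℝ, 0 < x → ∀ n : ℕ, n ≠ 0 → 1 - ((q ^ x : ℝ) : ℂ) ^ n ≠ 0 := fun x hx n hn => by
    have : (1 : ℝ) - (q ^ x) ^ n ≠ 0 := by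
      have := pow_lt_one₀ (pos x).le (lt x hx) hn
      linarith
    exact_mod_cast this
  have sq' : ∀ x : ℝ, 0 < x → ((q ^ x : ℝ) : ℂ) ^ 2 - 1 ≠ 0 := fun x hx => by
    rw [← neg_ne_zero, neg_sub]
    exact sq x hx 2 two_ne_zero
  have cp : ∀ x : ℝ, ((q : ℂ) ^ (x : ℂ)) ^ m = ((q ^ (x * m) : ℝ) : ℂ) := fun x => by
    rw [← Complex.ofReal_cpow hq₀.le, ← Complex.ofReal_pow, ← Real.rpow_mul_natCast hq₀.le]
  have hc : q ^ (c * m) = q ^ (r * m) / q ^ ((r - c) * m) := by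
    rw [← Real.rpow_sub hq₀]; ring_nf
  have hc' : ∀ y : ℝ, y = m ∨ y = -m → q ^ (-c * |y|) = q ^ ((r - c) * m) / q ^ (r * m) := by
    intro y hy
    have : |y| = m := by rcases hy with rfl | rfl <;> simp
    rw [this, ← Real.rpow_sub hq₀]; ring_nf
  have h1 : ∀ x : ℝ, q ^ ((x + 1) * m) = q ^ (x * m) * q ^ (m : ℝ) := fun x => by
    rw [← Real.rpow_add hq₀]; ring_nf
  have h2 : ∀ x : ℝ, q ^ ((x - 1) * m) = q ^ (x * m) / q ^ (m : ℝ) := fun x => by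
    rw [← Real.rpow_sub hq₀]; ring_nf
  have hnome : ∀ x : ℝ, nome q x ^ m = ((q ^ (x * m) : ℝ) : ℂ) ^ 2 := fun x => by
    rw [nome_eq hq₀, ← Complex.ofReal_pow, ← Complex.ofReal_pow, ← Real.rpow_mul_natCast hq₀.le,
      ← Real.rpow_mul_natCast hq₀.le]
    push_cast
    ring_nf
  refine ⟨⟨((q ^ (m : ℝ) : ℝ) : ℂ), ((q ^ (r * m) : ℝ) : ℂ), ((q ^ ((r - c) * m) : ℝ) : ℂ),
    ((q - q⁻¹ : ℝ) : ℂ), by exact_mod_cast hm.ne', ne _, ne _, ne _,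
    by exact_mod_cast q_sub_inv_ne hq₀ hq₁,
    sq _ (by positivity) 2 two_ne_zero, sq _ (by positivity) 2 two_ne_zero, sq' _ hm',
    sq' _ (by positivity), sq' _ (by positivity), ?_,
    sq _ hm' 6 (by norm_num), by push_cast; rfl, by rw [Real.rpow_natCast]; push_cast; rfl,
    hnome r, hnome (r - c), ?_, ?_, ?_, ?_, ?_, rfl, ?_, ?_, ?_, ?_, ?_, ?_, ?_, ?_, ?_, ?_⟩⟩
  · have : (q ^ (m : ℝ)) ^ 2 + 1 - q ^ (m : ℝ) ≠ 0 := by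
      nlinarith [sq_nonneg (q ^ (m : ℝ) - 1 / 2)]
    exact_mod_cast this
  · have := cp (r + 1); rw [h1] at this; push_cast at this ⊢; exact this
  · have := cp (r - 1); rw [h2] at this; push_cast at this ⊢; exact this
  · have := cp (r - c + 1); rw [h1] at this; push_cast at this ⊢; exact this
  · have := cp (r - c - 1); rw [h2] at this; push_cast at this ⊢; exact this
  · rw [hc]; push_cast; rfl
  · rw [uE, qn_eq hq₀]; push_cast; rfl
  · rw [vF, qn_eq hq₀]; push_cast; rfl
  · rw [uK, qn_eq hq₀, qn_eq hq₀, dn_eq hq₀, hc]; push_cast; rfl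
  · rw [vK, qn_eq hq₀, qn_eq hq₀, dn_eq hq₀]; push_cast; rfl
  · rw [uH, qn_eq hq₀, hc]; push_cast; rfl
  · rw [vH, qn_eq hq₀]; push_cast; rfl
  · rw [chargeP, hc' _ (Or.inl (by push_cast; rfl)), Int.cast_natCast, dn_eq hq₀]; push_cast; rfl
  · rw [chargeP, hc' _ (Or.inr (by push_cast; rfl)), Int.cast_neg, Int.cast_natCast, dn_neg,
      dn_eq hq₀]
    push_cast; ring
  · rw [chargeM, Int.cast_natCast, dn_eq hq₀]; push_cast; rfl
  · rw [chargeM, Int.cast_neg, Int.cast_natCast, dn_neg, dn_eq hq₀]; push_cast; ring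

/-- The central term `[a_m, a_{-m}]` in terms of the charge of `x⁺` and `[cm]_q`, where `q^{cm} =
R/S`. -/
lemma beta_pos {q r c : ℝ} (hq₀ : 0 < q) {m : ℕ} (s : ScalarForms q r c m)
    {M : Type*} [AddCommGroup M] [Module ℂ M] {π : Uq q c ⊗[ℂ] Heis →ₐ[ℂ] Module.End ℂ M}
    (hπ : IsRestricted π) :
    (heis hπ).β m = chargeP q c m * ((s.R / s.S - (s.R / s.S)⁻¹) / s.δ) := by
  rw [← s.qc, ← s.δ_eq]
  simp only [heis, chargeP]
  rw [Int.cast_natCast, qn_eq hq₀ (c * m)]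
  push_cast
  rfl

lemma beta_neg {q c : ℝ} (m : ℕ)
    {M : Type*} [AddCommGroup M] [Module ℂ M] {π : Uq q c ⊗[ℂ] Heis →ₐ[ℂ] Module.End ℂ M}
    (hπ : IsRestricted π) : (heis hπ).β (-m) = -(heis hπ).β m := by
  simp only [heis]
  rw [Int.cast_neg, Int.cast_natCast, abs_neg, mul_neg, dn_neg, qn_neg]
  push_cast
  ring

end Scalars

/-! ### The exchange relations of the modes -/

section ModeRelations
open Finset PowerSeries
variable {q r c : ℝ} {M : Type*} [AddCommGroup M] [Module ℂ M]
variable {π : Uq q c ⊗[ℂ] Heis →ₐ[ℂ] Module.End ℂ M}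

lemma primary_eField (r : ℝ) (hπ : IsRestricted π) : Primary (heis hπ).a (eField r hπ)
    fun m => chargeP q c m + if 0 < m then uE q r c m.toNat * (heis hπ).β m else 0 :=
  HeisData.primary_lD (primary_xp hπ) _

lemma primary_fField (r : ℝ) (hπ : IsRestricted π) : Primary (heis hπ).a (fField r hπ)
    fun m => chargeM q m + if m < 0 then vF q r (-m).toNat * (heis hπ).β m else 0 :=
  HeisData.primary_rD (primary_xm hπ) _


lemma Exch.congr_series {A B : TField M} {L R L' R' : PowerSeries ℂ} {C : ℂ} {e : ℤ}
    {D : ℤ → ℤ → M → M} (h : Exch A B L R C e D) (hL : L = L') (hR : R = R') :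
    Exch A B L' R' C e D := by
  subst hL hR
  exact h

/-- The total charge of `e(z)` on the positive side. -/
lemma charge_eField (hq₀ : 0 < q) {m : ℕ} (s : ScalarForms q r c m) (hπ : IsRestricted π) :
    chargeP q c m + uE q r c m * (heis hπ).β m =
      1 / m * ((s.Q - s.Q⁻¹) * (s.Q + s.Q⁻¹ - 1) / s.δ) * ((s.R - s.R⁻¹) / (s.S - s.S⁻¹)) := by
  obtain ⟨hm, hQ, hR, hS, hδ, hQ2, hR2, hS2, hR2', hS2', hQ3, hQ6⟩ := s.nz
  rw [beta_pos hq₀ s, s.uE_eq, s.chargeP_pos]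
  field_simp
  ring

/-- The total charge of `f(z)` on the negative side. -/
lemma charge_fField (hq₀ : 0 < q) {m : ℕ} (s : ScalarForms q r c m) (hπ : IsRestricted π) :
    chargeM q (-m) + vF q r m * (heis hπ).β (-m) =
      -(1 / m * ((s.Q - s.Q⁻¹) * (s.Q + s.Q⁻¹ - 1) / s.δ) * (s.S / s.R) *
        ((s.S - s.S⁻¹) / (s.R - s.R⁻¹))) := by
  obtain ⟨hm, hQ, hR, hS, hδ, hQ2, hR2, hS2, hR2', hS2', hQ3, hQ6⟩ := s.nz
  rw [beta_neg, beta_pos hq₀ s, s.vF_eq, s.chargeP_pos, s.chargeM_neg]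
  field_simp
  ring

lemma exch_K_E (hq₀ : 0 < q) (hq₁ : q < 1) (hr : 0 < r) (hrc : 0 < r - c)
    (hπ : IsRestricted π) :
    Exch (kField r hπ) (eField r hπ)
      (pochCoeff (nome q (r - c)) [(q : ℂ) ^ (r - c + 1 : ℂ)] [(q : ℂ) ^ (r - c - 1 : ℂ)]).series
      (pochCoeff (nome q (r - c)) [(q : ℂ) ^ (r - c + 1 : ℂ)] [(q : ℂ) ^ (r - c - 1 : ℂ)]).series
      1 0 fun _ _ _ => 0 := by
  have h := exch_vertexOp (primary_eField r hπ) (uK q r c) (vK q r)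
  rw [pochCoeff_series (norm_nome_lt hq₀ hq₁ hrc)]
  refine h.congr_series (expSeries_congr (A := ℂ) fun m hm => ?_)
    (expSeries_congr (A := ℂ) fun m hm => ?_)
  all_goals
    obtain ⟨s⟩ := scalarForms hq₀ hq₁ hr hrc hm
    obtain ⟨hm', hQ, hR, hS, hδ, hQ2, hR2, hS2, hR2', hS2', hQ3, hQ6⟩ := s.nz
    simp only [List.map_cons, List.map_nil, List.sum_cons, List.sum_nil, add_zero, s.qsp, s.qsm,
      s.nome'_pow]
  · rw [if_pos (by omega), Int.toNat_natCast, charge_eField hq₀ s hπ, s.vK_eq]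
    field_simp
    ring
  · rw [if_neg (by omega), add_zero, s.chargeP_neg, s.uK_eq]
    field_simp
    ring

lemma exch_K_F (hq₀ : 0 < q) (hq₁ : q < 1) (hr : 0 < r) (hrc : 0 < r - c)
    (hπ : IsRestricted π) :
    Exch (kField r hπ) (fField r hπ)
      (pochCoeff (nome q r) [(q : ℂ) ^ (r - 1 : ℂ)] [(q : ℂ) ^ (r + 1 : ℂ)]).series
      (pochCoeff (nome q r) [(q : ℂ) ^ (r - 1 : ℂ)] [(q : ℂ) ^ (r + 1 : ℂ)]).series
      1 0 fun _ _ _ => 0 := by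
  have h := exch_vertexOp (primary_fField r hπ) (uK q r c) (vK q r)
  rw [pochCoeff_series (norm_nome_lt hq₀ hq₁ hr)]
  refine h.congr_series (expSeries_congr (A := ℂ) fun m hm => ?_)
    (expSeries_congr (A := ℂ) fun m hm => ?_)
  all_goals
    obtain ⟨s⟩ := scalarForms hq₀ hq₁ hr hrc hm
    obtain ⟨hm', hQ, hR, hS, hδ, hQ2, hR2, hS2, hR2', hS2', hQ3, hQ6⟩ := s.nz
    simp only [List.map_cons, List.map_nil, List.sum_cons, List.sum_nil, add_zero, s.qrp, s.qrm,
      s.nome_pow]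
  · rw [if_neg (by omega), add_zero, s.chargeM_pos, s.vK_eq]
    field_simp
    ring
  · rw [if_pos (by omega), neg_neg, Int.toNat_natCast, charge_fField hq₀ s hπ, s.uK_eq]
    field_simp
    ring

/-- The logarithm of the structure function of `k(z₁) k(z₂)`. -/
def logRho (r : ℝ) (hπ : IsRestricted π) (m : ℕ) : ℂ :=
  -(vK q r m * (uK q r c m * (heis hπ).β m))

/-- The factor in `Q` comes from `[m]_q / ([2m]_q - [m]_q)` rewritten with denominator `1 -
q^{6m}`, which is the source of the second nome `q^6`. -/
lemma logRho_eq (hq₀ : 0 < q) {m : ℕ} (s : ScalarForms q r c m) (hπ : IsRestricted π) :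
    logRho r hπ m = -(1 / m * (s.R ^ 2 / (1 - s.R ^ 2) - s.S ^ 2 / (1 - s.S ^ 2)) *
      ((1 + s.Q - s.Q ^ 2 - 2 * s.Q ^ 3 - s.Q ^ 4 + s.Q ^ 5 + s.Q ^ 6) / (1 - s.Q ^ 6))) := by
  obtain ⟨hm, hQ, hR, hS, hδ, hQ2, hR2, hS2, hR2', hS2', hQ3, hQ6⟩ := s.nz
  rw [logRho, beta_pos hq₀ s, s.vK_eq, s.uK_eq, s.chargeP_pos]
  field_simp
  ring

lemma logRho_eq_sum (hq₀ : 0 < q) (hq₁ : q < 1) (hr : 0 < r) (hrc : 0 < r - c)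
    (hπ : IsRestricted π) {m : ℕ} (hm : 0 < m) :
    logRho r hπ m =
      (((rhoList₂ q r).map fun a => a ^ m).sum - ((rhoList₁ q r).map fun a => a ^ m).sum) /
          (m * ((1 - nome q r ^ m) * (1 - ((q : ℂ) ^ 6) ^ m))) +
        (((rhoList₁ q (r - c)).map fun a => a ^ m).sum -
            ((rhoList₂ q (r - c)).map fun a => a ^ m).sum) /
          (m * ((1 - nome q (r - c) ^ m) * (1 - ((q : ℂ) ^ 6) ^ m))) := by
  obtain ⟨s⟩ := scalarForms hq₀ hq₁ hr hrc hm
  obtain ⟨hm', hQ, hR, hS, hδ, hQ2, hR2, hS2, hR2', hS2', hQ3, hQ6⟩ := s.nz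
  rw [logRho_eq hq₀ s]
  simp only [rhoList₁, rhoList₂, List.map_cons, List.map_nil, List.sum_cons, List.sum_nil,
    add_zero, mul_pow, pow_right_comm _ _ m, s.q_pow, s.nome_pow, s.nome'_pow]
  field_simp
  ring

lemma logRho_series (hq₀ : 0 < q) (hq₁ : q < 1) (hr : 0 < r) (hrc : 0 < r - c)
    (hπ : IsRestricted π) :
    expSeries (logRho r hπ) = (rhoCoeff q r (r - c)).series := by
  rw [rhoCoeff_series hq₀ hq₁ hr hrc]
  exact expSeries_congr fun m hm => logRho_eq_sum hq₀ hq₁ hr hrc hπ hm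

lemma primary_kField (r : ℝ) (hπ : IsRestricted π) : Primary (heis hπ).a (kField r hπ) fun m =>
    (if m < 0 then vK q r (-m).toNat * (heis hπ).β m else 0) +
      if 0 < m then uK q r c m.toNat * (heis hπ).β m else 0 :=
  primary_vertexOp _ _

lemma exch_K_K (hq₀ : 0 < q) (hq₁ : q < 1) (hr : 0 < r) (hrc : 0 < r - c)
    (hπ : IsRestricted π) :
    Exch (kField r hπ) (kField r hπ) (rhoCoeff q r (r - c)).series (rhoCoeff q r (r - c)).series
      1 0 fun _ _ _ => 0 := by
  have h := exch_vertexOp (primary_kField r hπ) (uK q r c) (vK q r)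
  rw [← logRho_series hq₀ hq₁ hr hrc hπ]
  refine h.congr_series (expSeries_congr (A := ℂ) fun m hm => ?_)
    (expSeries_congr (A := ℂ) fun m hm => ?_)
  · rw [if_neg (by omega), if_pos (by omega), zero_add, Int.toNat_natCast, logRho]
  · rw [if_neg (c := 0 < -(m : ℤ)) (by omega), if_pos (by omega), add_zero, neg_neg,
      Int.toNat_natCast, logRho, beta_neg]
    ring

lemma exch_E_E (hq₀ : 0 < q) (hq₁ : q < 1) (hr : 0 < r) (hrc : 0 < r - c)
    (hπ : IsRestricted π) :
    Exch (eField r hπ) (eField r hπ)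
      (pochCoeff (nome q (r - c)) [(q : ℂ) ^ 2, (q : ℂ)⁻¹]
        [nome q (r - c) / q ^ 2, nome q (r - c) * q]).series
      (pochCoeff (nome q (r - c)) [(q : ℂ) ^ 2, (q : ℂ)⁻¹]
        [nome q (r - c) / q ^ 2, nome q (r - c) * q]).series (-1) 2 fun _ _ _ => 0 := by
  have h := exch_lD (primary_xp hπ) (uE q r c)
    (exch_x hπ 1 (A := (q : ℂ) ^ 2) (B := (q : ℂ)⁻¹) (by norm_cast) (by simp))
  rw [pochCoeff_series (norm_nome_lt hq₀ hq₁ hrc)]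
  rw [one_sub_eq_expSeries, one_sub_eq_expSeries, ← expSeries_commute, ← expSeries_commute] at h
  refine h.congr_series ?_ ?_
  all_goals
    refine expSeries_congr fun m hm => ?_
    obtain ⟨s⟩ := scalarForms hq₀ hq₁ hr hrc hm
    obtain ⟨hm', hQ, hR, hS, hδ, hQ2, hR2, hS2, hR2', hS2', hQ3, hQ6⟩ := s.nz
    simp only [List.map_cons, List.map_nil, List.sum_cons, List.sum_nil, add_zero, div_pow,
      mul_pow, inv_pow, pow_right_comm _ _ m, s.q_pow, s.nome'_pow, s.chargeP_neg, s.uE_eq]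
    field_simp
    ring

lemma exch_F_F (hq₀ : 0 < q) (hq₁ : q < 1) (hr : 0 < r) (hrc : 0 < r - c)
    (hπ : IsRestricted π) :
    Exch (fField r hπ) (fField r hπ)
      (pochCoeff (nome q r) [1 / (q : ℂ) ^ 2, (q : ℂ)] [nome q r * q ^ 2, nome q r / q]).series
      (pochCoeff (nome q r) [1 / (q : ℂ) ^ 2, (q : ℂ)] [nome q r * q ^ 2, nome q r / q]).series
      (-1) 2 fun _ _ _ => 0 := by
  have h := exch_rD (primary_xm hπ) (vF q r)
    (exch_x hπ (-1) (A := 1 / (q : ℂ) ^ 2) (B := (q : ℂ)) (by simp) (by simp))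
  rw [pochCoeff_series (norm_nome_lt hq₀ hq₁ hr)]
  rw [one_sub_eq_expSeries, one_sub_eq_expSeries, ← expSeries_commute, ← expSeries_commute] at h
  refine h.congr_series ?_ ?_
  all_goals
    refine expSeries_congr fun m hm => ?_
    obtain ⟨s⟩ := scalarForms hq₀ hq₁ hr hrc hm
    obtain ⟨hm', hQ, hR, hS, hδ, hQ2, hR2, hS2, hR2', hS2', hQ3, hQ6⟩ := s.nz
    simp only [List.map_cons, List.map_nil, List.sum_cons, List.sum_nil, add_zero, div_pow,
      mul_pow, one_pow, pow_right_comm _ _ m, s.q_pow, s.nome_pow, s.chargeM_pos, s.vF_eq]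
    field_simp
    ring

end ModeRelations

/-! ### The commutator of `e(z)` and `f(z)` -/

section Commutator
open Finset PowerSeries
variable {M : Type*} [AddCommGroup M] [Module ℂ M]

lemma HeisData.up_add (𝔥 : HeisData M) (u w : ℕ → ℂ) (n : ℕ) :
    𝔥.up (fun m => u m + w m) n = ∑ p ∈ antidiagonal n, 𝔥.up u p.1 * 𝔥.up w p.2 := by
  have h := congrArg (coeff n) (expSeries_add (𝔥.commute_up u u) (𝔥.commute_up w w)
    (𝔥.commute_up u w))
  rw [coeff_mul, coeff_expSeries] at h
  simp only [coeff_expSeries, ← add_smul] at h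
  exact h

lemma HeisData.dn_add (𝔥 : HeisData M) (v w : ℕ → ℂ) (n : ℕ) :
    (𝔥.dn (fun m => v m + w m)).mode n =
      ∑ p ∈ antidiagonal n, (𝔥.dn v).mode p.1 * (𝔥.dn w).mode p.2 := by
  have h := congrArg (coeff n) (expSeries_add (𝔥.commute_dn v v) (𝔥.commute_dn w w)
    (𝔥.commute_dn v w))
  rw [coeff_mul, coeff_expSeries] at h
  simp only [coeff_expSeries, ← add_smul] at h
  exact h

/-- Rescaling `z ↦ t z`. -/
lemma HeisData.up_rescale (𝔥 : HeisData M) (t : ℂ) (u : ℕ → ℂ) (n : ℕ) :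
    𝔥.up (fun m => t ^ m * u m) n = t ^ n • 𝔥.up u n := by
  have h := expCoeff_rescale (𝔥.commute_up u u) t n
  simp only [smul_smul] at h
  exact h

lemma HeisData.dn_rescale (𝔥 : HeisData M) (t : ℂ) (v : ℕ → ℂ) (n : ℕ) :
    (𝔥.dn (fun m => t ^ m * v m)).mode n = t ^ n • (𝔥.dn v).mode n := by
  have h := expCoeff_rescale (𝔥.commute_dn v v) t n
  simp only [smul_smul] at h
  exact h

lemma HeisData.up_congr (𝔥 : HeisData M) {u u' : ℕ → ℂ} (h : ∀ m, 0 < m → u m = u' m) :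
    𝔥.up u = 𝔥.up u' := by
  funext n
  exact expCoeff_congr (fun m hm => by rw [h m hm]) n

lemma HeisData.dn_congr (𝔥 : HeisData M) {u u' : ℕ → ℂ} (h : ∀ m, 0 < m → u m = u' m) :
    𝔥.dn u = 𝔥.dn u' := by
  have : (𝔥.dn u).mode = (𝔥.dn u').mode := by
    funext n
    exact expCoeff_congr (fun m hm => by rw [h m hm]) n
  simp only [HeisData.dn] at this ⊢
  congr

lemma TField.ext_apply {Y Z : TField M} (h : ∀ n v, Y n v = Z n v) : Y = Z := by
  obtain ⟨y, hy⟩ := Y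
  obtain ⟨z, hz⟩ := Z
  have : y = z := by
    funext n
    exact LinearMap.ext (h n)
  subst this
  rfl

lemma lD_lD (𝔥 : HeisData M) (u w : ℕ → ℂ) (Y : TField M) :
    lD (𝔥.up u) (lD (𝔥.up w) Y) = lD (𝔥.up fun m => u m + w m) Y := by
  refine TField.ext_apply fun n v => ?_
  simp only [lD_apply]
  have hb : BoxZero fun i j : ℕ => 𝔥.up u i (𝔥.up w j (Y (n + i + j) v)) :=
    (Trunc.box (β := fun k => Y k v) (Y.trunc v) n).map
      (fun i j x => 𝔥.up u i (𝔥.up w j x)) (by simp)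
  rw [finsum_congr fun i => map_finsum_of_evZero (𝔥.up u i)
    ((Y.evZero (n + i) v).map (fun j => 𝔥.up w j) (by simp)), ← finsum_antidiagonal hb]
  refine finsum_congr fun k => ?_
  rw [𝔥.up_add, LinearMap.sum_apply]
  refine sum_congr rfl fun p hp => ?_
  rw [← Finset.HasAntidiagonal.mem_antidiagonal.mp hp, Module.End.mul_apply]
  congr 4
  push_cast
  ring

lemma rD_rD (𝔥 : HeisData M) (v w : ℕ → ℂ) (Y : TField M) :
    rD (rD Y (𝔥.dn v)) (𝔥.dn w) = rD Y (𝔥.dn fun m => v m + w m) := by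
  refine TField.ext_apply fun n x => ?_
  simp only [rD_apply]
  have hb : BoxZero fun j i : ℕ => (Y (n - j - i)) ((𝔥.dn v) i ((𝔥.dn w) j x)) := by
    refine BoxZero.of_nested ?_ fun j =>
      ((𝔥.dn v).fin ((𝔥.dn w) j x)).map (fun i => Y (n - j - i)) (by simp)
    obtain ⟨N, hN⟩ := (𝔥.dn w).fin x
    refine ⟨N, fun j hj i => ?_⟩
    have := hN j hj
    simp only at this
    rw [this, map_zero, map_zero]
  rw [← finsum_antidiagonal hb]
  refine finsum_congr fun k => ?_
  have h := 𝔥.dn_add v w k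
  rw [h, LinearMap.sum_apply, map_sum, ← Finset.Nat.sum_antidiagonal_swap]
  refine sum_congr rfl fun p hp => ?_
  rw [← Finset.HasAntidiagonal.mem_antidiagonal.mp hp, Module.End.mul_apply]
  simp only [Prod.fst_swap, Prod.snd_swap]
  congr 2
  push_cast
  ring

/-- Rescaling `z ↦ t z`. -/
lemma vertexOp_rescale (𝔥 : HeisData M) {t : ℂ} (ht : t ≠ 0) (u v : ℕ → ℂ) (n : ℤ) (x : M) :
    vertexOp 𝔥 (fun m => t ^ m * u m) (fun m => t⁻¹ ^ m * v m) n x =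
      t ^ (-n) • vertexOp 𝔥 u v n x := by
  rw [vertexOp_apply, vertexOp_apply, smul_finsum]
  refine finsum_congr fun j => ?_
  rw [𝔥.up_rescale]
  split_ifs with h
  · have h1 := 𝔥.dn_rescale t⁻¹ v (n + j).toNat
    rw [h1, LinearMap.smul_apply, LinearMap.smul_apply, map_smul, smul_smul]
    congr 1
    rw [inv_pow, ← zpow_natCast, ← zpow_natCast, ← zpow_neg, ← zpow_add₀ ht]
    congr 1
    omega
  · simp

lemma vertexOp_congr (𝔥 : HeisData M) {u v u' v' : ℕ → ℂ} (hu : ∀ m, 0 < m → u m = u' m)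
    (hv : ∀ m, 0 < m → v m = v' m) : vertexOp 𝔥 u v = vertexOp 𝔥 u' v' := by
  rw [vertexOp, vertexOp, 𝔥.up_congr hu, 𝔥.dn_congr hv]

/-- Dressing a term `t^m κ Y_{m+n}` on the left of the first field and on the right of the
second one. -/
lemma dress_delta {U : ℕ → Module.End ℂ M} {V : FinSeq M} {κ : Module.End ℂ M} (Y : TField M)
    (hU : ∀ j, Commute κ (U j)) {t : ℂ} (ht : t ≠ 0) (m n : ℤ) (v : M) :
    ∑ᶠ J₂ : ℕ, ∑ᶠ J₁ : ℕ, U J₁ (t ^ (m + J₁) • κ (Y (m + J₁ + (n - J₂)) (V J₂ v))) =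
      t ^ m • κ (rD (lD (fun j => t ^ j • U j) Y) V (m + n) v) := by
  rw [rD_apply, map_finsum_of_evZero κ ((V.fin v).map (fun J => lD _ Y (m + n - J)) (by simp)),
    smul_finsum]
  refine finsum_congr fun J₂ => ?_
  rw [lD_apply, map_finsum_of_evZero κ
    ((Y.evZero _ _).map (fun j => t ^ j • U j) (by simp)), smul_finsum]
  refine finsum_congr fun J₁ => ?_
  rw [LinearMap.smul_apply, map_smul, map_smul, smul_smul, zpow_add₀ ht, zpow_natCast]
  have h := congrArg (fun f : Module.End ℂ M => f (Y (m + J₁ + (n - J₂)) (V J₂ v))) (hU J₁).eq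
  simp only [Module.End.mul_apply] at h
  rw [← h, show m + (J₁ : ℤ) + (n - J₂) = m + n - J₂ + J₁ by ring]

end Commutator

section CommutatorEF
open Finset PowerSeries
variable {q r c : ℝ} {M : Type*} [AddCommGroup M] [Module ℂ M]
variable {π : Uq q c ⊗[ℂ] Heis →ₐ[ℂ] Module.End ℂ M}

lemma commute_k_a (m : ℤ) : Commute (opU π (gU .k)) (opU π (ga m)) := by
  have h := repU_rel π (UqRel.k_a m)
  rw [map_mul, map_mul] at h
  exact h

lemma kinv_k_op : opU π (gU .kinv) * opU π (gU .k) = 1 := by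
  have h := repU_rel π (UqRel.kinv_k)
  rwa [map_mul, map_one] at h

lemma k_kinv_op : opU π (gU .k) * opU π (gU .kinv) = 1 := by
  have h := repU_rel π (UqRel.k_kinv)
  rwa [map_mul, map_one] at h

lemma commute_kinv {x : Module.End ℂ M} (h : Commute (opU π (gU .k)) x) :
    Commute (opU π (gU .kinv)) x := by
  have e : opU π (gU .kinv) * x * (opU π (gU .k) * opU π (gU .kinv)) =
      opU π (gU .kinv) * opU π (gU .k) * x * opU π (gU .kinv) := by
    rw [mul_assoc _ _ x, h.eq]
    simp only [mul_assoc]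
  rwa [k_kinv_op, kinv_k_op, mul_one, one_mul] at e

lemma psi_apply (hπ : IsRestricted π) (n : ℤ) (v : M) :
    repU π (gpsi q n) v = opU π (gU .k)
      (rD oneField ((heis hπ).dn fun _ => (q : ℂ) - (q : ℂ)⁻¹) n v) := by
  rw [rD_oneField_apply, gpsi]
  split_ifs with h
  · rw [map_mul, map_expCoeff]
    simp only [map_smul]
    rfl
  · simp

lemma lD_oneField_apply (U : ℕ → Module.End ℂ M) (n : ℤ) (v : M) :
    lD U oneField n v = if n ≤ 0 then U (-n).toNat v else 0 := by
  rw [lD_apply]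
  simp only [oneField_apply]
  split_ifs with h
  · rw [finsum_eq_single _ (-n).toNat]
    · rw [if_pos (by omega)]
    · intro j hj
      rw [if_neg (by omega), map_zero]
  · refine finsum_eq_zero_of_forall_eq_zero fun j => ?_
    rw [if_neg (by omega), map_zero]

lemma phi_apply (hπ : IsRestricted π) (n : ℤ) (v : M) :
    repU π (gphi q n) v = opU π (gU .kinv)
      (lD ((heis hπ).up fun _ => -((q : ℂ) - (q : ℂ)⁻¹)) oneField n v) := by
  rw [lD_oneField_apply, gphi]
  split_ifs with h
  · rw [map_mul, map_expCoeff]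
    simp only [map_smul]
    rfl
  · simp

/-- The relation between `x⁺` and `x⁻`: an exchange relation with inhomogeneous term the sum of a
`ψ`-part and a `φ`-part. -/
lemma exch_x_x (hq₀ : 0 < q) (hπ : IsRestricted π) :
    Exch (xField hπ 1) (xField hπ (-1)) 1 1 (-1) 0 fun m n v =>
      (-((q : ℂ) - (q : ℂ)⁻¹)⁻¹) •
        (((q ^ c : ℝ) : ℂ) ^ m • opU π (gU .k)
            (rD oneField ((heis hπ).dn fun _ => (q : ℂ) - (q : ℂ)⁻¹) (m + n) v) -
          (((q ^ c : ℝ) : ℂ)⁻¹) ^ m • opU π (gU .kinv)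
            (lD ((heis hπ).up fun _ => -((q : ℂ) - (q : ℂ)⁻¹)) oneField (m + n) v)) := by
  intro m n v
  have h := congrArg (fun f : Module.End ℂ M => f v) (repU_rel π (UqRel.xp_xm m n))
  simp only [map_add, map_sub, map_mul, map_smul, LinearMap.add_apply,
    LinearMap.sub_apply, LinearMap.smul_apply, Module.End.mul_apply] at h
  have e1 : ((q ^ (c * m) : ℝ) : ℂ) = ((q ^ c : ℝ) : ℂ) ^ m := by
    rw [Real.rpow_mul_intCast hq₀.le]; push_cast; rfl
  have e2 : ((q ^ (-c * m) : ℝ) : ℂ) = (((q ^ c : ℝ) : ℂ)⁻¹) ^ m := by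
    rw [Real.rpow_mul_intCast hq₀.le, Real.rpow_neg hq₀.le]; push_cast; rfl
  rw [pair_one, pair_one, add_zero, sub_zero, neg_one_smul, sub_neg_eq_add]
  rw [psi_apply hπ, phi_apply hπ, e1, e2] at h
  exact h

/-- The anticommutator of `e(z)` and `f(z)`: the series that appear when `u⁺` is moved past
`x⁻` and `u⁻` past `e` cancel, and the dressed `ψ` and `φ` are both rescalings of `ψ(z, p)`. -/
lemma anticomm_e_f (hq₀ : 0 < q) (hq₁ : q < 1) (hr : 0 < r) (hrc : 0 < r - c)
    (hπ : IsRestricted π) (m n : ℤ) (v : M) :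
    eField r hπ m (fField r hπ n v) + fField r hπ n (eField r hπ m v) =
      (-((q : ℂ) - (q : ℂ)⁻¹)⁻¹) •
        (((q ^ c : ℝ) : ℂ) ^ m • ((q ^ r : ℝ) : ℂ) ^ (-(m + n)) • opU π (gU .k)
            (psiField r hπ (m + n) v) -
          (((q ^ c : ℝ) : ℂ)⁻¹) ^ m • (((q ^ r : ℝ) : ℂ)⁻¹) ^ (-(m + n)) • opU π (gU .kinv)
            (psiField r hπ (m + n) v)) := by
  set δ : ℂ := (q : ℂ) - (q : ℂ)⁻¹ with hδ
  set t : ℂ := ((q ^ c : ℝ) : ℂ) with ht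
  set ρ : ℂ := ((q ^ r : ℝ) : ℂ) with hρ
  have ht0 : t ≠ 0 := by
    rw [ht]; exact_mod_cast (Real.rpow_pos_of_pos hq₀ c).ne'
  have hρ0 : ρ ≠ 0 := by
    rw [hρ]; exact_mod_cast (Real.rpow_pos_of_pos hq₀ r).ne'
  have tpow : ∀ m : ℕ, t ^ m = ((q ^ (c * m) : ℝ) : ℂ) := fun m => by
    rw [Real.rpow_mul_natCast hq₀.le]; push_cast; rfl
  have ρpow : ∀ m : ℕ, ρ ^ m = ((q ^ (r * m) : ℝ) : ℂ) := fun m => by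
    rw [Real.rpow_mul_natCast hq₀.le]; push_cast; rfl
  have h1 := (exch_x_x hq₀ hπ).lD_left (HeisData.leftComm (primary_xm hπ) (uE q r c))
  have h2 := h1.rD_right (HeisData.rightComm (primary_eField r hπ) (vF q r))
  -- the series from moving `u⁺` past `x⁻` and the one from moving `u⁻` past `e` are inverse
  have hR : (1 : PowerSeries ℂ) * (expSeries fun m => uE q r c m * chargeM q (-m)) *
      (expSeries fun m : ℕ => -(vF q r m * (chargeP q c m +
        if (0 : ℤ) < m then uE q r c (m : ℤ).toNat * (heis hπ).β m else 0))) = 1 := by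
    rw [one_mul, ← expSeries_commute, ← expSeries_zero (A := ℂ)]
    refine expSeries_congr fun m hm => ?_
    obtain ⟨s⟩ := scalarForms hq₀ hq₁ hr hrc hm
    obtain ⟨hm', hQ, hR, hS, hδ, hQ2, hR2, hS2, hR2', hS2', hQ3, hQ6⟩ := s.nz
    rw [if_pos (by omega), Int.toNat_natCast, charge_eField hq₀ s hπ, s.vF_eq, s.uE_eq,
      s.chargeM_neg]
    field_simp
    ring
  have h3 := h2.congr_series rfl hR m n v
  rw [pair_one, pair_one, add_zero, sub_zero, neg_one_smul, sub_neg_eq_add] at h3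
  refine h3.trans ?_
  -- the two terms of the delta function relation are dressed separately
  set Ψ : TField M := rD oneField ((heis hπ).dn fun _ => δ) with hΨ
  set Φ : TField M := lD ((heis hπ).up fun _ => -δ) oneField with hΦ
  set U := (heis hπ).up (uE q r c) with hU
  set V := (heis hπ).dn (vF q r) with hV
  have hs : ∀ J₂ : ℕ, (∑ᶠ J₁ : ℕ, U J₁ (-δ⁻¹ • (t ^ (m + (J₁ : ℤ)) • opU π (gU .k)
        (Ψ (m + J₁ + (n - J₂)) (V J₂ v)) - t⁻¹ ^ (m + (J₁ : ℤ)) • opU π (gU .kinv)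
        (Φ (m + J₁ + (n - J₂)) (V J₂ v))))) =
      -δ⁻¹ • ((∑ᶠ J₁ : ℕ, U J₁ (t ^ (m + (J₁ : ℤ)) • opU π (gU .k)
        (Ψ (m + J₁ + (n - J₂)) (V J₂ v)))) - ∑ᶠ J₁ : ℕ, U J₁ (t⁻¹ ^ (m + (J₁ : ℤ)) •
        opU π (gU .kinv) (Φ (m + J₁ + (n - J₂)) (V J₂ v)))) := by
    intro J₂
    have ev : ∀ (Y : TField M) (s : ℂ) (κ : Module.End ℂ M), EvZero fun J₁ : ℕ =>
        U J₁ (s ^ (m + (J₁ : ℤ)) • κ (Y (m + J₁ + (n - J₂)) (V J₂ v))) := fun Y s κ => by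
      have := (Y.evZero (m + (n - J₂)) (V J₂ v)).map
        (fun J₁ x => U J₁ (s ^ (m + (J₁ : ℤ)) • κ x)) (by simp)
      simpa only [add_right_comm] using this
    rw [← finsum_sub_of_evZero (ev _ _ _) (ev _ _ _), smul_finsum]
    refine finsum_congr fun J₁ => ?_
    rw [map_smul, map_sub]
  have ev : ∀ (Y : TField M) (s : ℂ) (κ : Module.End ℂ M), EvZero fun J₂ : ℕ =>
      ∑ᶠ J₁ : ℕ, U J₁ (s ^ (m + (J₁ : ℤ)) • κ (Y (m + J₁ + (n - J₂)) (V J₂ v))) :=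
    fun Y s κ => (V.fin v).map (fun J₂ x => ∑ᶠ J₁ : ℕ, U J₁ (s ^ (m + (J₁ : ℤ)) •
      κ (Y (m + J₁ + (n - J₂)) x))) (by simp)
  rw [finsum_congr hs, ← smul_finsum, finsum_sub_of_evZero (ev _ _ _) (ev _ _ _)]
  have cU : ∀ j, Commute (opU π (gU .k)) (U j) := fun j =>
    commute_expCoeff (fun m => (commute_k_a (-m)).smul_right _) j
  rw [dress_delta Ψ cU ht0, dress_delta Φ (fun j => commute_kinv (cU j)) (inv_ne_zero ht0)]
  have eU : ∀ s : ℂ, (fun j => s ^ j • U j) = (heis hπ).up fun m => s ^ m * uE q r c m := fun s => by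
    funext j
    rw [HeisData.up_rescale]
  rw [eU, eU, ← lD_rD, hΨ, rD_rD, hΦ, lD_lD, ← lD_rD]
  -- `u⁺(tz) ψ u⁻` is `ψ(z, p)` at `ρz`, and `u⁺(t⁻¹z) φ u⁻` is `ψ(z, p)` at `ρ⁻¹z`
  have v1 : vertexOp (heis hπ) (fun m => t ^ m * uE q r c m) (fun m => δ + vF q r m) =
      vertexOp (heis hπ) (fun m => ρ ^ m * uH q r c m) (fun m => ρ⁻¹ ^ m * vH q r m) := by
    refine vertexOp_congr _ (fun m hm => ?_) (fun m hm => ?_)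
    all_goals
      obtain ⟨s⟩ := scalarForms hq₀ hq₁ hr hrc hm
      obtain ⟨hm', hQ, hR, hS, hδ', hQ2, hR2, hS2, hR2', hS2', hQ3, hQ6⟩ := s.nz
    · rw [tpow, ρpow, s.qc, s.qr, s.uE_eq, s.uH_eq]
      field_simp
    · rw [inv_pow, ρpow, s.qr, s.vF_eq, s.vH_eq, hδ, s.δ_eq]
      field_simp
      ring
  have v2 : vertexOp (heis hπ) (fun m => t⁻¹ ^ m * uE q r c m + -δ) (vF q r) =
      vertexOp (heis hπ) (fun m => ρ⁻¹ ^ m * uH q r c m) (fun m => ρ⁻¹⁻¹ ^ m * vH q r m) := by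
    refine vertexOp_congr _ (fun m hm => ?_) (fun m hm => ?_)
    all_goals
      obtain ⟨s⟩ := scalarForms hq₀ hq₁ hr hrc hm
      obtain ⟨hm', hQ, hR, hS, hδ', hQ2, hR2, hS2, hR2', hS2', hQ3, hQ6⟩ := s.nz
    · rw [inv_pow, inv_pow, tpow, ρpow, s.qc, s.qr, s.uE_eq, s.uH_eq, hδ, s.δ_eq]
      field_simp
      ring
    · rw [inv_inv, ρpow, s.qr, s.vF_eq, s.vH_eq]
      field_simp
  have w1 : lD ((heis hπ).up fun m => t ^ m * uE q r c m)
      (rD oneField ((heis hπ).dn fun m => δ + vF q r m)) (m + n) v =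
      ρ ^ (-(m + n)) • psiField r hπ (m + n) v := by
    rw [← vertexOp, v1, vertexOp_rescale _ hρ0]
    rfl
  have w2 : lD ((heis hπ).up fun m => t⁻¹ ^ m * uE q r c m + -δ) (rD oneField V) (m + n) v =
      ρ⁻¹ ^ (-(m + n)) • psiField r hπ (m + n) v := by
    rw [hV, ← vertexOp, v2, vertexOp_rescale _ (inv_ne_zero hρ0)]
    rfl
  rw [w1, w2, map_smul, map_smul]

end CommutatorEF

/-! ### The Serre relations of the modes -/

section SerreModes
open Finset PowerSeries

/-- A relation between the summands of a series over `J : Fin 3 → ℕ`, after symmetrization, gives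
the same relation between the sums. -/
lemma serre_reindex {M : Type*} [AddCommGroup M] [Module ℂ M]
    (Ψ : (Fin 3 → ℕ) → ℤ → ℤ → ℤ → M)
    (hΨ : ∀ m₁ m₂ m₃, (fun J => Ψ J m₁ m₂ m₃).HasFiniteSupport) (α β γ : ℂ) (m : Fin 3 → ℤ)
    (h : ∀ J : Fin 3 → ℕ, ∑ σ : Equiv.Perm (Fin 3),
      (α • Ψ (J ∘ σ) (m (σ 0) + 1) (m (σ 1)) (m (σ 2)) +
        β • Ψ (J ∘ σ) (m (σ 0)) (m (σ 1) + 1) (m (σ 2)) +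
        γ • Ψ (J ∘ σ) (m (σ 0)) (m (σ 1)) (m (σ 2) + 1)) = 0) :
    ∑ σ : Equiv.Perm (Fin 3),
      (α • (∑ᶠ J, Ψ J (m (σ 0) + 1) (m (σ 1)) (m (σ 2))) +
        β • (∑ᶠ J, Ψ J (m (σ 0)) (m (σ 1) + 1) (m (σ 2))) +
        γ • (∑ᶠ J, Ψ J (m (σ 0)) (m (σ 1)) (m (σ 2) + 1))) = 0 := by
  have key : ∀ (σ : Equiv.Perm (Fin 3)) (a b d : ℤ),
      ∑ᶠ J, Ψ J a b d = ∑ᶠ J : Fin 3 → ℕ, Ψ (J ∘ σ) a b d := fun σ a b d =>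
    (finsum_comp_equiv (σ.symm.arrowCongr (Equiv.refl ℕ)) (f := fun J => Ψ J a b d)).symm
  have fin : ∀ (σ : Equiv.Perm (Fin 3)) (a b d : ℤ) (x : ℂ),
      (fun J : Fin 3 → ℕ => x • Ψ (J ∘ σ) a b d).HasFiniteSupport := fun σ a b d x => by
    have h1 := (hΨ a b d).preimage
      (f := fun J : Fin 3 → ℕ => J ∘ σ) (fun J _ J' _ hJ => σ.surjective.injective_comp_right hJ)
    refine h1.subset fun J hJ => ?_
    simp only [Function.mem_support, Set.mem_preimage] at hJ ⊢
    intro h0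
    exact hJ (by rw [h0, smul_zero])
  have step : ∀ σ : Equiv.Perm (Fin 3),
      α • (∑ᶠ J, Ψ J (m (σ 0) + 1) (m (σ 1)) (m (σ 2))) +
        β • (∑ᶠ J, Ψ J (m (σ 0)) (m (σ 1) + 1) (m (σ 2))) +
        γ • (∑ᶠ J, Ψ J (m (σ 0)) (m (σ 1)) (m (σ 2) + 1)) =
      ∑ᶠ J : Fin 3 → ℕ, (α • Ψ (J ∘ σ) (m (σ 0) + 1) (m (σ 1)) (m (σ 2)) +
        β • Ψ (J ∘ σ) (m (σ 0)) (m (σ 1) + 1) (m (σ 2)) +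
        γ • Ψ (J ∘ σ) (m (σ 0)) (m (σ 1)) (m (σ 2) + 1)) := fun σ => by
    have f₁ := fin σ (m (σ 0) + 1) (m (σ 1)) (m (σ 2)) α
    have f₂ := fin σ (m (σ 0)) (m (σ 1) + 1) (m (σ 2)) β
    have f₃ := fin σ (m (σ 0)) (m (σ 1)) (m (σ 2) + 1) γ
    have e₁ := finsum_add_distrib f₁ f₂
    have e₂ := finsum_add_distrib (f₁.add f₂) f₃
    rw [key σ, key σ, key σ, smul_finsum, smul_finsum, smul_finsum, ← e₁]
    exact e₂.symm
  rw [sum_congr rfl fun σ _ => step σ, ← finsum_sum_comm]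
  · exact finsum_eq_zero_of_forall_eq_zero h
  · exact fun σ _ => ((fin σ _ _ _ _).add (fin σ _ _ _ _)).add (fin σ _ _ _ _)

/-- A product of three commuting operators does not depend on their order. -/
lemma prod_three_perm {M : Type*} [AddCommGroup M] [Module ℂ M] {U : ℕ → Module.End ℂ M}
    (hU : ∀ i j, Commute (U i) (U j)) (J : Fin 3 → ℕ) (σ : Equiv.Perm (Fin 3)) (v : M) :
    U (J (σ 2)) (U (J (σ 1)) (U (J (σ 0)) v)) = U (J 2) (U (J 1) (U (J 0) v)) := by
  have rev : ∀ a b c, U a (U b (U c v)) = (U c * (U b * U a)) v := fun a b c => by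
    have : U a * (U b * U c) = U c * (U b * U a) := by
      rw [(hU b c).eq, ← mul_assoc, (hU a c).eq, mul_assoc, (hU a b).eq]
    exact congrArg (fun f : Module.End ℂ M => f v) this
  have h : (List.ofFn ((fun i => U (J i)) ∘ σ)).prod = (List.ofFn fun i => U (J i)).prod := by
    refine (Equiv.Perm.ofFn_comp_perm σ fun i => U (J i)).prod_eq' ?_
    rw [List.pairwise_ofFn]
    exact fun i j _ => hU _ _
  simp only [List.ofFn_succ, List.ofFn_zero, List.prod_cons, List.prod_nil, mul_one,
    Function.comp_apply] at h
  rw [rev, rev]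
  exact congrArg (fun f : Module.End ℂ M => f v) h

variable {q r c : ℝ} {M : Type*} [AddCommGroup M] [Module ℂ M]
variable {π : Uq q c ⊗[ℂ] Heis →ₐ[ℂ] Module.End ℂ M}

/-- The Serre relation of the Drinfeld currents, with the overall factor `q^{3ε/2}` removed. -/
lemma serre_x (hq₀ : 0 < q) (hπ : IsRestricted π) (ε : ℤˣ) {b : ℂ} (hb : b = (q : ℂ) ^ (ε : ℤ))
    (m : Fin 3 → ℤ) (v : M) :
    ∑ σ : Equiv.Perm (Fin 3),
      ((1 : ℂ) • xField hπ ε (m (σ 0) + 1) (xField hπ ε (m (σ 1)) (xField hπ ε (m (σ 2)) v)) +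
        (b - b ^ 2) •
          xField hπ ε (m (σ 0)) (xField hπ ε (m (σ 1) + 1) (xField hπ ε (m (σ 2)) v)) +
        (-b ^ 3) •
          xField hπ ε (m (σ 0)) (xField hπ ε (m (σ 1)) (xField hπ ε (m (σ 2) + 1) v))) = 0 := by
  have h := congrArg (fun f : Module.End ℂ M => f v)
    (repU_rel π (UqRel.serre ε m ((ε : ℤ) : ℝ) rfl))
  simp only [map_sum, map_add, map_sub, map_mul, map_smul, map_zero, LinearMap.add_apply,
    LinearMap.sub_apply, LinearMap.smul_apply, Module.End.mul_apply, LinearMap.sum_apply,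
    LinearMap.zero_apply] at h
  have h' := congrArg (fun x => ((q ^ (3 * ((ε : ℤ) : ℝ) / 2) : ℝ) : ℂ) • x) h
  simp only [smul_zero, smul_sum] at h'
  rw [← h']
  refine sum_congr rfl fun σ _ => ?_
  have hb' : b = ((q ^ ((ε : ℤ) : ℝ) : ℝ) : ℂ) := by
    rw [hb, Real.rpow_intCast]; push_cast; rfl
  have pw : ∀ n : ℕ, b ^ n = ((q ^ (((ε : ℤ) : ℝ) * n) : ℝ) : ℂ) := fun n => by
    rw [hb', Real.rpow_mul_natCast hq₀.le]; push_cast; rfl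
  set e : ℝ := ((ε : ℤ) : ℝ)
  have e₁ : ((q ^ (3 * e / 2) : ℝ) : ℂ) * ((q ^ (-3 * e / 2) : ℝ) : ℂ) = 1 := by
    rw [← Complex.ofReal_mul, ← Real.rpow_add hq₀, show 3 * e / 2 + -3 * e / 2 = 0 by ring,
      Real.rpow_zero, Complex.ofReal_one]
  have e₂ : ((q ^ (3 * e / 2) : ℝ) : ℂ) * ((q ^ (-e / 2) - q ^ (e / 2) : ℝ) : ℂ) =
      b - b ^ 2 := by
    rw [pw, hb', ← Complex.ofReal_mul, ← Complex.ofReal_sub, mul_sub, ← Real.rpow_add hq₀,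
      ← Real.rpow_add hq₀, show 3 * e / 2 + -e / 2 = e by ring,
      show 3 * e / 2 + e / 2 = e * (2 : ℕ) by push_cast; ring]
  have e₃ : ((q ^ (3 * e / 2) : ℝ) : ℂ) * ((q ^ (3 * e / 2) : ℝ) : ℂ) = b ^ 3 := by
    rw [pw, ← Complex.ofReal_mul, ← Real.rpow_add hq₀,
      show 3 * e / 2 + 3 * e / 2 = e * (3 : ℕ) by push_cast; ring]
  rw [smul_sub, smul_add, smul_smul, smul_smul, smul_smul, e₁, e₂, e₃, neg_smul,
    ← sub_eq_add_neg]
  rfl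

/-- The symmetrized product of three dressed currents: the factors `1 - b² w` of the structure
function `A = (1 - b² w) B` turn the polynomial of the Serre relation into shifts of modes. -/
lemma serre_of_triple {Y : TField M} {g : PowerSeries ℂ} {b : ℂ} (m : Fin 3 → ℤ) (v : M)
    (h : ∑ σ : Equiv.Perm (Fin 3),
      ((1 : ℂ) • triple g g g Y Y Y (m (σ 0) + 1) (m (σ 1)) (m (σ 2)) v +
        (b - b ^ 2) • triple g g g Y Y Y (m (σ 0)) (m (σ 1) + 1) (m (σ 2)) v +
        (-b ^ 3) • triple g g g Y Y Y (m (σ 0)) (m (σ 1)) (m (σ 2) + 1) v) = 0) :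
    ∑ σ : Equiv.Perm (Fin 3),
      (triple ((1 - PowerSeries.C (b ^ 2) * X) * g) g g Y Y Y (m (σ 0) + 1) (m (σ 1)) (m (σ 2)) v +
        b • triple g g ((1 - PowerSeries.C (b ^ 2) * X) * g) Y Y Y
          (m (σ 0)) (m (σ 1) + 1) (m (σ 2)) v) = 0 := by
  rw [← h]
  refine sum_congr rfl fun σ _ => ?_
  rw [triple_one_sub_left, triple_one_sub_right, add_sub_cancel_right, add_sub_cancel_right]
  module

/-- In normal order the three dressings `U` stand to the left of three Drinfeld currents; they
commute, so the Serre relation of the Drinfeld currents can be applied under each of their modes.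
-/
lemma serre_eField (hq₀ : 0 < q) (hπ : IsRestricted π) (m : Fin 3 → ℤ) (v : M) :
    ∑ σ : Equiv.Perm (Fin 3),
      (triple ((1 - PowerSeries.C ((q : ℂ) ^ 2) * X) * expSeries fun m => uE q r c m *
          chargeP q c (-m)) (expSeries fun m => uE q r c m * chargeP q c (-m))
          (expSeries fun m => uE q r c m * chargeP q c (-m))
          (eField r hπ) (eField r hπ) (eField r hπ) (m (σ 0) + 1) (m (σ 1)) (m (σ 2)) v +
        (q : ℂ) • triple (expSeries fun m => uE q r c m * chargeP q c (-m))
          (expSeries fun m => uE q r c m * chargeP q c (-m))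
          ((1 - PowerSeries.C ((q : ℂ) ^ 2) * X) * expSeries fun m => uE q r c m *
            chargeP q c (-m))
          (eField r hπ) (eField r hπ) (eField r hπ) (m (σ 0)) (m (σ 1) + 1) (m (σ 2)) v) = 0 := by
  refine serre_of_triple m v ?_
  set g := expSeries fun m => uE q r c m * chargeP q c (-m) with hg
  set U := (heis hπ).up (uE q r c) with hU
  set Y := xField hπ 1 with hY
  have hL : LeftComm U (eField r hπ) g := by
    have h1 := HeisData.leftComm (primary_eField r hπ) (uE q r c)
    rwa [expSeries_congr (b := fun m : ℕ => uE q r c m * (chargeP q c (-m) + _))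
      (c := fun m => uE q r c m * chargeP q c (-m))
      fun m hm => by rw [if_neg (by omega), add_zero]] at h1
  have hT : ∀ m₁ m₂ m₃, triple g g g (eField r hπ) (eField r hπ) (eField r hπ) m₁ m₂ m₃ v =
      ∑ᶠ J : Fin 3 → ℕ, U (J 2) (U (J 1) (U (J 0)
        (Y (m₁ + J 0) (Y (m₂ + J 1) (Y (m₃ + J 2) v))))) := fun m₁ m₂ m₃ => by
    have hb := triple_lD_box U Y m₁ m₂ m₃ v
    rw [← hb.rev.finsum_eq_fin, ← hb.rev.finsum_eq, hb.rev.finsum_eq_rev]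
    exact triple_lD hL m₁ m₂ m₃ v
  simp only [hT]
  refine serre_reindex (fun J m₁ m₂ m₃ => U (J 2) (U (J 1) (U (J 0)
        (Y (m₁ + J 0) (Y (m₂ + J 1) (Y (m₃ + J 2) v)))))) (fun m₁ m₂ m₃ =>
        (triple_lD_box U Y m₁ m₂ m₃ v).rev.finite_fin) _ _ _ m fun J => ?_
  have hc : ∀ i j, Commute (U i) (U j) := fun i j =>
    commute_expCoeff_expCoeff ((heis hπ).commute_up _ _) i j
  have h := serre_x hq₀ hπ 1 (b := (q : ℂ)) (by simp) (fun i => m i + J i) v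
  have h2 := congrArg (fun x => U (J 2) (U (J 1) (U (J 0) x))) h
  simp only [map_sum, map_add, map_smul, map_zero] at h2
  rw [← h2]
  refine sum_congr rfl fun σ _ => ?_
  simp only [Function.comp_apply]
  rw [prod_three_perm hc, prod_three_perm hc, prod_three_perm hc]
  simp only [add_right_comm _ (1 : ℤ)]
  rfl

/-- As `serre_eField`, with the three dressings `V` to the right of the Drinfeld currents. -/
lemma serre_fField (hq₀ : 0 < q) (hπ : IsRestricted π) (m : Fin 3 → ℤ) (v : M) :
    ∑ σ : Equiv.Perm (Fin 3),
      (triple ((1 - PowerSeries.C ((q : ℂ)⁻¹ ^ 2) * X) * expSeries fun m => -(vF q r m *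
          chargeM q m)) (expSeries fun m => -(vF q r m * chargeM q m))
          (expSeries fun m => -(vF q r m * chargeM q m))
          (fField r hπ) (fField r hπ) (fField r hπ) (m (σ 0) + 1) (m (σ 1)) (m (σ 2)) v +
        (q : ℂ)⁻¹ • triple (expSeries fun m => -(vF q r m * chargeM q m))
          (expSeries fun m => -(vF q r m * chargeM q m))
          ((1 - PowerSeries.C ((q : ℂ)⁻¹ ^ 2) * X) * expSeries fun m => -(vF q r m *
            chargeM q m))
          (fField r hπ) (fField r hπ) (fField r hπ) (m (σ 0)) (m (σ 1) + 1) (m (σ 2)) v) = 0 := by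
  refine serre_of_triple m v ?_
  set g := expSeries fun m : ℕ => -(vF q r m * chargeM q m) with hg
  set V := (heis hπ).dn (vF q r) with hV
  set Y := xField hπ (-1) with hY
  have hL : RightComm (fField r hπ) V g := by
    have h1 := HeisData.rightComm (primary_fField r hπ) (vF q r)
    rwa [expSeries_congr (b := fun m : ℕ => -(vF q r m * (chargeM q m + _)))
      (c := fun m => -(vF q r m * chargeM q m))
      fun m hm => by rw [if_neg (by omega), add_zero]] at h1
  have hT : ∀ m₁ m₂ m₃, triple g g g (fField r hπ) (fField r hπ) (fField r hπ) m₁ m₂ m₃ v =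
      ∑ᶠ J : Fin 3 → ℕ, Y (m₁ - J 0) (Y (m₂ - J 1) (Y (m₃ - J 2)
        (V (J 2) (V (J 1) (V (J 0) v))))) := fun m₁ m₂ m₃ => by
    rw [← (triple_rD_box Y Y Y V V V m₁ m₂ m₃ v).finsum_eq_fin]
    exact triple_rD' hL hL hL m₁ m₂ m₃ v
  simp only [hT]
  refine serre_reindex (fun J m₁ m₂ m₃ => Y (m₁ - J 0) (Y (m₂ - J 1) (Y (m₃ - J 2)
        (V (J 2) (V (J 1) (V (J 0) v)))))) (fun m₁ m₂ m₃ =>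
        (triple_rD_box Y Y Y V V V m₁ m₂ m₃ v).finite_fin) _ _ _ m fun J => ?_
  have hc : ∀ i j, Commute (V i) (V j) := fun i j =>
    commute_expCoeff_expCoeff ((heis hπ).commute_dn _ _) i j
  have h := serre_x hq₀ hπ (-1) (b := (q : ℂ)⁻¹) (by simp) (fun i => m i - J i)
    (V (J 2) (V (J 1) (V (J 0) v)))
  rw [← h]
  refine sum_congr rfl fun σ _ => ?_
  simp only [Function.comp_apply]
  rw [prod_three_perm hc]
  simp only [add_sub_right_comm _ (1 : ℤ)]
  rfl

end SerreModes

/-! ### Sums over modes of products at coinciding points -/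

section ModeSums
open Finset PowerSeries

variable {M : Type*} [AddCommGroup M] [Module ℂ M]

/-- Inverting the action of a power series on a finitely supported sequence. -/
lemma finsum_act_inv {g g' : PowerSeries ℂ} (h : g' * g = 1) {Φ : ℕ → M} (hΦ : EvZero Φ) :
    Φ 0 = ∑ᶠ k, coeff k g' • ∑ᶠ j, coeff j g • Φ (k + j) := by
  have hb : BoxZero fun k j => coeff k g' • coeff j g • Φ (k + j) := by
    obtain ⟨N, hN⟩ := hΦ
    exact ⟨N, fun i j hij => by simp only; rw [hN _ (by omega), smul_zero, smul_zero]⟩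
  have h1 : ∀ k, coeff k g' • ∑ᶠ j, coeff j g • Φ (k + j) =
      ∑ᶠ j, coeff k g' • coeff j g • Φ (k + j) := fun k => smul_finsum _ _
  rw [finsum_congr h1, ← finsum_antidiagonal hb]
  have h2 : ∀ n, ∑ p ∈ antidiagonal n, coeff p.1 g' • coeff p.2 g • Φ (p.1 + p.2) =
      coeff n (1 : PowerSeries ℂ) • Φ n := fun n => by
    rw [← h, coeff_mul, sum_smul]
    refine sum_congr rfl fun p hp => ?_
    rw [smul_smul, Finset.HasAntidiagonal.mem_antidiagonal.mp hp]
  rw [finsum_congr h2, finsum_eq_single _ 0 fun n hn => by rw [coeff_one, if_neg hn, zero_smul]]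
  simp

/-- The action of a summable series along a direction `d` multiplies the sum of a summable
family by the sum of the series. -/
lemma hasSum_act {G : Type*} [AddCommGroup G] (d : G) {g : ℕ → ℂ} {c a : G → ℂ} {S T : ℂ}
    (hg : HasSum g S) (hc : HasSum c T) (ha : ∀ m, HasSum (fun k => g k * c (m + k • d)) (a m)) :
    HasSum a (S * T) := by
  have h1 : HasSum (fun x : ℕ × G => g x.1 * c x.2) (S * T) :=
    hg.mul hc (hg.summable.norm.mul_norm hc.summable.norm).of_norm
  let e : G × ℕ ≃ ℕ × G :=
    { toFun := fun x => (x.2, x.1 + x.2 • d)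
      invFun := fun y => (y.2 - y.1 • d, y.1)
      left_inv := fun x => by simp
      right_inv := fun y => by simp }
  exact (e.hasSum_iff.mpr h1).prod_fiberwise ha

/-- A finite sum over `ℕ` of vectors, seen through a functional, as a convergent series. -/
lemma hasSum_of_evZero (ξ : Module.Dual ℂ M) {f : ℕ → M} (hf : EvZero f) :
    HasSum (fun k => ξ (f k)) (ξ (∑ᶠ k, f k)) := by
  obtain ⟨N, hN⟩ := hf
  rw [finsum_eq_sum_range hN, map_sum]
  exact hasSum_sum_of_ne_finset_zero fun k hk => by
    rw [hN k (by simpa using hk), map_zero]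

/-- The form of `hasSum_act` for vectors seen through a functional. -/
lemma hasSum_act_evZero {G : Type*} [AddCommGroup G] (d : G) {g : PowerSeries ℂ} {S T : ℂ}
    (ξ : Module.Dual ℂ M) {c a : G → M} (hg : HasSum (fun k => coeff k g) S)
    (hc : HasSum (fun m => ξ (c m)) T) (he : ∀ m, EvZero fun k : ℕ => coeff k g • c (m + k • d))
    (ha : ∀ m, a m = ∑ᶠ k : ℕ, coeff k g • c (m + k • d)) :
    HasSum (fun m => ξ (a m)) (S * T) := by
  refine hasSum_act d hg hc fun m => ?_
  have h := hasSum_of_evZero ξ (he m)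
  simp only [map_smul, smul_eq_mul] at h
  rwa [ha m]

lemma lD_one_eq_zero (U : ℕ → Module.End ℂ M) {n : ℤ} (hn : 0 < n) (v : M) :
    lD U oneField n v = 0 := by
  rw [lD_oneField_apply, if_neg (by omega)]

/-- The sum over all modes of the normally ordered product of `U(z) V(z)` and `Y(z)`. -/
lemma hasSum_normal (ξ : Module.Dual ℂ M) (U : ℕ → Module.End ℂ M) (Y : TField M) (V : FinSeq M)
    (N : ℤ) (v : M) :
    HasSum (fun m : ℤ => ξ (∑ᶠ J : ℕ, lD U oneField (m - J) (Y (N - m) (V J v))))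
      (ξ (lD U (rD Y V) N v)) := by
  obtain ⟨J₀, hJ₀⟩ := V.fin v
  simp only at hJ₀
  have h1 : ∀ m : ℤ, ∑ᶠ J : ℕ, lD U oneField (m - J) (Y (N - m) (V J v)) =
      ∑ J ∈ range J₀, lD U oneField (m - J) (Y (N - m) (V J v)) := fun m =>
    finsum_eq_sum_range fun J hJ => by rw [hJ₀ J hJ, map_zero, map_zero]
  have h2 : lD U (rD Y V) N v = ∑ J ∈ range J₀, lD U Y (N - J) (V J v) := by
    rw [lD_rD, rD_apply]
    exact finsum_eq_sum_range fun J hJ => by rw [hJ₀ J hJ, map_zero]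
  simp only [h1, h2, map_sum]
  refine hasSum_sum fun J _ => ?_
  have hinj : Function.Injective fun I : ℕ => (J : ℤ) - I := fun I I' h => by
    simp only at h
    omega
  rw [← hinj.hasSum_iff]
  · rw [lD_apply]
    have h3 := hasSum_of_evZero ξ ((Y.evZero (N - J) (V J v)).map (fun I => U I) (by simp))
    convert h3 using 2 with I
    simp only [Function.comp_apply]
    rw [lD_oneField_apply, if_pos (by omega), show N - ((J : ℤ) - I) = N - J + I by ring,
      show (-((J : ℤ) - I - J)).toNat = I by omega]
  · intro m hm
    rw [lD_one_eq_zero, map_zero]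
    by_contra hlt
    exact hm ⟨(J - m).toNat, by simp only; omega⟩

variable {𝔥 : HeisData M}

/-- A vertex operator is its creation part dressed by its annihilation part. -/
lemma vertexOp_eq_rD (u v : ℕ → ℂ) :
    vertexOp 𝔥 u v = rD (lD (𝔥.up u) oneField) (𝔥.dn v) := lD_rD _ _ _

/-- The sum over modes of the product at the same point of a vertex operator and a primary field
converges to the normally ordered product times the value at `1` of the contraction. -/
lemma hasSum_vertexOp_mul {Y : TField M} {γ : ℤ → ℂ} (h : Primary 𝔥.a Y γ) (u v : ℕ → ℂ) {S : ℂ}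
    (hS : HasSum (fun k => coeff k (expSeries fun m : ℕ => v m * γ m)) S)
    (ξ : Module.Dual ℂ M) (N : ℤ) (x : M) :
    HasSum (fun m : ℤ => ξ (vertexOp 𝔥 u v m (Y (N - m) x)))
      (S * ξ (lD (𝔥.up u) (rD Y (𝔥.dn v)) N x)) := by
  have hR := HeisData.rightComm h v
  have hinv : (expSeries fun m : ℕ => v m * γ m) * (expSeries fun m : ℕ => -(v m * γ m)) = 1 := by
    rw [mul_comm, expSeries_neg_mul]
  have hF : ∀ m n : ℤ, pair (expSeries fun m : ℕ => -(v m * γ m)) (vertexOp 𝔥 u v) Y m n x =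
      ∑ᶠ J : ℕ, lD (𝔥.up u) oneField (m - J) (Y n (𝔥.dn v J x)) := fun m n => by
    have h1 := pair_rD_left hR 1 (lD (𝔥.up u) oneField) m n x
    rw [one_mul] at h1
    rw [vertexOp_eq_rD, h1]
    simp only [pair_one]
  refine hasSum_act_evZero (-1 : ℤ) ξ hS (hasSum_normal ξ (𝔥.up u) Y (𝔥.dn v) N x)
    (fun m => ?_) fun m => ?_
  · obtain ⟨N₀, hN₀⟩ := Y.trunc x
    refine ⟨(N₀ - (N - m)).toNat, fun k hk => ?_⟩
    simp only
    rw [← hF, pair, finsum_eq_zero_of_forall_eq_zero fun i => ?_, smul_zero]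
    rw [hN₀ _ (by simp only [nsmul_eq_mul]; omega), map_zero, smul_zero]
  · have h1 := pair_one (vertexOp 𝔥 u v) Y m (N - m) x
    rw [← hinv, pair_mul] at h1
    rw [← h1]
    refine finsum_congr fun k => ?_
    rw [hF]
    simp only [nsmul_eq_mul, mul_neg, mul_one, ← sub_eq_add_neg]
    rw [show N - (m - (k : ℤ)) = N - m + k by ring]

/-- Acting by a summable series along the direction `(p, s, -p - s)` preserves summability over
the plane of modes of total degree `N`. -/
lemma summable_act_plane (ξ : Module.Dual ℂ M) {F G : ℤ → ℤ → ℤ → M} (p s : ℤ)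
    {g : PowerSeries ℂ} (hg : Summable fun k => coeff k g) {N : ℤ}
    (hG : Summable fun m : ℤ × ℤ => ξ (G m.1 m.2 (N - m.1 - m.2)))
    (he : ∀ a b d, EvZero fun k : ℕ => coeff k g • G (a + k * p) (b + k * s) (d - k * p - k * s))
    (h : ∀ a b d, F a b d =
      ∑ᶠ k : ℕ, coeff k g • G (a + k * p) (b + k * s) (d - k * p - k * s)) :
    Summable fun m : ℤ × ℤ => ξ (F m.1 m.2 (N - m.1 - m.2)) := by
  have e : ∀ (m : ℤ × ℤ) (k : ℕ), G (m + k • (p, s)).1 (m + k • (p, s)).2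
      (N - (m + k • (p, s)).1 - (m + k • (p, s)).2) =
      G (m.1 + k * p) (m.2 + k * s) (N - m.1 - m.2 - k * p - k * s) := fun m k => by
    simp only [Prod.fst_add, Prod.snd_add, Prod.smul_mk, nsmul_eq_mul]
    congr 1
    ring
  refine (hasSum_act_evZero (c := fun m : ℤ × ℤ => G m.1 m.2 (N - m.1 - m.2)) (p, s) ξ
    hg.hasSum hG.hasSum (fun m => ?_) fun m => ?_).summable
  · simp only [e]
    exact he _ _ _
  · simp only [e]
    exact h _ _ _

/-- The product of three fields is absolutely summable over the modes of a given total degree: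
removing the three contractions leaves a normally ordered product, which has only finitely many
non-zero modes there. -/
lemma summable_vertexOp_mul_mul {γB γC : ℤ → ℂ} {u v u' v' : ℕ → ℂ} {C : TField M}
    (hB : Primary 𝔥.a (vertexOp 𝔥 u' v') γB) (hC : Primary 𝔥.a C γC)
    (h₂₁ : Summable fun k => coeff k (expSeries fun m : ℕ => v m * γB m))
    (h₃₁ : Summable fun k => coeff k (expSeries fun m : ℕ => v m * γC m))
    (h₃₂ : Summable fun k => coeff k (expSeries fun m : ℕ => v' m * γC m))
    (ξ : Module.Dual ℂ M) (N : ℤ) (x : M) :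
    Summable fun m : ℤ × ℤ =>
      ξ (vertexOp 𝔥 u v m.1 (vertexOp 𝔥 u' v' m.2 (C (N - m.1 - m.2) x))) := by
  have inv : ∀ b : ℕ → ℂ, expSeries b * expSeries (fun m => -b m) = 1 := fun b => by
    rw [mul_comm, expSeries_neg_mul]
  set A := vertexOp 𝔥 u v with hA
  set B := vertexOp 𝔥 u' v' with hBdef
  set g₂₁ := expSeries fun m : ℕ => -(v m * γB m) with hg₂₁
  set g₃₁ := expSeries fun m : ℕ => -(v m * γC m) with hg₃₁
  set g₃₂ := expSeries fun m : ℕ => -(v' m * γC m) with hg₃₂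
  obtain ⟨n₀, hn₀⟩ := C.trunc x
  -- the products with the contractions `21`, then `31`, then `32` removed
  set f : ℤ → ℤ → ℤ → M := fun a b d => A a (B b (C d x)) with hf
  set f₁ : ℤ → ℤ → ℤ → M := fun a b d => ∑ᶠ i : ℕ, coeff i g₂₁ • f (a - i) (b + i) d with hf₁
  set f₂ : ℤ → ℤ → ℤ → M := fun a b d => ∑ᶠ i : ℕ, coeff i g₃₁ • f₁ (a - i) b (d + i) with hf₂
  set f₃ : ℤ → ℤ → ℤ → M := fun a b d => ∑ᶠ i : ℕ, coeff i g₃₂ • f₂ a (b - i) (d + i) with hf₃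
  have z : ∀ a b d, n₀ ≤ d → f a b d = 0 := fun a b d hd => by
    simp only [hf]; rw [hn₀ d hd, map_zero, map_zero]
  have z₁ : ∀ a b d, n₀ ≤ d → f₁ a b d = 0 := fun a b d hd =>
    finsum_eq_zero_of_forall_eq_zero fun i => by rw [z _ _ _ hd, smul_zero]
  have z₂ : ∀ a b d, n₀ ≤ d → f₂ a b d = 0 := fun a b d hd =>
    finsum_eq_zero_of_forall_eq_zero fun i => by rw [z₁ _ _ _ (by omega), smul_zero]
  have z₃ : ∀ a b d, n₀ ≤ d → f₃ a b d = 0 := fun a b d hd =>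
    finsum_eq_zero_of_forall_eq_zero fun i => by rw [z₂ _ _ _ (by omega), smul_zero]
  have e₁ : ∀ a b d, EvZero fun i : ℕ => f (a - i) (b + i) d := fun a b d =>
    (B.evZero b (C d x)).map (fun i => A (a - i)) (by simp)
  have ev : ∀ (F : ℤ → ℤ → ℤ → M) (p s : ℕ → ℤ) (d : ℤ), (∀ a b d, n₀ ≤ d → F a b d = 0) →
      EvZero fun i : ℕ => F (p i) (s i) (d + i) := fun F p s d hF =>
    ⟨(n₀ - d).toNat, fun i hi => hF _ _ _ (by omega)⟩
  -- the normally ordered product has finite support in each total degree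
  have hf₃' : ∀ a b d, f₃ a b d = ∑ᶠ J₁ : ℕ, ∑ᶠ J₂ : ℕ,
      lD (𝔥.up u) oneField (a - J₁) (lD (𝔥.up u') oneField (b - J₂) (C d
        (𝔥.dn v' J₂ (𝔥.dn v J₁ x)))) := fun a b d => by
    have hB' := HeisData.rightComm hB v
    rw [hBdef, vertexOp_eq_rD] at hB'
    rw [← triple_rD hB' (HeisData.rightComm hC v) (HeisData.rightComm hC v'), triple_eq_rev,
      ← vertexOp_eq_rD, ← vertexOp_eq_rD]
    simp only [hf₃, hf₂, hf₁, hf, sub_right_comm a, add_sub_right_comm b, add_right_comm d]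
    rfl
  obtain ⟨K, hK⟩ : BoxZero fun J₁ J₂ : ℕ => 𝔥.dn v' J₂ (𝔥.dn v J₁ x) := by
    refine BoxZero.of_nested ?_ fun J₁ => (𝔥.dn v').fin _
    obtain ⟨K, hK⟩ := (𝔥.dn v).fin x
    exact ⟨K, fun J hJ i => by
      have := hK J hJ
      simp only at this
      rw [this, map_zero]⟩
  have supp : ∀ a b d, (K : ℤ) ≤ a ∨ (K : ℤ) ≤ b ∨ n₀ ≤ d → f₃ a b d = 0 := by
    rintro a b d h
    by_cases hd : n₀ ≤ d
    · exact z₃ a b d hd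
    rw [hf₃']
    refine finsum_eq_zero_of_forall_eq_zero fun J₁ => finsum_eq_zero_of_forall_eq_zero fun J₂ => ?_
    by_cases hJ : K ≤ J₁ ∨ K ≤ J₂
    · have := hK J₁ J₂ hJ
      simp only at this
      rw [this, map_zero, map_zero, map_zero]
    · rcases h with h | h | h
      · exact lD_one_eq_zero _ (by omega) _
      · rw [lD_one_eq_zero (𝔥.up u') (n := b - J₂) (by omega), map_zero]
      · exact absurd h hd
  have s₃ : Summable fun m : ℤ × ℤ => ξ (f₃ m.1 m.2 (N - m.1 - m.2)) := by
    refine summable_of_hasFiniteSupport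
      (((Set.finite_Ioo (N - n₀ - K) K).prod (Set.finite_Ioo (N - n₀ - K) K)).subset ?_)
    rintro ⟨a, b⟩ h
    rw [Function.mem_support] at h
    have h1 := mt (supp a b (N - a - b)) fun h0 => h (by simp only; rw [h0, map_zero])
    push Not at h1
    simp only [Set.mem_prod, Set.mem_Ioo]
    omega
  -- the contractions are put back one by one
  have a₂ : ∀ a b d, f₂ a b d = ∑ᶠ k : ℕ, coeff k (expSeries fun m : ℕ => v' m * γC m) •
      f₃ a (b - k) (d + k) := fun a b d => by
    have h := finsum_act_inv (inv fun m : ℕ => v' m * γC m)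
      (ev f₂ (fun _ => a) (fun i => b - i) d z₂)
    simp only [Nat.cast_zero, sub_zero, add_zero] at h
    rw [h]
    refine finsum_congr fun k => ?_
    simp only [hf₃, Nat.cast_add, sub_sub, add_assoc]
    rfl
  have a₁ : ∀ a b d, f₁ a b d = ∑ᶠ k : ℕ, coeff k (expSeries fun m : ℕ => v m * γC m) •
      f₂ (a - k) b (d + k) := fun a b d => by
    have h := finsum_act_inv (inv fun m : ℕ => v m * γC m)
      (ev f₁ (fun i => a - i) (fun _ => b) d z₁)
    simp only [Nat.cast_zero, sub_zero, add_zero] at h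
    rw [h]
    refine finsum_congr fun k => ?_
    simp only [hf₂, Nat.cast_add, sub_sub, add_assoc]
    rfl
  have a₀ : ∀ a b d, f a b d = ∑ᶠ k : ℕ, coeff k (expSeries fun m : ℕ => v m * γB m) •
      f₁ (a - k) (b + k) d := fun a b d => by
    have h := finsum_act_inv (inv fun m : ℕ => v m * γB m) (e₁ a b d)
    simp only [Nat.cast_zero, sub_zero, add_zero] at h
    rw [h]
    refine finsum_congr fun k => ?_
    simp only [hf₁, Nat.cast_add, sub_sub, add_assoc]
    rfl
  have s₂ := summable_act_plane ξ (F := f₂) (G := f₃) 0 (-1) h₃₂ s₃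
    (fun a b d => by
      simp only [mul_zero, add_zero, sub_zero, mul_neg, mul_one, sub_neg_eq_add, ← sub_eq_add_neg]
      exact (ev f₃ (fun _ => a) (fun k => b - k) d z₃).map (fun k y => coeff k _ • y) (by simp))
    (fun a b d => by
      simp only [mul_zero, add_zero, sub_zero, mul_neg, mul_one, sub_neg_eq_add, ← sub_eq_add_neg]
      exact a₂ a b d)
  have s₁ := summable_act_plane ξ (F := f₁) (G := f₂) (-1) 0 h₃₁ s₂
    (fun a b d => by
      simp only [mul_zero, add_zero, sub_zero, mul_neg, mul_one, sub_neg_eq_add, ← sub_eq_add_neg]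
      exact (ev f₂ (fun k => a - k) (fun _ => b) d z₂).map (fun k y => coeff k _ • y) (by simp))
    (fun a b d => by
      simp only [mul_zero, add_zero, sub_zero, mul_neg, mul_one, sub_neg_eq_add, ← sub_eq_add_neg]
      exact a₁ a b d)
  have e₁' : ∀ a b d, EvZero fun k : ℕ => f₁ (a - k) (b + k) d := fun a b d => by
    obtain ⟨n₁, hn₁⟩ := B.trunc (C d x)
    refine ⟨(n₁ - b).toNat, fun k hk => finsum_eq_zero_of_forall_eq_zero fun i => ?_⟩
    simp only [hf]
    rw [hn₁ _ (by omega), map_zero, smul_zero]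
  exact summable_act_plane ξ (F := f) (G := f₁) (-1) 1 h₂₁ s₁
    (fun a b d => by
      simp only [mul_one, mul_neg, sub_neg_eq_add, ← sub_eq_add_neg, add_sub_cancel_right]
      exact (e₁' a b d).map (fun k y => coeff k _ • y) (by simp))
    (fun a b d => by
      simp only [mul_one, mul_neg, sub_neg_eq_add, ← sub_eq_add_neg, add_sub_cancel_right]
      exact a₀ a b d)

/-- The sum over all modes of a given total degree of the product of three fields. -/
lemma hasSum_vertexOp_mul_mul {γB γC γ : ℤ → ℂ} {u v u' v' : ℕ → ℂ} {C : TField M}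
    (hB : Primary 𝔥.a (vertexOp 𝔥 u' v') γB) (hC : Primary 𝔥.a C γC)
    (hBC : Primary 𝔥.a (lD (𝔥.up u') (rD C (𝔥.dn v'))) γ) {S T : ℂ}
    (h₂₁ : Summable fun k => coeff k (expSeries fun m : ℕ => v m * γB m))
    (h₃₁ : Summable fun k => coeff k (expSeries fun m : ℕ => v m * γC m))
    (h₃₂ : HasSum (fun k => coeff k (expSeries fun m : ℕ => v' m * γC m)) S)
    (h₁ : HasSum (fun k => coeff k (expSeries fun m : ℕ => v m * γ m)) T)
    (ξ : Module.Dual ℂ M) (N : ℤ) (x : M) :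
    HasSum (fun m : ℤ × ℤ =>
      ξ (vertexOp 𝔥 u v m.1 (vertexOp 𝔥 u' v' m.2 (C (N - m.1 - m.2) x))))
      (S * (T * ξ (lD (𝔥.up u) (rD (lD (𝔥.up u') (rD C (𝔥.dn v'))) (𝔥.dn v)) N x))) := by
  have h := (summable_vertexOp_mul_mul (u := u) hB hC h₂₁ h₃₁ h₃₂.summable ξ N x).hasSum
  -- by summability the sum may be computed iteratively: first the product of the last two factors,
  -- then the product of the first with the result
  have h2 := h.prod_fiberwise fun m =>
    hasSum_vertexOp_mul hC u' v' h₃₂ (ξ ∘ₗ vertexOp 𝔥 u v m) (N - m) x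
  have h3 := (hasSum_vertexOp_mul hBC u v h₁ ξ N x).mul_left S
  rwa [h2.unique h3] at h

end ModeSums

/-! ### The constants of the inverse of `K` and of `H` -/

section Constants
open Finset PowerSeries

/-- The logarithm of a product of double infinite products. -/
lemma braceProd_eq_exp {q r : ℝ} (hq₀ : 0 < q) (hq₁ : q < 1) (hr : 0 < r) (w : ℂ) (L : List ℂ)
    (hL : ∀ a ∈ L, ‖a * w‖ < 1) :
    (Summable fun m : ℕ => -((L.map fun a => a ^ m).sum * w ^ m /
      (m * ((1 - nome q r ^ m) * (1 - ((q : ℂ) ^ 6) ^ m))))) ∧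
    braceProd q r L w = Complex.exp (∑' m : ℕ, -((L.map fun a => a ^ m).sum * w ^ m /
      (m * ((1 - nome q r ^ m) * (1 - ((q : ℂ) ^ 6) ^ m))))) := by
  induction L with
  | nil => simp [braceProd, summable_zero]
  | cons a L ih =>
    obtain ⟨h1, h2⟩ := ih fun b hb => hL b (List.mem_cons_of_mem _ hb)
    obtain ⟨h3, h4⟩ := poch₂_eq_exp (hL a List.mem_cons_self) (norm_nome_lt hq₀ hq₁ hr)
      (norm_q_pow_lt hq₀ hq₁ (n := 6) (by norm_num))
    have e : ∀ m : ℕ, -((((a :: L).map fun a => a ^ m).sum) * w ^ m /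
        (m * ((1 - nome q r ^ m) * (1 - ((q : ℂ) ^ 6) ^ m)))) =
        -((a * w) ^ m / (m * ((1 - nome q r ^ m) * (1 - ((q : ℂ) ^ 6) ^ m)))) +
        -((L.map fun a => a ^ m).sum * w ^ m /
          (m * ((1 - nome q r ^ m) * (1 - ((q : ℂ) ^ 6) ^ m)))) := fun m => by
      rw [List.map_cons, List.sum_cons, mul_pow]
      ring
    simp only [e]
    refine ⟨h3.of_norm.add h1, ?_⟩
    rw [h3.of_norm.tsum_add h1, Complex.exp_add, ← h2, ← h4]
    simp [braceProd, brace]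

variable {q r c : ℝ} {M : Type*} [AddCommGroup M] [Module ℂ M]
variable {π : Uq q c ⊗[ℂ] Heis →ₐ[ℂ] Module.End ℂ M}

lemma logRho_zero (hπ : IsRestricted π) : logRho r hπ 0 = 0 := by
  simp [logRho, uK, qn]

/-- The contraction of `k(z)` and `k(wz)⁻¹` for `|w| ≤ 1`: it converges, and its value is the
quotient of infinite products that defines `rhoCoeff`. -/
lemma logRho_sum (hq₀ : 0 < q) (hq₁ : q < 1) (hr : 0 < r) (hrc : 0 < r - c)
    (hπ : IsRestricted π) {w : ℂ} (hw : ‖w‖ ≤ 1) :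
    (Summable fun m => logRho r hπ m * w ^ m) ∧ (rhoCoeff q r (r - c)).den w ≠ 0 ∧
      Complex.exp (∑' m, logRho r hπ m * w ^ m) =
        (rhoCoeff q r (r - c)).num w / (rhoCoeff q r (r - c)).den w := by
  have nq : ∀ n : ℕ, ‖(q : ℂ) ^ n‖ ≤ 1 := fun n => by
    rw [norm_pow, Complex.norm_real, Real.norm_of_nonneg hq₀.le]
    exact pow_le_one₀ hq₀.le hq₁.le
  have small : ∀ (s : ℝ) (_ : 0 < s) (n : ℕ), ‖nome q s * (q : ℂ) ^ n * w‖ < 1 := fun s hs n => by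
    rw [norm_mul, norm_mul, mul_assoc]
    refine lt_of_le_of_lt (mul_le_of_le_one_right (norm_nonneg _) ?_) (norm_nome_lt hq₀ hq₁ hs)
    exact mul_le_one₀ (nq n) (norm_nonneg _) hw
  have l₁ : ∀ s : ℝ, 0 < s → ∀ a ∈ rhoList₁ q s, ‖a * w‖ < 1 := fun s hs a ha => by
    have h0 := small s hs 0
    have h1 := small s hs 1
    rw [pow_zero, mul_one] at h0
    rw [pow_one] at h1
    simp only [rhoList₁, List.mem_cons, List.not_mem_nil, or_false] at ha
    rcases ha with rfl | rfl | rfl | rfl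
    exacts [h0, h1, small s hs 5, small s hs 6]
  have l₂ : ∀ s : ℝ, 0 < s → ∀ a ∈ rhoList₂ q s, ‖a * w‖ < 1 := fun s hs a ha => by
    simp only [rhoList₂, List.mem_cons, List.not_mem_nil, or_false] at ha
    rcases ha with rfl | rfl | rfl | rfl
    exacts [small s hs 2, small s hs 3, small s hs 3, small s hs 4]
  obtain ⟨s₁, e₁⟩ := braceProd_eq_exp hq₀ hq₁ hr w _ (l₁ r hr)
  obtain ⟨s₂, e₂⟩ := braceProd_eq_exp hq₀ hq₁ hr w _ (l₂ r hr)
  obtain ⟨s₃, e₃⟩ := braceProd_eq_exp hq₀ hq₁ hrc w _ (l₁ _ hrc)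
  obtain ⟨s₄, e₄⟩ := braceProd_eq_exp hq₀ hq₁ hrc w _ (l₂ _ hrc)
  have key : HasSum (fun m => logRho r hπ m * w ^ m) _ :=
    ((s₁.hasSum.add s₄.hasSum).sub (s₂.hasSum.add s₃.hasSum)).congr_fun fun m => by
      rcases Nat.eq_zero_or_pos m with rfl | hm
      · simp [logRho_zero]
      · rw [logRho_eq_sum hq₀ hq₁ hr hrc hπ hm]
        ring
  refine ⟨key.summable, ?_, ?_⟩
  · simp only [rhoCoeff]
    rw [e₂, e₃]
    exact mul_ne_zero (Complex.exp_ne_zero _) (Complex.exp_ne_zero _)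
  · simp only [rhoCoeff]
    rw [key.tsum_eq, e₁, e₂, e₃, e₄, ← Complex.exp_add, ← Complex.exp_add, ← Complex.exp_sub]

/-- The contraction of `k(z)` and the normally ordered inverse of `k(wz)`. -/
def rhoVal (r : ℝ) (hπ : IsRestricted π) (w : ℂ) : ℂ := Complex.exp (∑' m, logRho r hπ m * w ^ m)

lemma rhoVal_ne_zero (hπ : IsRestricted π) (w : ℂ) : rhoVal r hπ w ≠ 0 := Complex.exp_ne_zero _

lemma braceProd_rhoList₁ (q r : ℝ) (j : ℕ) :
    braceProd q r (rhoList₁ q r) ((q : ℂ) ^ j) =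
      brace q r (nome q r * q ^ j) * brace q r (nome q r * q ^ (j + 1)) *
        brace q r (nome q r * q ^ (j + 5)) * brace q r (nome q r * q ^ (j + 6)) := by
  simp only [braceProd, rhoList₁, List.map_cons, List.map_nil, List.prod_cons, List.prod_nil]
  rw [pow_add (q : ℂ) j 1, pow_add (q : ℂ) j 5, pow_add (q : ℂ) j 6, pow_one]
  simp only [mul_comm ((q : ℂ) ^ j), mul_assoc, mul_one]

lemma braceProd_rhoList₂ (q r : ℝ) (j : ℕ) :
    braceProd q r (rhoList₂ q r) ((q : ℂ) ^ j) =
      brace q r (nome q r * q ^ (j + 2)) * brace q r (nome q r * q ^ (j + 3)) ^ 2 *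
        brace q r (nome q r * q ^ (j + 4)) := by
  simp only [braceProd, rhoList₂, List.map_cons, List.map_nil, List.prod_cons, List.prod_nil]
  rw [pow_add (q : ℂ) j 2, pow_add (q : ℂ) j 3, pow_add (q : ℂ) j 4]
  simp only [mul_comm ((q : ℂ) ^ j), mul_assoc, mul_one, sq]

lemma brace_nome_ne_zero {q r : ℝ} (hq₀ : 0 < q) (hq₁ : q < 1) (hr : 0 < r) (j : ℕ) :
    brace q r (nome q r * q ^ j) ≠ 0 := by
  have h : ‖nome q r * (q : ℂ) ^ j‖ < 1 := by
    rw [norm_mul]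
    refine lt_of_le_of_lt (mul_le_of_le_one_right (norm_nonneg _) ?_) (norm_nome_lt hq₀ hq₁ hr)
    rw [norm_pow, Complex.norm_real, Real.norm_of_nonneg hq₀.le]
    exact pow_le_one₀ hq₀.le hq₁.le
  rw [brace, (poch₂_eq_exp h (norm_nome_lt hq₀ hq₁ hr)
    (norm_q_pow_lt hq₀ hq₁ (n := 6) (by norm_num))).2]
  exact Complex.exp_ne_zero _

/-- The constant `κ` is the product of the contractions in `K(q⁻¹z) K(z)⁻¹ K(qz)` and of the
normalization of `K(z)⁻¹`. -/
lemma kappa_eq (hq₀ : 0 < q) (hq₁ : q < 1) (hr : 0 < r) (hrc : 0 < r - c)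
    (hπ : IsRestricted π) :
    kappa q r c * rhoVal r hπ q ^ 2 = rhoVal r hπ 1 * rhoVal r hπ (q ^ 2) := by
  have hn : ∀ j : ℕ, ‖(q : ℂ) ^ j‖ ≤ 1 := fun j => by
    rw [norm_pow, Complex.norm_real, Real.norm_of_nonneg hq₀.le]
    exact pow_le_one₀ hq₀.le hq₁.le
  have h : ∀ j : ℕ, rhoVal r hπ ((q : ℂ) ^ j) = _ := fun j =>
    (logRho_sum hq₀ hq₁ hr hrc hπ (hn j)).2.2
  have h0 := h 0
  have h1 := h 1
  simp only [rhoCoeff, braceProd_rhoList₁, braceProd_rhoList₂] at h0 h1 h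
  rw [pow_zero, mul_one] at h0
  rw [pow_one] at h1
  rw [h0, h1, h 2, kappa]
  have b := brace_nome_ne_zero hq₀ hq₁ hr
  have b' := brace_nome_ne_zero hq₀ hq₁ hrc
  have b0 := b 0
  have b1 := b 1
  have b0' := b' 0
  have b1' := b' 1
  rw [pow_zero, mul_one] at b0 b0'
  rw [pow_one] at b1 b1'
  simp only [zero_add, pow_one]
  have b2 := b 2; have b3 := b 3; have b4 := b 4; have b5 := b 5; have b6 := b 6
  have b7 := b 7; have b8 := b 8
  have b2' := b' 2; have b3' := b' 3; have b4' := b' 4; have b5' := b' 5; have b6' := b' 6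
  have b7' := b' 7; have b8' := b' 8
  norm_num only
  field_simp

end Constants

/-! ### Products of `K(z)` and its inverse at the same point -/

section Inverse
open Finset PowerSeries
variable {M : Type*} [AddCommGroup M] [Module ℂ M]

/-- The normally ordered product of two vertex operators is a vertex operator. -/
lemma vertexOp_merge (𝔥 : HeisData M) (u v u' v' : ℕ → ℂ) :
    lD (𝔥.up u) (rD (vertexOp 𝔥 u' v') (𝔥.dn v)) =
      vertexOp 𝔥 (fun m => u m + u' m) (fun m => v' m + v m) := by
  rw [vertexOp, ← lD_rD, rD_rD, lD_lD]
  rfl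

lemma vertexOp_zero (𝔥 : HeisData M) {u v : ℕ → ℂ} (hu : ∀ m, 0 < m → u m = 0)
    (hv : ∀ m, 0 < m → v m = 0) (n : ℤ) (x : M) :
    vertexOp 𝔥 u v n x = if n = 0 then x else 0 := by
  have h0 : ∀ (b : ℕ → Module.End ℂ M) (j : ℕ), (∀ m, 0 < m → b m = 0) →
      expCoeff b j = if j = 0 then 1 else 0 := fun b j hb => by
    rw [expCoeff_congr (c := fun _ => 0) hb]
    have := congrArg (coeff j) (expSeries_zero (A := Module.End ℂ M))
    rwa [coeff_expSeries, coeff_one] at this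
  have hup : ∀ j, 𝔥.up u j = if j = 0 then 1 else 0 := fun j =>
    h0 _ j fun m hm => by rw [hu m hm, zero_smul]
  have hdn : ∀ j, (𝔥.dn v).mode j = if j = 0 then 1 else 0 := fun j =>
    h0 _ j fun m hm => by rw [hv m hm, zero_smul]
  rw [vertexOp_apply, finsum_eq_single _ 0 fun j hj => by
    rw [hup, if_neg hj, LinearMap.zero_apply], hup, if_pos rfl, Nat.cast_zero, add_zero,
    Module.End.one_apply]
  by_cases hn : 0 ≤ n
  · have := hdn n.toNat
    rw [if_pos hn, this]
    by_cases h : n = 0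
    · subst h; simp
    · rw [if_neg h, if_neg (by omega), LinearMap.zero_apply]
  · rw [if_neg hn, if_neg (by omega)]

variable {q r c : ℝ} {π : Uq q c ⊗[ℂ] Heis →ₐ[ℂ] Module.End ℂ M}

/-- The sum of the coefficients of the contraction at `w`. -/
lemma hasSum_rhoVal (hq₀ : 0 < q) (hq₁ : q < 1) (hr : 0 < r) (hrc : 0 < r - c)
    (hπ : IsRestricted π) {w : ℂ} (hw : ‖w‖ ≤ 1) {b : ℕ → ℂ}
    (hb : ∀ m, 0 < m → b m = logRho r hπ m * w ^ m) :
    HasSum (fun k => coeff k (expSeries b)) (rhoVal r hπ w) := by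
  rw [expSeries_congr hb]
  simp only [coeff_expSeries]
  exact (hasSum_expCoeff (by rw [logRho_zero, zero_mul])
    (logRho_sum hq₀ hq₁ hr hrc hπ hw).1.norm).2

/-- The normally ordered product of `k(z)` and `:k(z)⁻¹:` is `1`, so that only the value of the
contraction at `1` remains. -/
lemma hasSum_k_kinv (hq₀ : 0 < q) (hq₁ : q < 1) (hr : 0 < r) (hrc : 0 < r - c)
    (hπ : IsRestricted π) (ξ : Module.Dual ℂ M) (N : ℤ) (x : M) :
    HasSum (fun m : ℤ => ξ (kField r hπ m (kinvField r hπ (N - m) x)))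
      (rhoVal r hπ 1 * if N = 0 then ξ x else 0) := by
  have h := hasSum_vertexOp_mul (𝔥 := heis hπ)
    (primary_vertexOp (fun m => -uK q r c m) (fun m => -vK q r m)) (uK q r c) (vK q r)
    (hasSum_rhoVal hq₀ hq₁ hr hrc hπ (w := 1) (by simp) fun m hm => by
      rw [if_neg (by omega), if_pos (by omega), Int.toNat_natCast, logRho]; ring) ξ N x
  rw [vertexOp_merge, vertexOp_zero _ (fun m _ => by ring) (fun m _ => by ring), apply_ite ξ,
    map_zero] at h
  exact h

lemma hasSum_kinv_k (hq₀ : 0 < q) (hq₁ : q < 1) (hr : 0 < r) (hrc : 0 < r - c)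
    (hπ : IsRestricted π) (ξ : Module.Dual ℂ M) (N : ℤ) (x : M) :
    HasSum (fun m : ℤ => ξ (kinvField r hπ m (kField r hπ (N - m) x)))
      (rhoVal r hπ 1 * if N = 0 then ξ x else 0) := by
  have h := hasSum_vertexOp_mul (primary_kField r hπ) (fun m => -uK q r c m) (fun m => -vK q r m)
    (hasSum_rhoVal hq₀ hq₁ hr hrc hπ (w := 1) (by simp) fun m hm => by
      rw [if_neg (by omega), if_pos (by omega), Int.toNat_natCast, logRho]; ring) ξ N x
  rw [kField, vertexOp_merge, vertexOp_zero _ (fun m _ => by ring) (fun m _ => by ring),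
    apply_ite ξ, map_zero] at h
  exact h

/-- The triple product `K(q⁻¹z) K(z)⁻¹ K(qz)` without zero modes. -/
lemma hasSum_k_kinv_k (hq₀ : 0 < q) (hq₁ : q < 1) (hr : 0 < r) (hrc : 0 < r - c)
    (hπ : IsRestricted π) (ξ : Module.Dual ℂ M) (N : ℤ) (x : M) :
    HasSum (fun m : ℤ × ℤ => (q : ℂ) ^ m.1 * (q : ℂ) ^ (-(N - m.1 - m.2)) *
        ξ (kField r hπ m.1 (kinvField r hπ m.2 (kField r hπ (N - m.1 - m.2) x))))
      (rhoVal r hπ q ^ 2 / rhoVal r hπ (q ^ 2) * ξ (psiField r hπ N x)) := by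
  have hq : (q : ℂ) ≠ 0 := by exact_mod_cast hq₀.ne'
  have hw : ‖(q : ℂ)‖ ≤ 1 := by
    rw [Complex.norm_real, Real.norm_of_nonneg hq₀.le]; exact hq₁.le
  have hw2 : ‖(q : ℂ) ^ 2‖ ≤ 1 := by rw [norm_pow]; exact pow_le_one₀ (norm_nonneg _) hw
  set Λ := logRho r hπ with hΛ
  obtain ⟨s1, -, -⟩ := logRho_sum hq₀ hq₁ hr hrc hπ hw
  obtain ⟨s2, -, -⟩ := logRho_sum hq₀ hq₁ hr hrc hπ hw2
  have hinv : ∀ m : ℕ, vK q r m * uK q r c m * (heis hπ).β m = -Λ m := fun m => by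
    rw [hΛ, logRho]; ring
  have z0 : ∀ w : ℂ, Λ 0 * w ^ 0 = 0 := fun w => by rw [hΛ, logRho_zero, zero_mul]
  -- the contraction of the outer factors
  have h31 : Summable fun k => coeff k (expSeries fun m : ℕ => -(Λ m * ((q : ℂ) ^ 2) ^ m)) := by
    simp only [coeff_expSeries]
    exact (hasSum_expCoeff (by rw [z0, neg_zero]) s2.neg.norm).1.of_norm
  -- the contraction of the first factor with the product of the other two
  have h1 : HasSum (fun k => coeff k (expSeries fun m : ℕ => Λ m * (q : ℂ) ^ m -
      Λ m * ((q : ℂ) ^ 2) ^ m)) (rhoVal r hπ q / rhoVal r hπ (q ^ 2)) := by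
    simp only [coeff_expSeries]
    have := (hasSum_expCoeff (b := fun m : ℕ => Λ m * (q : ℂ) ^ m - Λ m * ((q : ℂ) ^ 2) ^ m)
      (by rw [z0, z0, sub_zero]) (s1.sub s2).norm).2
    rwa [s1.tsum_sub s2, Complex.exp_sub] at this
  have hC := primary_vertexOp (𝔥 := heis hπ) (fun m => (q : ℂ) ^ m * uK q r c m)
    (fun m => (q : ℂ)⁻¹ ^ m * vK q r m)
  have hBC := primary_vertexOp (𝔥 := heis hπ)
    (fun m => -uK q r c m + (q : ℂ) ^ m * uK q r c m)
    (fun m => (q : ℂ)⁻¹ ^ m * vK q r m + -vK q r m)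
  rw [← vertexOp_merge] at hBC
  -- `:k(q⁻¹z) k(z)⁻¹ k(qz):` is `ψ(z, p)`
  have merged : (vertexOp (heis hπ)
      (fun m => (q : ℂ)⁻¹ ^ m * uK q r c m + (-uK q r c m + (q : ℂ) ^ m * uK q r c m))
      fun m => (q : ℂ)⁻¹ ^ m * vK q r m + -vK q r m + (q : ℂ)⁻¹⁻¹ ^ m * vK q r m) =
      psiField r hπ := by
    refine vertexOp_congr _ (fun m hm => ?_) fun m hm => ?_
    all_goals
      obtain ⟨s⟩ := scalarForms hq₀ hq₁ hr hrc hm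
      obtain ⟨hm', hQ, hR, hS, hδ, hQ2, hR2, hS2, hR2', hS2', hQ3, hQ6⟩ := s.nz
    · rw [inv_pow, s.q_pow, s.uK_eq, s.uH_eq]
      field_simp
      ring
    · rw [inv_inv, inv_pow, s.q_pow, s.vK_eq, s.vH_eq]
      field_simp
      ring
  have h := hasSum_vertexOp_mul_mul (u := fun m => (q : ℂ)⁻¹ ^ m * uK q r c m)
    (v := fun m => (q : ℂ)⁻¹⁻¹ ^ m * vK q r m)
    (primary_vertexOp (𝔥 := heis hπ) (fun m => -uK q r c m) (fun m => -vK q r m)) hC hBC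
    (S := rhoVal r hπ q) (T := rhoVal r hπ q / rhoVal r hπ (q ^ 2)) ?_ ?_ ?_ ?_ ξ N x
  · rw [vertexOp_merge, vertexOp_merge, merged, ← mul_assoc, mul_div_assoc', ← sq] at h
    refine h.congr_fun fun m => ?_
    rw [vertexOp_rescale _ (inv_ne_zero hq), vertexOp_rescale _ hq]
    simp only [map_smul, smul_eq_mul, inv_zpow, zpow_neg, inv_inv, kField, kinvField]
    ring
  · refine (hasSum_rhoVal hq₀ hq₁ hr hrc hπ hw fun m hm => ?_).summable
    rw [if_neg (by omega), if_pos (by omega), Int.toNat_natCast, inv_inv]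
    linear_combination (-(q : ℂ) ^ m) * hinv m
  · rw [expSeries_congr fun m hm => ?_]
    · exact h31
    · rw [if_neg (by omega), if_pos (by omega), Int.toNat_natCast, inv_inv]
      linear_combination ((q : ℂ) ^ m) ^ 2 * hinv m
  · refine hasSum_rhoVal hq₀ hq₁ hr hrc hπ hw fun m hm => ?_
    rw [if_neg (by omega), if_pos (by omega), Int.toNat_natCast]
    linear_combination (-(q : ℂ) ^ m) * hinv m
  · rw [expSeries_congr fun m hm => ?_]
    · exact h1
    · rw [if_neg (by omega), if_pos (by omega), Int.toNat_natCast, inv_inv]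
      linear_combination (((q : ℂ) ^ m) ^ 2 - (q : ℂ) ^ m) * hinv m

end Inverse

/-! ### Currents with complex exponents on weight vectors -/

section Weights
variable {q c : ℝ} {M : Type*} [AddCommGroup M] [Module ℂ M]

/-- The mode of a field at a complex index: zero unless the index is an integer. -/
def TField.at (Y : TField M) (x : ℂ) : Module.End ℂ M :=
  open Classical in if h : ∃ n : ℤ, (n : ℂ) = x then Y h.choose else 0

lemma TField.at_intCast (Y : TField M) (n : ℤ) : Y.at n = Y n := by
  have h : ∃ k : ℤ, (k : ℂ) = n := ⟨n, rfl⟩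
  have h1 : h.choose = n := by exact_mod_cast h.choose_spec
  rw [TField.at, dif_pos h, h1]

lemma TField.at_of_not (Y : TField M) {x : ℂ} (h : ¬ ∃ n : ℤ, (n : ℂ) = x) : Y.at x = 0 := by
  rw [TField.at, dif_neg h]

lemma TField.at_commute (Y : TField M) {D : Module.End ℂ M} (h : ∀ n, Commute D (Y n)) (x : ℂ) :
    Commute D (Y.at x) := by
  by_cases hx : ∃ n : ℤ, (n : ℂ) = x
  · obtain ⟨n, rfl⟩ := hx
    rw [Y.at_intCast]
    exact h n
  · rw [Y.at_of_not hx]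
    exact Commute.zero_right D

lemma TField.at_evZero (Y : TField M) (x : ℂ) (v : M) : EvZero fun k : ℕ => Y.at (x + k) v := by
  by_cases hx : ∃ n : ℤ, (n : ℂ) = x
  · obtain ⟨n, rfl⟩ := hx
    have h : (fun k : ℕ => Y.at ((n : ℂ) + k) v) = fun k : ℕ => Y (n + k) v := by
      funext k
      rw [← Y.at_intCast]
      push_cast
      rfl
    rw [h]
    exact Y.evZero n v
  · refine ⟨0, fun k _ => ?_⟩
    have h : ¬ ∃ n : ℤ, (n : ℂ) = x + k := by
      rintro ⟨n, hn⟩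
      exact hx ⟨n - k, by push_cast; rw [hn]; ring⟩
    simp only [Y.at_of_not h, LinearMap.zero_apply]

/-- Joint eigenvectors of `P` and `h`. -/
def IsWt (π : Uq q c ⊗[ℂ] Heis →ₐ[ℂ] Module.End ℂ M) (l μ : ℂ) (v : M) : Prop :=
  opH π .P v = l • v ∧ opU π (gU .h) v = μ • v

variable {π : Uq q c ⊗[ℂ] Heis →ₐ[ℂ] Module.End ℂ M}

/-- A basis of joint eigenvectors of `P` and `h`. -/
lemma exists_wtBasis (hπ : IsRestricted π) :
    ∃ (ι : Set M) (b : Module.Basis ι ℂ M) (w : ι → ℂ × ℂ), ∀ i, IsWt π (w i).1 (w i).2 (b i) := by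
  let b := Module.Basis.ofSpan hπ.weight.ge
  have h : ∀ i, ∃ w : ℂ × ℂ, IsWt π w.1 w.2 (b i) := fun i => by
    obtain ⟨l, μ, h⟩ := Module.Basis.ofSpan_subset hπ.weight.ge ⟨i, rfl⟩
    exact ⟨(l, μ), h⟩
  choose w hw using h
  exact ⟨_, b, w, hw⟩

/-- In a basis of eigenvectors, an eigenvector has no coordinates of other eigenvalues. -/
lemma repr_eq_zero {ι : Type*} (b : Module.Basis ι ℂ M) {D : Module.End ℂ M} {w : ι → ℂ}
    (hb : ∀ i, D (b i) = w i • b i) {l : ℂ} {v : M} (hv : D v = l • v) {i : ι}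
    (hi : w i ≠ l) : b.repr v i = 0 := by
  have h1 : b.coord i ∘ₗ D = w i • b.coord i := by
    classical
    refine b.ext fun j => ?_
    simp only [LinearMap.comp_apply, hb, map_smul, LinearMap.smul_apply, Module.Basis.coord_apply,
      Module.Basis.repr_self, smul_eq_mul, Finsupp.single_apply]
    split_ifs with h
    · rw [h]
    · simp
  have h2 := congrArg (fun f : M →ₗ[ℂ] ℂ => f v) h1
  simp only [LinearMap.comp_apply, hv, map_smul, LinearMap.smul_apply, Module.Basis.coord_apply,
    smul_eq_mul] at h2
  have h3 : (w i - l) * b.repr v i = 0 := by rw [sub_mul, h2, sub_self]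
  exact (mul_eq_zero.mp h3).resolve_left (sub_ne_zero.mpr hi)

/-- A linear map that vanishes on the joint eigenvectors with `P = l` vanishes on the whole
eigenspace of `P`. -/
lemma eq_zero_of_P_eigenvector (hπ : IsRestricted π) {l : ℂ} (Φ : Module.End ℂ M)
    (h : ∀ μ v, IsWt π l μ v → Φ v = 0) {v : M} (hv : opH π .P v = l • v) : Φ v = 0 := by
  obtain ⟨ι, b, w, hw⟩ := exists_wtBasis hπ
  rw [← b.linearCombination_repr v, Finsupp.linearCombination_apply, map_finsuppSum]
  refine Finset.sum_eq_zero fun i _ => ?_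
  simp only [map_smul]
  by_cases hi : (w i).1 = l
  · rw [h (w i).2 (b i) (hi ▸ hw i), smul_zero]
  · rw [repr_eq_zero b (w := fun i => (w i).1) (fun i => (hw i).1) hv hi, zero_smul]

/-- The current `Y(z) T z^{χ(P, h)}` exists: it is defined on a basis of joint eigenvectors, and
then has the same form on every joint eigenvector. -/
lemma exists_current (hπ : IsRestricted π) (Y : TField M) (T : Module.End ℂ M) (χ : ℂ → ℂ → ℂ) :
    ∃ A : ℂ → Module.End ℂ M, ∀ l μ v, IsWt π l μ v → ∀ s, A s v = Y.at (χ l μ - s) (T v) := by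
  obtain ⟨ι, b, w, hw⟩ := exists_wtBasis hπ
  refine ⟨fun s => b.constr ℂ fun i => Y.at (χ (w i).1 (w i).2 - s) (T (b i)),
    fun l μ v hv s => ?_⟩
  rw [Module.Basis.constr_apply]
  conv_rhs => rw [← b.linearCombination_repr v, Finsupp.linearCombination_apply, map_finsuppSum,
    map_finsuppSum]
  refine Finset.sum_congr rfl fun i _ => ?_
  simp only [map_smul]
  by_cases h1 : (w i).1 = l
  · by_cases h2 : (w i).2 = μ
    · rw [h1, h2]
    · rw [repr_eq_zero b (w := fun i => (w i).2) (fun i => (hw i).2) hv.2 h2, zero_smul, zero_smul]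
  · rw [repr_eq_zero b (w := fun i => (w i).1) (fun i => (hw i).1) hv.1 h1, zero_smul, zero_smul]

/-- `A` is the current `Y(z) T z^{χ(P, h)}`. -/
def HasModes (π : Uq q c ⊗[ℂ] Heis →ₐ[ℂ] Module.End ℂ M) (A : ℂ → Module.End ℂ M) (Y : TField M)
    (T : Module.End ℂ M) (χ : ℂ → ℂ → ℂ) : Prop :=
  ∀ l μ v, IsWt π l μ v → ∀ s, A s v = Y.at (χ l μ - s) (T v)

lemma HasModes.isCurrent {A : ℂ → Module.End ℂ M} {Y : TField M} {T : Module.End ℂ M}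
    {χ : ℂ → ℂ → ℂ} (h : HasModes π A Y T χ) {y : ℤ → M → M} (hy : ∀ n v, y n v = Y n v) :
    IsCurrent π A y T χ := by
  refine fun l μ v h1 h2 => ⟨fun n => ?_, fun s hs => ?_⟩
  · rw [h l μ v ⟨h1, h2⟩, sub_sub_cancel, Y.at_intCast, hy]
  · rw [h l μ v ⟨h1, h2⟩, Y.at_of_not, LinearMap.zero_apply]
    rintro ⟨n, hn⟩
    exact hs n (by rw [hn, sub_sub_cancel])

/-- A property of vectors that is compatible with linear combinations holds everywhere as soon as
it holds for joint eigenvectors. -/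
lemma wt_induction (hπ : IsRestricted π) {p : M → Prop} (h0 : p 0)
    (hadd : ∀ v w, p v → p w → p (v + w)) (hsmul : ∀ (a : ℂ) v, p v → p (a • v))
    (hwt : ∀ l μ v, IsWt π l μ v → p v) (v : M) : p v := by
  have hv : v ∈ Submodule.span ℂ
      {v : M | ∃ l μ : ℂ, opH π .P v = l • v ∧ opU π (gU .h) v = μ • v} := by
    rw [hπ.weight]; trivial
  induction hv using Submodule.span_induction with
  | mem v hv => obtain ⟨l, μ, hv⟩ := hv; exact hwt l μ v hv
  | zero => exact h0
  | add v w _ _ hv hw => exact hadd v w hv hw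
  | smul a v _ hv => exact hsmul a v hv

lemma HasModes.evZero (hπ : IsRestricted π) {A : ℂ → Module.End ℂ M} {Y : TField M}
    {T : Module.End ℂ M} {χ : ℂ → ℂ → ℂ} (h : HasModes π A Y T χ) (s : ℂ) (v : M) :
    EvZero fun k : ℕ => A (s - k) v := by
  refine wt_induction hπ (p := fun v => EvZero fun k : ℕ => A (s - k) v) ⟨0, by simp⟩
    (fun v w hv hw => by simpa only [map_add] using hv.add hw)
    (fun a v hv => by simpa only [map_smul] using hv.map (fun _ x => a • x) (by simp))
    (fun l μ v hv => ?_) v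
  simp only [h l μ v hv]
  have h1 := Y.at_evZero (χ l μ - s) (T v)
  simpa only [sub_sub_eq_add_sub, add_sub_right_comm] using h1

lemma HasModes.isSmooth (hπ : IsRestricted π) {A : ℂ → Module.End ℂ M} {Y : TField M}
    {T : Module.End ℂ M} {χ : ℂ → ℂ → ℂ} (h : HasModes π A Y T χ) : IsSmooth A :=
  fun s v => h.evZero hπ s v

/-- The mode `Y_n` shifts the eigenvalue of `h` by `d` and commutes with the Heisenberg algebra. -/
structure Shifts (π : Uq q c ⊗[ℂ] Heis →ₐ[ℂ] Module.End ℂ M) (Y : TField M) (d : ℂ) : Prop where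
  commute : ∀ g n, Commute (opH π g) (Y n)
  shift : ∀ n, opU π (gU .h) * Y n = Y n * (opU π (gU .h) + d • 1)

lemma Shifts.isWt {Y : TField M} {d : ℂ} (h : Shifts π Y d) {l μ : ℂ} {v : M}
    (hv : IsWt π l μ v) (x : ℂ) : IsWt π l (μ + d) (Y.at x v) := by
  by_cases hx : ∃ n : ℤ, (n : ℂ) = x
  · obtain ⟨n, rfl⟩ := hx
    rw [Y.at_intCast]
    constructor
    · have := congrArg (fun f : Module.End ℂ M => f v) (h.commute .P n).eq
      simp only [Module.End.mul_apply, hv.1, map_smul] at this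
      exact this
    · have := congrArg (fun f : Module.End ℂ M => f v) (h.shift n)
      simp only [Module.End.mul_apply, LinearMap.add_apply, LinearMap.smul_apply,
        Module.End.one_apply, hv.2, ← add_smul, map_smul] at this
      exact this
  · rw [Y.at_of_not hx]
    constructor <;> simp

/-- `T` shifts the eigenvalue of `P` by `d` and preserves that of `h`. -/
def ShiftsP (π : Uq q c ⊗[ℂ] Heis →ₐ[ℂ] Module.End ℂ M) (T : Module.End ℂ M) (d : ℂ) : Prop :=
  ∀ l μ v, IsWt π l μ v → IsWt π (l + d) μ (T v)

/-- Intertwining relations pass to dressed fields. -/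
lemma mul_lD {D D' : Module.End ℂ M} {U : ℕ → Module.End ℂ M} {X : TField M}
    (hU : ∀ j, Commute D (U j)) (hX : ∀ n, D * X n = X n * D') (n : ℤ) :
    D * lD U X n = lD U X n * D' := by
  ext v
  simp only [Module.End.mul_apply, lD_apply]
  rw [map_finsum_of_evZero D ((X.evZero n v).map (fun j => U j) (by simp))]
  refine finsum_congr fun j => ?_
  have h1 := congrArg (fun f : Module.End ℂ M => f (X (n + j) v)) (hU j).eq
  have h2 := congrArg (fun f : Module.End ℂ M => f v) (hX (n + j))
  simp only [Module.End.mul_apply] at h1 h2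
  rw [h1, h2]

lemma mul_rD {D D' : Module.End ℂ M} {X : TField M} {V : FinSeq M}
    (hX : ∀ n, D * X n = X n * D') (hV : ∀ j, Commute D' (V j)) (n : ℤ) :
    D * rD X V n = rD X V n * D' := by
  ext v
  simp only [Module.End.mul_apply, rD_apply]
  rw [map_finsum_of_evZero D ((V.fin v).map (fun j => X (n - j)) (by simp))]
  refine finsum_congr fun j => ?_
  have h1 := congrArg (fun f : Module.End ℂ M => f v) (hV j).eq
  have h2 := congrArg (fun f : Module.End ℂ M => f (V j v)) (hX (n - j))
  simp only [Module.End.mul_apply] at h1 h2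
  rw [h2, h1]

lemma shifts_vertexOp (hπ : IsRestricted π) (u v : ℕ → ℂ) :
    Shifts π (vertexOp (heis hπ) u v) 0 := by
  have key : ∀ D : Module.End ℂ M, (∀ m, Commute D (opU π (ga m))) →
      ∀ n, D * vertexOp (heis hπ) u v n = vertexOp (heis hπ) u v n * D := fun D hD n =>
    mul_lD (fun j => commute_expCoeff (fun m => (hD _).smul_right _) j)
      (mul_rD (fun n => by
        simp only [oneField]
        split_ifs <;> simp) fun j => commute_expCoeff (fun m => (hD _).smul_right _) j) n
  constructor
  · exact fun g n => key _ (fun m => (commute_opU_opH π _ g).symm) n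
  · rw [zero_smul, add_zero]
    refine fun n => key _ (fun m => ?_) n
    have h := repU_rel π (UqRel.h_a m)
    rw [map_mul, map_mul] at h
    exact h

lemma shifts_xField (hπ : IsRestricted π) (ε : ℤˣ) :
    Shifts π (xField hπ ε) (2 * ((ε : ℤ) : ℂ)) := by
  refine ⟨fun g n => (commute_opU_opH π _ g).symm, fun n => ?_⟩
  have h := repU_rel π (UqRel.h_x ε n)
  rw [map_sub, map_mul, map_mul, map_smul, sub_eq_iff_eq_add] at h
  refine h.trans ?_
  rw [mul_add, mul_smul_comm, mul_one, add_comm]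
  rfl

lemma commute_h_a (m : ℤ) : Commute (opU π (gU .h)) (opU π (ga m)) := by
  have h := repU_rel π (UqRel.h_a m)
  rw [map_mul, map_mul] at h
  exact h

lemma shifts_eField (r : ℝ) (hπ : IsRestricted π) : Shifts π (eField r hπ) 2 := by
  have h := shifts_xField hπ 1
  rw [Units.val_one, Int.cast_one, mul_one] at h
  exact ⟨fun g n => mul_lD (fun j => commute_expCoeff
      (fun m => (commute_opU_opH π _ g).symm.smul_right _) j) (fun n => h.commute g n) n,
    fun n => mul_lD (fun j => commute_expCoeff (fun m => (commute_h_a _).smul_right _) j)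
      h.shift n⟩

lemma shifts_fField (r : ℝ) (hπ : IsRestricted π) : Shifts π (fField r hπ) (-2) := by
  have h := shifts_xField hπ (-1)
  rw [Units.val_neg, Units.val_one, Int.cast_neg, Int.cast_one, mul_neg, mul_one] at h
  refine ⟨fun g n => mul_rD (fun n => h.commute g n) (fun j => commute_expCoeff
      (fun m => (commute_opU_opH π _ g).symm.smul_right _) j) n,
    fun n => mul_rD h.shift (fun j => commute_expCoeff (fun m => ?_) j) n⟩
  exact ((commute_h_a _).smul_right _).add_left
    ((Commute.one_left _).smul_left _)

end Weights

/-! ### The relations of the currents -/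

section Zero
variable {q c : ℝ} {M : Type*} [AddCommGroup M] [Module ℂ M]
variable (π : Uq q c ⊗[ℂ] Heis →ₐ[ℂ] Module.End ℂ M)

lemma eQ_mul_eQinv : opH π .eQ * opH π .eQinv = 1 := by
  have h := repH_rel π HeisRel.Q_inv
  rwa [map_mul, map_one] at h

lemma eQinv_mul_eQ : opH π .eQinv * opH π .eQ = 1 := by
  have h := repH_rel π HeisRel.inv_Q
  rwa [map_mul, map_one] at h

lemma eA_mul_eAinv : opH π .eA * opH π .eAinv = 1 := by
  have h := repH_rel π HeisRel.A_inv
  rwa [map_mul, map_one] at h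

lemma eAinv_mul_eA : opH π .eAinv * opH π .eA = 1 := by
  have h := repH_rel π HeisRel.inv_A
  rwa [map_mul, map_one] at h

lemma eQ_mul_eA : opH π .eQ * opH π .eA = -(opH π .eA * opH π .eQ) := by
  have h := repH_rel π HeisRel.Q_A
  rw [map_smul, map_mul, map_mul, Complex.exp_pi_mul_I, neg_one_smul] at h
  exact h

/-- `e^{-Q}` and `e^ᾱ` anticommute. -/
lemma eQinv_mul_eA : opH π .eQinv * opH π .eA = -(opH π .eA * opH π .eQinv) := by
  have h : opH π .eQinv * (opH π .eQ * opH π .eA) * opH π .eQinv =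
      opH π .eQinv * -(opH π .eA * opH π .eQ) * opH π .eQinv := by rw [eQ_mul_eA]
  rw [← mul_assoc, eQinv_mul_eQ, one_mul, mul_neg, neg_mul, mul_assoc, mul_assoc _ _ (opH π .eQinv),
    eQ_mul_eQinv, mul_one] at h
  rw [h, neg_neg]

lemma eQinv_mul_eAinv : opH π .eQinv * opH π .eAinv = -(opH π .eAinv * opH π .eQinv) := by
  have h : opH π .eAinv * (opH π .eQinv * opH π .eA) * opH π .eAinv =
      opH π .eAinv * -(opH π .eA * opH π .eQinv) * opH π .eAinv := by rw [eQinv_mul_eA]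
  rw [mul_neg, neg_mul, ← mul_assoc (opH π .eAinv) (opH π .eA), eAinv_mul_eA, one_mul, mul_assoc,
    mul_assoc _ (opH π .eA), eA_mul_eAinv, mul_one] at h
  rw [h, neg_neg]

lemma shiftsP_of_mul {g : HeisGen} {d : ℂ}
    (h : opH π .P * opH π g = opH π g * opH π .P + d • opH π g) : ShiftsP π (opH π g) d := by
  intro l μ v hv
  constructor
  · have h1 := congrArg (fun f : Module.End ℂ M => f v) h
    simp only [Module.End.mul_apply, LinearMap.add_apply, LinearMap.smul_apply, hv.1, map_smul,
      ← add_smul] at h1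
    exact h1
  · have h1 := congrArg (fun f : Module.End ℂ M => f v) (commute_opU_opH π (gU .h) g).eq
    simp only [Module.End.mul_apply, hv.2, map_smul] at h1
    exact h1

lemma shiftsP_eQ : ShiftsP π (opH π .eQ) 1 := by
  refine shiftsP_of_mul π ?_
  have h := repH_rel π HeisRel.P_Q
  rw [map_sub, map_mul, map_mul, sub_eq_iff_eq_add] at h
  rw [one_smul, add_comm]
  exact h

lemma shiftsP_eQinv : ShiftsP π (opH π .eQinv) (-1) := by
  refine shiftsP_of_mul π ?_
  have h := repH_rel π HeisRel.P_Q
  rw [map_sub, map_mul, map_mul] at h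
  have h1 : opH π .eQinv * (opH π .P * opH π .eQ - opH π .eQ * opH π .P) * opH π .eQinv =
      opH π .eQinv * opH π .eQ * opH π .eQinv := congrArg (fun x => opH π .eQinv * x * opH π .eQinv) h
  rw [mul_sub, sub_mul, ← mul_assoc, ← mul_assoc, eQinv_mul_eQ, one_mul, one_mul, mul_assoc,
    eQ_mul_eQinv, mul_one] at h1
  rw [neg_one_smul, ← sub_eq_add_neg, eq_sub_iff_add_eq', ← eq_sub_iff_add_eq]
  exact h1.symm

lemma shiftsP_eA : ShiftsP π (opH π .eA) 0 := by
  refine shiftsP_of_mul π ?_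
  have h := repH_rel π HeisRel.P_A
  rw [map_mul, map_mul] at h
  rw [zero_smul, add_zero]
  exact h

lemma shiftsP_eAinv : ShiftsP π (opH π .eAinv) 0 := by
  refine shiftsP_of_mul π ?_
  have h := repH_rel π HeisRel.P_A
  rw [map_mul, map_mul] at h
  have h1 : opH π .eAinv * (opH π .P * opH π .eA) * opH π .eAinv =
      opH π .eAinv * (opH π .eA * opH π .P) * opH π .eAinv :=
    congrArg (fun x => opH π .eAinv * x * opH π .eAinv) h
  rw [← mul_assoc (opH π .eAinv) (opH π .eA), eAinv_mul_eA, one_mul, mul_assoc, mul_assoc,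
    eA_mul_eAinv, mul_one] at h1
  rw [zero_smul, add_zero, h1]

variable {π}

lemma ShiftsP.mul {T T' : Module.End ℂ M} {d d' : ℂ} (h : ShiftsP π T d) (h' : ShiftsP π T' d') :
    ShiftsP π (T * T') (d' + d) := fun l μ v hv => by
  rw [← add_assoc]
  exact h _ _ _ (h' _ _ _ hv)

lemma ShiftsP.smul {T : Module.End ℂ M} {d : ℂ} (h : ShiftsP π T d) (a : ℂ) :
    ShiftsP π (a • T) d := fun l μ v hv => by
  obtain ⟨h1, h2⟩ := h l μ v hv
  exact ⟨by rw [LinearMap.smul_apply, map_smul, h1, smul_comm],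
    by rw [LinearMap.smul_apply, map_smul, h2, smul_comm]⟩

end Zero

section ExchangeCurrents
open Finset PowerSeries
variable {q c : ℝ} {M : Type*} [AddCommGroup M] [Module ℂ M]
variable {π : Uq q c ⊗[ℂ] Heis →ₐ[ℂ] Module.End ℂ M}

/-- When an exponent is not an integer, all terms of a product of two fields vanish. -/
lemma pair_at_zero (L : PowerSeries ℂ) (A B : TField M) {x y : ℂ}
    (h : (¬ ∃ n : ℤ, (n : ℂ) = x) ∨ ¬ ∃ n : ℤ, (n : ℂ) = y) (v : M) :
    ∑ᶠ k : ℕ, coeff k L • A.at (x - k) (B.at (y + k) v) = 0 := by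
  refine finsum_eq_zero_of_forall_eq_zero fun k => ?_
  rcases h with h | h
  · rw [A.at_of_not, LinearMap.zero_apply, smul_zero]
    rintro ⟨n, hn⟩
    exact h ⟨n + k, by push_cast; rw [hn]; ring⟩
  · rw [B.at_of_not (x := y + k), LinearMap.zero_apply, map_zero, smul_zero]
    rintro ⟨n, hn⟩
    exact h ⟨n - k, by push_cast; rw [hn]; ring⟩

lemma pair_at (L : PowerSeries ℂ) (A B : TField M) (m n : ℤ) (v : M) :
    ∑ᶠ k : ℕ, coeff k L • A.at (m - k) (B.at (n + k) v) = pair L A B m n v := by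
  refine finsum_congr fun k => ?_
  rw [← A.at_intCast, ← B.at_intCast]
  push_cast
  rfl

variable {A B : ℂ → Module.End ℂ M} {YA YB : TField M} {TA TB : Module.End ℂ M}
  {χA χB : ℂ → ℂ → ℂ} {dA dB eA eB : ℂ}

/-- Composition of two currents on a joint eigenvector. -/
lemma HasModes.comp (hA : HasModes π A YA TA χA) (hB : HasModes π B YB TB χB)
    (sB : Shifts π YB dB) (pB : ShiftsP π TB eB) (cB : ∀ n, Commute TA (YB n)) {l μ : ℂ} {v : M}
    (hv : IsWt π l μ v) (s t : ℂ) :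
    A s (B t v) = YA.at (χA (l + eB) (μ + dB) - s) (YB.at (χB l μ - t) ((TA * TB) v)) := by
  rw [hB l μ v hv, hA _ _ _ (sB.isWt (pB l μ v hv) _)]
  have h := congrArg (fun f : Module.End ℂ M => f (TB v)) (YB.at_commute cB (χB l μ - t)).eq
  simp only [Module.End.mul_apply] at h
  rw [h, Module.End.mul_apply]

/-- An exchange relation of modes gives the exchange relation of the currents; the exponents of
the zero modes account for the shift of the power of `z₁/z₂`, and the zero modes themselves for
the scalar `k`. -/
lemma exchange_series (hπ : IsRestricted π) (hA : HasModes π A YA TA χA)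
    (hB : HasModes π B YB TB χB) (sA : Shifts π YA dA) (sB : Shifts π YB dB)
    (pA : ShiftsP π TA eA) (pB : ShiftsP π TB eB) (cA : ∀ n, Commute TB (YA n))
    (cB : ∀ n, Commute TA (YB n)) {C k : ℂ} (hT : TA * TB = k • (TB * TA))
    {L R : PowerSeries ℂ} {e : ℤ} (hex : Exch YA YB L R C e fun _ _ _ => 0) {γ : ℂ}
    (h₁ : ∀ l μ, χA (l + eB) (μ + dB) = χA l μ + γ + e)
    (h₂ : ∀ l μ, χB (l + eA) (μ + dA) = χB l μ + e + γ) (s t : ℂ) (v : M) :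
    ∑ᶠ j : ℕ, coeff j L • A (s + j) (B (t - j) v) =
      (C * k) • ∑ᶠ j : ℕ, coeff j R • B (t + γ + j) (A (s - γ - j) v) := by
  have evL : ∀ v, EvZero fun j : ℕ => coeff j L • A (s + j) (B (t - j) v) := fun v =>
    (hB.evZero hπ t v).map (fun j x => coeff j L • A (s + j) x) (by simp)
  have evR : ∀ v, EvZero fun j : ℕ => coeff j R • B (t + γ + j) (A (s - γ - j) v) := fun v =>
    (hA.evZero hπ (s - γ) v).map (fun j x => coeff j R • B (t + γ + j) x) (by simp)
  refine wt_induction hπ (p := fun v => ∑ᶠ j : ℕ, coeff j L • A (s + j) (B (t - j) v) =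
      (C * k) • ∑ᶠ j : ℕ, coeff j R • B (t + γ + j) (A (s - γ - j) v)) (by simp)
    (fun v w hv hw => ?_) (fun a v hv => ?_) (fun l μ v hv => ?_) v
  · simp only [map_add, smul_add]
    rw [finsum_add_of_evZero (evL v) (evL w), finsum_add_of_evZero (evR v) (evR w), hv, hw,
      smul_add]
  · simp only [map_smul, smul_comm _ a]
    rw [← smul_finsum, hv, ← smul_finsum, smul_comm a]
  · set x := χA (l + eB) (μ + dB) - s with hx
    set y := χB l μ - t with hy
    have e₁ : ∀ j : ℕ, A (s + j) (B (t - j) v) = YA.at (x - j) (YB.at (y + j) ((TA * TB) v)) :=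
      fun j => by
        rw [hA.comp hB sB pB cB hv, hx, hy, sub_sub, sub_add]
    have e₂ : ∀ j : ℕ, B (t + γ + j) (A (s - γ - j) v) =
        YB.at (y + e - j) (YA.at (x - e + j) ((TB * TA) v)) := fun j => by
      rw [hB.comp hA sA pA cA hv, h₂, hx, hy, h₁]
      congr 2
      · ring
      · congr 2; ring
    -- both sides vanish unless the exponents `x` and `y` of the integral modes are integers
    simp only [e₁, e₂]
    by_cases hxi : ∃ m : ℤ, (m : ℂ) = x
    · by_cases hyi : ∃ n : ℤ, (n : ℂ) = y
      · obtain ⟨m, hm⟩ := hxi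
        obtain ⟨n, hn⟩ := hyi
        have hex' := hex m n ((TA * TB) v)
        rw [sub_eq_zero] at hex'
        rw [← hm, ← hn]
        have c₁ : (n : ℂ) + e = ((n + e : ℤ) : ℂ) := by push_cast; rfl
        have c₂ : (m : ℂ) - e = ((m - e : ℤ) : ℂ) := by push_cast; rfl
        rw [c₁, c₂, pair_at, pair_at, hex', hT, LinearMap.smul_apply]
        have : pair R YB YA (n + e) (m - e) (k • (TB * TA) v) =
            k • pair R YB YA (n + e) (m - e) ((TB * TA) v) := by
          simp only [pair, map_smul, smul_comm _ k]
          rw [← smul_finsum]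
        rw [this, smul_smul]
      · rw [pair_at_zero _ _ _ (Or.inr hyi), pair_at_zero, smul_zero]
        left
        rintro ⟨n, hn⟩
        exact hyi ⟨n - e, by push_cast; rw [hn]; ring⟩
    · rw [pair_at_zero _ _ _ (Or.inl hxi), pair_at_zero, smul_zero]
      right
      rintro ⟨n, hn⟩
      exact hxi ⟨n + e, by push_cast; rw [hn]; ring⟩

end ExchangeCurrents

section SerreCurrents
open Finset PowerSeries
variable {q c : ℝ} {M : Type*} [AddCommGroup M] [Module ℂ M]
variable {π : Uq q c ⊗[ℂ] Heis →ₐ[ℂ] Module.End ℂ M}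
  {X : ℂ → Module.End ℂ M} {Y : TField M} {T : Module.End ℂ M} {χ : ℂ → ℂ → ℂ} {d e δ : ℂ}

/-- The summand of a triple product of currents on a joint eigenvector. -/
lemma triple_current (hX : HasModes π X Y T χ) (sX : Shifts π Y d) (pX : ShiftsP π T e)
    (cX : ∀ n, Commute T (Y n)) (hχ : ∀ l μ, χ (l + e) (μ + d) = χ l μ + δ) {l μ : ℂ} {v : M}
    (hv : IsWt π l μ v) (a b : ℤ) (s₁ s₂ s₃ : ℂ) (n : ℕ × ℕ × ℕ) :
    X (s₁ - (-2 * δ + a) + n.1 + n.2.1) (X (s₂ - (-δ + b) - n.1 + n.2.2)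
      (X (s₃ - n.2.1 - n.2.2) v)) =
    Y.at (χ l μ - s₁ + a - n.1 - n.2.1) (Y.at (χ l μ - s₂ + b + n.1 - n.2.2)
      (Y.at (χ l μ - s₃ + n.2.1 + n.2.2) ((T * (T * T)) v))) := by
  have h3 := hX l μ v hv (s₃ - n.2.1 - n.2.2)
  have w3 := sX.isWt (pX l μ v hv) (χ l μ - (s₃ - n.2.1 - n.2.2))
  rw [h3, hX.comp hX sX pX cX w3, hχ, hχ]
  have h := congrArg (fun f : Module.End ℂ M => f (T v))
    (((Y.at_commute cX (χ l μ - (s₃ - n.2.1 - n.2.2))).mul_left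
      (Y.at_commute cX (χ l μ - (s₃ - n.2.1 - n.2.2)))).eq)
  simp only [Module.End.mul_apply] at h ⊢
  have e₁ : χ l μ + δ + δ - (s₁ - (-2 * δ + a) + n.1 + n.2.1) = χ l μ - s₁ + a - n.1 - n.2.1 := by
    ring
  have e₂ : χ l μ + δ - (s₂ - (-δ + b) - n.1 + n.2.2) = χ l μ - s₂ + b + n.1 - n.2.2 := by ring
  have e₃ : χ l μ - (s₃ - n.2.1 - n.2.2) = χ l μ - s₃ + n.2.1 + n.2.2 := by ring
  rw [e₃] at h ⊢
  rw [e₁, e₂, h]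

/-- Coefficientwise Serre relations of modes give the Serre relation of the current. -/
lemma serre_current (hπ : IsRestricted π) (hX : HasModes π X Y T χ) (sX : Shifts π Y d)
    (pX : ShiftsP π T e) (cX : ∀ n, Commute T (Y n))
    (hχ : ∀ l μ, χ (l + e) (μ + d) = χ l μ + δ) {b : ℂ} {A B : PowerSeries ℂ}
    (hS : ∀ (m : Fin 3 → ℤ) (v : M), ∑ σ : Equiv.Perm (Fin 3),
      (triple A B B Y Y Y (m (σ 0) + 1) (m (σ 1)) (m (σ 2)) v +
        b • triple B B A Y Y Y (m (σ 0)) (m (σ 1) + 1) (m (σ 2)) v) = 0) :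
    Serre X (-2 * δ) (-δ) b A B := by
  -- on a joint eigenvector the summands are those of a triple product of modes, or all vanish
  have key : ∀ (L₁ L₂ L₃ : PowerSeries ℂ) (a a' : ℤ) (s₁ s₂ s₃ l μ : ℂ) (v : M), IsWt π l μ v →
      ((∃ m₁ m₂ m₃ : ℤ, (m₁ : ℂ) = χ l μ - s₁ ∧ (m₂ : ℂ) = χ l μ - s₂ ∧ (m₃ : ℂ) = χ l μ - s₃) ∧
        ∀ m₁ m₂ m₃ : ℤ, (m₁ : ℂ) = χ l μ - s₁ → (m₂ : ℂ) = χ l μ - s₂ →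
          (m₃ : ℂ) = χ l μ - s₃ → ∀ n : ℕ × ℕ × ℕ,
          (coeff n.1 L₁ * coeff n.2.1 L₂ * coeff n.2.2 L₃) •
            X (s₁ - (-2 * δ + a) + n.1 + n.2.1) (X (s₂ - (-δ + a') - n.1 + n.2.2)
              (X (s₃ - n.2.1 - n.2.2) v)) =
          (coeff n.1 L₁ * coeff n.2.1 L₂ * coeff n.2.2 L₃) •
            Y (m₁ + a - n.1 - n.2.1) (Y (m₂ + a' + n.1 - n.2.2)
              (Y (m₃ + n.2.1 + n.2.2) ((T * (T * T)) v)))) ∨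
      ((¬ ∃ m₁ m₂ m₃ : ℤ, (m₁ : ℂ) = χ l μ - s₁ ∧ (m₂ : ℂ) = χ l μ - s₂ ∧
          (m₃ : ℂ) = χ l μ - s₃) ∧ ∀ n : ℕ × ℕ × ℕ,
          (coeff n.1 L₁ * coeff n.2.1 L₂ * coeff n.2.2 L₃) •
            X (s₁ - (-2 * δ + a) + n.1 + n.2.1) (X (s₂ - (-δ + a') - n.1 + n.2.2)
              (X (s₃ - n.2.1 - n.2.2) v)) = 0) := by
    intro L₁ L₂ L₃ a a' s₁ s₂ s₃ l μ v hv
    by_cases hm : ∃ m₁ m₂ m₃ : ℤ, (m₁ : ℂ) = χ l μ - s₁ ∧ (m₂ : ℂ) = χ l μ - s₂ ∧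
      (m₃ : ℂ) = χ l μ - s₃
    · refine Or.inl ⟨hm, fun m₁ m₂ m₃ h1 h2 h3 n => ?_⟩
      rw [triple_current hX sX pX cX hχ hv, ← h1, ← h2, ← h3, ← Y.at_intCast, ← Y.at_intCast,
        ← Y.at_intCast]
      push_cast
      rfl
    · refine Or.inr ⟨hm, fun n => ?_⟩
      rw [triple_current hX sX pX cX hχ hv]
      by_cases h1 : ∃ m : ℤ, (m : ℂ) = χ l μ - s₁
      · by_cases h2 : ∃ m : ℤ, (m : ℂ) = χ l μ - s₂
        · rw [Y.at_of_not (x := χ l μ - s₃ + n.2.1 + n.2.2), LinearMap.zero_apply, map_zero,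
            map_zero, smul_zero]
          rintro ⟨k, hk⟩
          obtain ⟨m₁, h1⟩ := h1
          obtain ⟨m₂, h2⟩ := h2
          exact hm ⟨m₁, m₂, k - n.2.1 - n.2.2, h1, h2, by push_cast; rw [hk]; ring⟩
        · rw [Y.at_of_not (x := χ l μ - s₂ + a' + n.1 - n.2.2), LinearMap.zero_apply, map_zero,
            smul_zero]
          rintro ⟨k, hk⟩
          exact h2 ⟨k - a' - n.1 + n.2.2, by push_cast; rw [hk]; ring⟩
      · rw [Y.at_of_not (x := χ l μ - s₁ + a - n.1 - n.2.1), LinearMap.zero_apply, smul_zero]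
        rintro ⟨k, hk⟩
        exact h1 ⟨k - a + n.1 + n.2.1, by push_cast; rw [hk]; ring⟩
  have fin : ∀ (L₁ L₂ L₃ : PowerSeries ℂ) (a a' : ℤ) (s₁ s₂ s₃ : ℂ) (v : M),
      (fun n : ℕ × ℕ × ℕ => (coeff n.1 L₁ * coeff n.2.1 L₂ * coeff n.2.2 L₃) •
            X (s₁ - (-2 * δ + a) + n.1 + n.2.1) (X (s₂ - (-δ + a') - n.1 + n.2.2)
              (X (s₃ - n.2.1 - n.2.2) v))).HasFiniteSupport := by
    intro L₁ L₂ L₃ a a' s₁ s₂ s₃ v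
    refine wt_induction hπ (p := fun v => (fun n : ℕ × ℕ × ℕ =>
      (coeff n.1 L₁ * coeff n.2.1 L₂ * coeff n.2.2 L₃) •
            X (s₁ - (-2 * δ + a) + n.1 + n.2.1) (X (s₂ - (-δ + a') - n.1 + n.2.2)
              (X (s₃ - n.2.1 - n.2.2) v))).HasFiniteSupport) ?_ ?_ ?_ ?_ v
    · simp only [map_zero, smul_zero]
      simp [Function.HasFiniteSupport]
    · intro v w hv hw
      simp only [map_add, smul_add]
      exact hv.add hw
    · intro z v hv
      simp only [map_smul, smul_comm _ z]
      refine hv.subset fun n hn => ?_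
      simp only [Function.mem_support] at hn ⊢
      exact fun h0 => hn (by rw [h0, smul_zero])
    · intro l μ v hv
      rcases key L₁ L₂ L₃ a a' s₁ s₂ s₃ l μ v hv with ⟨⟨m₁, m₂, m₃, h1, h2, h3⟩, h⟩ | ⟨-, h⟩
      · simp only [h m₁ m₂ m₃ h1 h2 h3]
        exact (triple_box L₁ L₂ L₃ Y Y Y (m₁ + a) (m₂ + a') m₃ ((T * (T * T)) v)).finite
      · simp only [h]
        simp [Function.HasFiniteSupport]
  intro s v
  simp only [tripleCoeff]
  have fin₁ := fun (σ : Equiv.Perm (Fin 3)) v => fin A B B 1 0 (s (σ 0)) (s (σ 1)) (s (σ 2)) v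
  have fin₂ := fun (σ : Equiv.Perm (Fin 3)) v => fin B B A 0 1 (s (σ 0)) (s (σ 1)) (s (σ 2)) v
  have key₁ := fun (σ : Equiv.Perm (Fin 3)) => key A B B 1 0 (s (σ 0)) (s (σ 1)) (s (σ 2))
  have key₂ := fun (σ : Equiv.Perm (Fin 3)) => key B B A 0 1 (s (σ 0)) (s (σ 1)) (s (σ 2))
  simp only [Int.cast_one, Int.cast_zero, add_zero] at fin₁ fin₂ key₁ key₂
  let S : Equiv.Perm (Fin 3) → M → M := fun σ v =>
    (∑ᶠ n : ℕ × ℕ × ℕ, (coeff n.1 A * coeff n.2.1 B * coeff n.2.2 B) •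
      X (s (σ 0) - (-2 * δ + 1) + n.1 + n.2.1) (X (s (σ 1) - -δ - n.1 + n.2.2)
        (X (s (σ 2) - n.2.1 - n.2.2) v))) +
      b • ∑ᶠ n : ℕ × ℕ × ℕ, (coeff n.1 B * coeff n.2.1 B * coeff n.2.2 A) •
        X (s (σ 0) - -2 * δ + n.1 + n.2.1) (X (s (σ 1) - (-δ + 1) - n.1 + n.2.2)
          (X (s (σ 2) - n.2.1 - n.2.2) v))
  have hadd : ∀ σ v w, S σ (v + w) = S σ v + S σ w := fun σ v w => by
    simp only [S, map_add, smul_add]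
    rw [finsum_add_distrib (fin₁ σ v) (fin₁ σ w), finsum_add_distrib (fin₂ σ v) (fin₂ σ w),
      smul_add]
    abel
  have hsmul : ∀ σ (z : ℂ) v, S σ (z • v) = z • S σ v := fun σ z v => by
    simp only [S, map_smul, smul_comm _ z]
    rw [← smul_finsum, ← smul_finsum, smul_add, smul_comm b z]
  change ∑ σ, S σ v = 0
  refine wt_induction hπ (p := fun v => ∑ σ, S σ v = 0) ?_ ?_ ?_ ?_ v
  · simp [S]
  · intro v w hv hw
    simp only [hadd, sum_add_distrib]
    rw [hv, hw, add_zero]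
  · intro z v hv
    simp only [hsmul]
    rw [← smul_sum, hv, smul_zero]
  · intro l μ v hv
    simp only [S]
    by_cases hm : ∀ i, ∃ m : ℤ, (m : ℂ) = χ l μ - s i
    · choose m hm using hm
      rw [← hS m ((T * (T * T)) v)]
      refine sum_congr rfl fun σ _ => ?_
      congr 1
      · rcases key₁ σ l μ v hv with ⟨-, h⟩ | ⟨h, -⟩
        · exact finsum_congr fun n => h _ _ _ (hm _) (hm _) (hm _) n
        · exact absurd ⟨_, _, _, hm _, hm _, hm _⟩ h
      · congr 1
        rcases key₂ σ l μ v hv with ⟨-, h⟩ | ⟨h, -⟩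
        · exact finsum_congr fun n => h _ _ _ (hm _) (hm _) (hm _) n
        · exact absurd ⟨_, _, _, hm _, hm _, hm _⟩ h
    · refine sum_eq_zero fun σ _ => ?_
      have h3 : ¬ ∃ m₁ m₂ m₃ : ℤ, (m₁ : ℂ) = χ l μ - s (σ 0) ∧ (m₂ : ℂ) = χ l μ - s (σ 1) ∧
          (m₃ : ℂ) = χ l μ - s (σ 2) := by
        rintro ⟨m₁, m₂, m₃, h1, h2, h3⟩
        refine hm fun i => ?_
        obtain ⟨j, rfl⟩ := σ.surjective i
        fin_cases j
        exacts [⟨_, h1⟩, ⟨_, h2⟩, ⟨_, h3⟩]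
      rcases key₁ σ l μ v hv with ⟨h, -⟩ | ⟨-, h₁⟩
      · exact absurd h h3
      rcases key₂ σ l μ v hv with ⟨h, -⟩ | ⟨-, h₂⟩
      · exact absurd h h3
      rw [finsum_eq_zero_of_forall_eq_zero h₁, finsum_eq_zero_of_forall_eq_zero h₂, smul_zero,
        add_zero]

end SerreCurrents

/-! ### The structure functions as quotients of theta functions -/

section Theta

lemma cpow_two_mul_add {q : ℝ} (hq₀ : 0 < q) (u a : ℂ) :
    (q : ℂ) ^ (2 * (u + a)) = (q : ℂ) ^ (2 * a) * (q : ℂ) ^ (2 * u) := by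
  rw [← Complex.cpow_add _ _ (by exact_mod_cast hq₀.ne')]
  congr 1
  ring

/-- The theta quotient `-[u+a]/[u+b]` with `a + b = r`: its two halves are the expansions of one
and the same quotient of infinite products, at `z` and at `1/z`. -/
lemma br_exchange {q r : ℝ} (hq₀ : 0 < q) (hr : (r : ℂ) ≠ 0) {a b : ℂ} (hab : a + b = r)
    {L : Coeff} (hL : L = pochCoeff (nome q r) [(q : ℂ) ^ (2 * a)] [(q : ℂ) ^ (2 * b)]) {γ : ℂ}
    (hγ : γ = (a - b) / r) (u : ℂ) :
    -br q r (u + a) * L.num ((q : ℂ) ^ (-(2 * u))) * L.den ((q : ℂ) ^ (2 * u)) =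
      -1 * (q : ℂ) ^ (2 * u * γ) * L.num ((q : ℂ) ^ (2 * u)) *
        L.den ((q : ℂ) ^ (-(2 * u))) * br q r (u + b) := by
  have hq : (q : ℂ) ≠ 0 := by exact_mod_cast hq₀.ne'
  subst hL hγ
  simp only [pochCoeff, br, Theta, List.map_cons, List.map_nil, List.prod_cons, List.prod_nil,
    mul_one, cpow_two_mul_add hq₀, Complex.cpow_neg]
  have e : (q : ℂ) ^ ((u + a) ^ 2 / r - (u + a)) =
      (q : ℂ) ^ (2 * u * ((a - b) / r)) * (q : ℂ) ^ ((u + b) ^ 2 / r - (u + b)) := by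
    rw [← Complex.cpow_add _ _ hq]
    congr 1
    rw [← hab] at hr ⊢
    field_simp
    ring
  have hp : nome q r = (q : ℂ) ^ (2 * a) * (q : ℂ) ^ (2 * b) := by
    rw [nome, ← Complex.cpow_add _ _ hq, ← hab]
    congr 1
    ring
  have hz : (q : ℂ) ^ (2 * u) ≠ 0 := by simp [Complex.cpow_eq_zero_iff, hq]
  have ha : (q : ℂ) ^ (2 * a) ≠ 0 := by simp [Complex.cpow_eq_zero_iff, hq]
  have hb : (q : ℂ) ^ (2 * b) ≠ 0 := by simp [Complex.cpow_eq_zero_iff, hq]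
  have h1 : nome q r / ((q : ℂ) ^ (2 * a) * (q : ℂ) ^ (2 * u)) =
      (q : ℂ) ^ (2 * b) * ((q : ℂ) ^ (2 * u))⁻¹ := by rw [hp]; field_simp
  have h2 : nome q r / ((q : ℂ) ^ (2 * b) * (q : ℂ) ^ (2 * u)) =
      (q : ℂ) ^ (2 * a) * ((q : ℂ) ^ (2 * u))⁻¹ := by rw [hp]; field_simp
  rw [e, h1, h2]
  ring

/-- The theta quotient `-[u+a][u+b]/([u-a][u-b])`; the factors `(1 - q^{2a}/z)(1 - q^{2b}/z)` and
`(1 - q^{-2a}z)(1 - q^{-2b}z)`, which differ by `q^{2a+2b} z^{-2}`, relate the theta functions to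
the infinite products. -/
lemma br_exchange₂ {q r : ℝ} (hq₀ : 0 < q) (hp : ‖nome q r‖ < 1) (hr : (r : ℂ) ≠ 0) {a b : ℂ}
    {L : Coeff} (hL : L = pochCoeff (nome q r) [(q : ℂ) ^ (2 * a), (q : ℂ) ^ (2 * b)]
      [nome q r / (q : ℂ) ^ (2 * a), nome q r / (q : ℂ) ^ (2 * b)]) {γ : ℂ}
    (hγ : γ = 2 * (a + b) / r - 2) (u : ℂ) :
    -(br q r (u + a) * br q r (u + b)) * L.num ((q : ℂ) ^ (-(2 * u))) *
        L.den ((q : ℂ) ^ (2 * u)) =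
      -1 * (q : ℂ) ^ (2 * u * γ) * L.num ((q : ℂ) ^ (2 * u)) *
        L.den ((q : ℂ) ^ (-(2 * u))) * (br q r (u - a) * br q r (u - b)) := by
  have hq : (q : ℂ) ≠ 0 := by exact_mod_cast hq₀.ne'
  subst hL hγ
  have em : ∀ x : ℂ, (q : ℂ) ^ (2 * (u - x)) = ((q : ℂ) ^ (2 * x))⁻¹ * (q : ℂ) ^ (2 * u) :=
    fun x => by
      rw [← Complex.cpow_neg, ← Complex.cpow_add _ _ hq]
      congr 1
      ring
  simp only [pochCoeff, br, Theta, List.map_cons, List.map_nil, List.prod_cons, List.prod_nil,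
    mul_one, cpow_two_mul_add hq₀, Complex.cpow_neg, em]
  have e : (q : ℂ) ^ ((u + a) ^ 2 / r - (u + a)) * (q : ℂ) ^ ((u + b) ^ 2 / r - (u + b)) *
        ((q : ℂ) ^ (2 * a) * (q : ℂ) ^ (2 * b)) =
      (q : ℂ) ^ (2 * u * (2 * (a + b) / r - 2)) * ((q : ℂ) ^ (2 * u)) ^ 2 *
        ((q : ℂ) ^ ((u - a) ^ 2 / r - (u - a)) * (q : ℂ) ^ ((u - b) ^ 2 / r - (u - b))) := by
    rw [sq ((q : ℂ) ^ (2 * u))]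
    simp only [← Complex.cpow_add _ _ hq]
    congr 1
    field_simp
    ring
  have hz : (q : ℂ) ^ (2 * u) ≠ 0 := by simp [Complex.cpow_eq_zero_iff, hq]
  have ha : (q : ℂ) ^ (2 * a) ≠ 0 := by simp [Complex.cpow_eq_zero_iff, hq]
  have hb : (q : ℂ) ^ (2 * b) ≠ 0 := by simp [Complex.cpow_eq_zero_iff, hq]
  set z := (q : ℂ) ^ (2 * u)
  set α := (q : ℂ) ^ (2 * a)
  set β := (q : ℂ) ^ (2 * b)
  set p := nome q r
  have d₁ : ∀ x : ℂ, p / (x * z) = p / x * z⁻¹ := fun x => by rw [div_mul_eq_div_div, div_eq_mul_inv]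
  have d₂ : ∀ x : ℂ, p / (x⁻¹ * z) = p * (x * z⁻¹) := fun x => by
    rw [div_eq_mul_inv, mul_inv, inv_inv]
  have d₃ : ∀ x : ℂ, p / x * z = p * (x⁻¹ * z) := fun x => by rw [div_eq_mul_inv, mul_assoc]
  rw [d₁, d₁, d₂, d₂, d₃, d₃, poch_eq_mul (α * z⁻¹) hp, poch_eq_mul (β * z⁻¹) hp,
    poch_eq_mul (α⁻¹ * z) hp, poch_eq_mul (β⁻¹ * z) hp]
  set A := poch (α * z) p
  set A' := poch (p / α * z⁻¹) p
  set B := poch (β * z) p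
  set B' := poch (p / β * z⁻¹) p
  set C₁ := poch (p * (α * z⁻¹)) p
  set C₂ := poch (p * (β * z⁻¹)) p
  set D₁ := poch (p * (α⁻¹ * z)) p
  set D₂ := poch (p * (β⁻¹ * z)) p
  set e₁ := (q : ℂ) ^ ((u + a) ^ 2 / r - (u + a))
  set e₂ := (q : ℂ) ^ ((u + b) ^ 2 / r - (u + b))
  set e₃ := (q : ℂ) ^ ((u - a) ^ 2 / r - (u - a))
  set e₄ := (q : ℂ) ^ ((u - b) ^ 2 / r - (u - b))
  set e₅ := (q : ℂ) ^ (2 * u * (2 * (a + b) / r - 2))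
  have f : e₁ * e₂ * ((1 - α * z⁻¹) * (1 - β * z⁻¹)) =
      e₅ * (e₃ * e₄) * ((1 - α⁻¹ * z) * (1 - β⁻¹ * z)) := by
    have f1 : (1 - α * z⁻¹) * (1 - β * z⁻¹) =
        α * β * (z⁻¹) ^ 2 * ((1 - α⁻¹ * z) * (1 - β⁻¹ * z)) := by
      field_simp
      ring
    rw [f1, ← mul_assoc, ← mul_assoc (e₁ * e₂), e]
    field_simp
  linear_combination (-(A * A' * B * B' * C₁ * C₂ * D₁ * D₂ * poch p p ^ 2)) * f

/-- The scalar of the exchange relation of two `K`-currents. -/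
lemma rho_exchange {q r s : ℝ} (hq₀ : 0 < q) (hq₁ : q < 1) (hr : 0 < r) (hs : 0 < s) {γ : ℂ}
    (hγ : γ = 1 / s - 1 / r) (u : ℂ) :
    rhoNum q s u * rhoDen q r u * (rhoCoeff q r s).num ((q : ℂ) ^ (-(2 * u))) *
        (rhoCoeff q r s).den ((q : ℂ) ^ (2 * u)) =
      1 * (q : ℂ) ^ (2 * u * γ) * (rhoCoeff q r s).num ((q : ℂ) ^ (2 * u)) *
        (rhoCoeff q r s).den ((q : ℂ) ^ (-(2 * u))) * (rhoDen q s u * rhoNum q r u) := by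
  have hq : (q : ℂ) ≠ 0 := by exact_mod_cast hq₀.ne'
  subst hγ
  have e : (q : ℂ) ^ (2 * u / s) = (q : ℂ) ^ (2 * u * (1 / s - 1 / r)) * (q : ℂ) ^ (2 * u / r) := by
    rw [← Complex.cpow_add _ _ hq]
    congr 1
    ring
  have h6 := norm_q_pow_lt hq₀ hq₁ (n := 6) (by norm_num)
  have b : ∀ t : ℝ, 0 < t → ∀ a w : ℂ, brace q t (a / w) =
      poch (a / w) ((q : ℂ) ^ 6) * brace q t (nome q t * a * w⁻¹) := fun t ht a w => by
    rw [brace, poch₂_eq_mul _ (norm_nome_lt hq₀ hq₁ ht) h6, brace, mul_assoc, div_eq_mul_inv]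
  simp only [rhoNum, rhoDen, rhoCoeff, braceProd, rhoList₁, rhoList₂, List.map_cons, List.map_nil,
    List.prod_cons, List.prod_nil, mul_one, Complex.cpow_neg, b r hr, b s hs, e]
  ring

end Theta

/-! ### Products of `K(z)` and `K(z)⁻¹` -/

section Sums
variable {M : Type*} [AddCommGroup M] [Module ℂ M]

/-- The sum over the modes of a product of two currents, as a sum over integral modes. -/
lemma hasSum_at (Y Z : TField M) (a s : ℂ) (ξ : Module.Dual ℂ M) (x y : M) {c : ℂ}
    (h : ∀ N : ℤ, HasSum (fun m : ℤ => ξ (Y m (Z (N - m) x))) (c * if N = 0 then ξ y else 0)) :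
    HasSum (fun t : ℂ => ξ (Y.at (a - t) (Z.at (t - s - a) x))) (c * if s = 0 then ξ y else 0) := by
  by_cases hs : ∃ N : ℤ, (N : ℂ) = -s
  · obtain ⟨N, hN⟩ := hs
    have hi : Function.Injective fun m : ℤ => a - (m : ℂ) := fun m n hmn => by
      simpa using hmn
    have h0 : (N = 0) = (s = 0) := by
      rw [← Int.cast_eq_zero (α := ℂ), hN, neg_eq_zero]
    have h' := h N
    simp only [h0] at h'
    refine (hi.hasSum_iff fun t ht => ?_).mp (h'.congr_fun fun m => ?_)
    · rw [Y.at_of_not, LinearMap.zero_apply, map_zero]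
      rintro ⟨m, hm⟩
      exact ht ⟨m, by simp only [hm]; ring⟩
    · have e₁ : a - (a - (m : ℂ)) = (m : ℤ) := by ring
      have e₂ : a - (m : ℂ) - s - a = ((N - m : ℤ) : ℂ) := by push_cast; rw [hN]; ring
      simp only [Function.comp_apply]
      rw [e₁, e₂, Y.at_intCast, Z.at_intCast]
  · have hs0 : s ≠ 0 := fun h0 => hs ⟨0, by simp [h0]⟩
    rw [if_neg hs0, mul_zero]
    refine hasSum_zero.congr_fun fun t => ?_
    by_cases ht : ∃ m : ℤ, (m : ℂ) = a - t
    · obtain ⟨m, hm⟩ := ht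
      rw [Z.at_of_not, LinearMap.zero_apply, map_zero, map_zero]
      rintro ⟨n, hn⟩
      exact hs ⟨n + m, by push_cast; rw [hm, hn]; ring⟩
    · rw [Y.at_of_not ht, LinearMap.zero_apply, map_zero]

/-- The sum over the modes of the product `K(q⁻¹z) K(z)⁻¹ K(qz)`, as a sum over integral modes. -/
lemma hasSum_at₃ {q : ℂ} (hq : q ≠ 0) (Y Z W : TField M) (a s : ℂ) (ξ : Module.Dual ℂ M) (x : M)
    {c : ℂ} (h : ∀ N : ℤ, HasSum (fun m : ℤ × ℤ => q ^ m.1 * q ^ (-(N - m.1 - m.2)) *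
        ξ (Y m.1 (Z m.2 (Y (N - m.1 - m.2) x)))) (c * ξ (W N x))) :
    HasSum (fun t : ℂ × ℂ => q ^ (-t.1) * q ^ (s - t.1 - t.2) *
      ξ (Y.at (a - t.1) (Z.at (-a - t.2) (Y.at (a - (s - t.1 - t.2)) x))))
      (c * ξ (W.at (a - s) x)) := by
  by_cases hs : ∃ N : ℤ, (N : ℂ) = a - s
  · obtain ⟨N, hN⟩ := hs
    have hi : Function.Injective fun m : ℤ × ℤ => (a - (m.1 : ℂ), -a - (m.2 : ℂ)) :=
      fun m n hmn => by
        simp only [Prod.mk.injEq, sub_right_inj, Int.cast_inj] at hmn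
        exact Prod.ext hmn.1 hmn.2
    rw [← hN, W.at_intCast]
    refine (hi.hasSum_iff fun t ht => ?_).mp ((h N).congr_fun fun m => ?_)
    · by_cases h1 : ∃ m : ℤ, (m : ℂ) = a - t.1
      · rw [Z.at_of_not, LinearMap.zero_apply, map_zero, map_zero, mul_zero]
        rintro ⟨n, hn⟩
        obtain ⟨m, hm⟩ := h1
        exact ht ⟨(m, n), Prod.ext (by simp only [hm]; ring) (by simp only [hn]; ring)⟩
      · rw [Y.at_of_not h1, LinearMap.zero_apply, map_zero, mul_zero]
    · have e₁ : a - (a - (m.1 : ℂ)) = (m.1 : ℤ) := by ring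
      have e₂ : -a - (-a - (m.2 : ℂ)) = (m.2 : ℤ) := by ring
      have e₃ : a - (s - (a - (m.1 : ℂ)) - (-a - (m.2 : ℂ))) = ((N - m.1 - m.2 : ℤ) : ℂ) := by
        push_cast; rw [hN]; ring
      simp only [Function.comp_apply]
      rw [e₁, e₂, e₃, Y.at_intCast, Y.at_intCast, Z.at_intCast, ← Complex.cpow_intCast,
        ← Complex.cpow_intCast, ← Complex.cpow_add _ _ hq, ← Complex.cpow_add _ _ hq]
      congr 2
      push_cast
      rw [hN]
      ring
  · rw [W.at_of_not hs, LinearMap.zero_apply, map_zero, mul_zero]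
    refine hasSum_zero.congr_fun fun t => ?_
    by_cases h1 : ∃ m : ℤ, (m : ℂ) = a - t.1
    · by_cases h2 : ∃ m : ℤ, (m : ℂ) = -a - t.2
      · rw [Y.at_of_not (x := a - (s - t.1 - t.2)), LinearMap.zero_apply, map_zero, map_zero,
          map_zero, mul_zero]
        rintro ⟨k, hk⟩
        obtain ⟨m, hm⟩ := h1
        obtain ⟨n, hn⟩ := h2
        exact hs ⟨k + m + n, by push_cast; rw [hk, hm, hn]; ring⟩
      · rw [Z.at_of_not h2, LinearMap.zero_apply, map_zero, map_zero, mul_zero]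
    · rw [Y.at_of_not h1, LinearMap.zero_apply, map_zero, mul_zero]

end Sums

section KCurrents
variable {q r c : ℝ} {M : Type*} [AddCommGroup M] [Module ℂ M]
variable {π : Uq q c ⊗[ℂ] Heis →ₐ[ℂ] Module.End ℂ M}
  {K Ki H : ℂ → Module.End ℂ M} {χ : ℂ → ℂ → ℂ}

lemma commute_zeroMode {Y : TField M} {d : ℂ} (h : Shifts π Y d) (g : HeisGen) (a : ℂ) (n : ℤ) :
    Commute (a • opH π g) (Y n) := (h.commute g n).smul_left a

/-- `K(z) K(z)⁻¹ = 1`, where `K(z)⁻¹` is normally ordered and divided by the contraction at `1`.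
Its zero-mode exponent is `-χ(l + 1, μ)` since `e^Q` raises the eigenvalue of `P` by one. -/
lemma K_Kinv_hasSum (hq₀ : 0 < q) (hq₁ : q < 1) (hr : 0 < r) (hrc : 0 < r - c)
    (hπ : IsRestricted π) (hK : HasModes π K (kField r hπ) (opH π .eQinv) χ)
    (hKi : HasModes π Ki (kinvField r hπ) ((rhoVal r hπ 1)⁻¹ • opH π .eQ)
      fun l μ => -χ (l + 1) μ) (s : ℂ) (v : M) (ξ : Module.Dual ℂ M) :
    HasSum (fun t : ℂ => ξ (K t (Ki (s - t) v))) (if s = 0 then ξ v else 0) := by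
  have sKi : Shifts π (kinvField r hπ) 0 := shifts_vertexOp hπ _ _
  refine wt_induction hπ (p := fun v => HasSum (fun t : ℂ => ξ (K t (Ki (s - t) v)))
    (if s = 0 then ξ v else 0)) (by simp) (fun v w hv hw => ?_)
    (fun a v hv => ?_) (fun l μ v hv => ?_) v
  · simp only [map_add]
    convert hv.add hw using 1
    split_ifs <;> simp
  · simp only [map_smul, smul_eq_mul]
    have h := hv.mul_left a
    rwa [mul_ite, mul_zero] at h
  · have h := hasSum_at (kField r hπ) (kinvField r hπ) (χ (l + 1) μ) s ξ v v
      fun N => hasSum_k_kinv hq₀ hq₁ hr hrc hπ ξ N v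
    have h1 := h.mul_left (rhoVal r hπ 1)⁻¹
    rw [inv_mul_cancel_left₀ (rhoVal_ne_zero hπ 1)] at h1
    refine h1.congr_fun fun t => ?_
    rw [hK.comp hKi sKi ((shiftsP_eQ π).smul _) (sKi.commute _) hv, mul_smul_comm, eQinv_mul_eQ,
      LinearMap.smul_apply, Module.End.one_apply, map_smul, map_smul, map_smul, smul_eq_mul,
      add_zero]
    rw [show -χ (l + 1) μ - (s - t) = t - s - χ (l + 1) μ by ring]

/-- `K(z)⁻¹ K(z) = 1`. -/
lemma Kinv_K_hasSum (hq₀ : 0 < q) (hq₁ : q < 1) (hr : 0 < r) (hrc : 0 < r - c)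
    (hπ : IsRestricted π) (hK : HasModes π K (kField r hπ) (opH π .eQinv) χ)
    (hKi : HasModes π Ki (kinvField r hπ) ((rhoVal r hπ 1)⁻¹ • opH π .eQ)
      fun l μ => -χ (l + 1) μ) (s : ℂ) (v : M) (ξ : Module.Dual ℂ M) :
    HasSum (fun t : ℂ => ξ (Ki t (K (s - t) v))) (if s = 0 then ξ v else 0) := by
  have sK : Shifts π (kField r hπ) 0 := shifts_vertexOp hπ _ _
  refine wt_induction hπ (p := fun v => HasSum (fun t : ℂ => ξ (Ki t (K (s - t) v)))
    (if s = 0 then ξ v else 0)) (by simp) (fun v w hv hw => ?_)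
    (fun a v hv => ?_) (fun l μ v hv => ?_) v
  · simp only [map_add]
    convert hv.add hw using 1
    split_ifs <;> simp
  · simp only [map_smul, smul_eq_mul]
    have h := hv.mul_left a
    rwa [mul_ite, mul_zero] at h
  · have h := hasSum_at (kinvField r hπ) (kField r hπ) (-χ l μ) s ξ v v
      fun N => hasSum_kinv_k hq₀ hq₁ hr hrc hπ ξ N v
    have h1 := h.mul_left (rhoVal r hπ 1)⁻¹
    rw [inv_mul_cancel_left₀ (rhoVal_ne_zero hπ 1)] at h1
    refine h1.congr_fun fun t => ?_
    rw [hKi.comp hK sK (shiftsP_eQinv π) (commute_zeroMode sK _ _) hv, smul_mul_assoc,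
      eQ_mul_eQinv, LinearMap.smul_apply, Module.End.one_apply, map_smul, map_smul, map_smul,
      smul_eq_mul, add_zero, neg_add_cancel_right]
    rw [show χ l μ - (s - t) = t - s - -χ l μ by ring]

/-- `H(z) = κ K(q⁻¹z) K(z)⁻¹ K(qz)`. -/
lemma H_K_hasSum (hq₀ : 0 < q) (hq₁ : q < 1) (hr : 0 < r) (hrc : 0 < r - c)
    (hπ : IsRestricted π) (hK : HasModes π K (kField r hπ) (opH π .eQinv) χ)
    (hKi : HasModes π Ki (kinvField r hπ) ((rhoVal r hπ 1)⁻¹ • opH π .eQ)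
      fun l μ => -χ (l + 1) μ) (hH : HasModes π H (psiField r hπ) (opH π .eQinv) χ)
    (s : ℂ) (v : M) (ξ : Module.Dual ℂ M) :
    HasSum (fun t : ℂ × ℂ => kappa q r c * ((q : ℂ) ^ (-t.1) * (q : ℂ) ^ (s - t.1 - t.2) *
      ξ (K t.1 (Ki t.2 (K (s - t.1 - t.2) v))))) (ξ (H s v)) := by
  have sK : Shifts π (kField r hπ) 0 := shifts_vertexOp hπ _ _
  have sKi : Shifts π (kinvField r hπ) 0 := shifts_vertexOp hπ _ _
  refine wt_induction hπ (p := fun v => HasSum (fun t : ℂ × ℂ => kappa q r c *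
      ((q : ℂ) ^ (-t.1) * (q : ℂ) ^ (s - t.1 - t.2) *
      ξ (K t.1 (Ki t.2 (K (s - t.1 - t.2) v))))) (ξ (H s v))) (by simp)
    (fun v w hv hw => ?_) (fun a v hv => ?_) (fun l μ v hv => ?_) v
  · simp only [map_add, mul_add]
    exact hv.add hw
  · simp only [map_smul, smul_eq_mul]
    exact (hv.mul_left a).congr_fun fun t => by ring
  · have h := (hasSum_at₃ (q := q) (by exact_mod_cast hq₀.ne') (kField r hπ) (kinvField r hπ)
      (psiField r hπ) (χ l μ) s ξ (opH π .eQinv v)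
      fun N => hasSum_k_kinv_k hq₀ hq₁ hr hrc hπ ξ N _).mul_left
      (kappa q r c * (rhoVal r hπ 1)⁻¹)
    have hc : kappa q r c * (rhoVal r hπ 1)⁻¹ * (rhoVal r hπ q ^ 2 / rhoVal r hπ (q ^ 2)) = 1 := by
      have := kappa_eq hq₀ hq₁ hr hrc hπ
      have h1 := rhoVal_ne_zero (r := r) hπ 1
      have h2 := rhoVal_ne_zero (r := r) hπ (q ^ 2)
      field_simp
      exact this
    rw [← mul_assoc, hc, one_mul, ← hH l μ v hv] at h
    refine h.congr_fun fun t => ?_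
    have w := sK.isWt (shiftsP_eQinv π l μ v hv) (χ l μ - (s - t.1 - t.2))
    rw [hK l μ v hv, hK.comp hKi sKi ((shiftsP_eQ π).smul _) (sKi.commute _) w, mul_smul_comm,
      eQinv_mul_eQ, LinearMap.smul_apply, Module.End.one_apply, map_smul, map_smul, map_smul,
      smul_eq_mul]
    simp only [add_zero, neg_add_cancel_right]
    ring

end KCurrents

section EFCurrents
variable {q r c : ℝ} {M : Type*} [AddCommGroup M] [Module ℂ M]
variable {π : Uq q c ⊗[ℂ] Heis →ₐ[ℂ] Module.End ℂ M}
  {E F H : ℂ → Module.End ℂ M} {χ : ℂ → ℂ → ℂ}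

lemma kinv_apply (hπ : IsRestricted π) (hq₀ : 0 < q) {μ : ℂ} {x : M}
    (hx : opU π (gU .h) x = μ • x) : opU π (gU .kinv) x = ((q : ℂ) ^ (-(μ / 2))) • x := by
  have h1 := hπ.qh μ x hx
  have h2 := congrArg (fun f : Module.End ℂ M => f x) (kinv_k_op (π := π))
  simp only [Module.End.mul_apply, Module.End.one_apply, h1, map_smul] at h2
  have hq : (q : ℂ) ≠ 0 := by exact_mod_cast hq₀.ne'
  conv_rhs => rw [← h2, smul_smul, ← Complex.cpow_add _ _ hq, neg_add_cancel, Complex.cpow_zero,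
    one_smul]

/-- The relation of `[E(z₁), F(z₂)]` in terms of the coefficients of `z₁^s z₂^t`. The zero modes
`e^ᾱ e^{-Q}` and `e^{-ᾱ}` anticommute, which turns the anticommutator of `e(z)` and `f(z)` into a
commutator; the factors `q^{±h/2}` supply the remaining powers of `q`. -/
lemma commutator_E_F (hq₀ : 0 < q) (hq₁ : q < 1) (hr : 0 < r) (hrc : 0 < r - c)
    (hπ : IsRestricted π)
    (hE : HasModes π E (eField r hπ) (opH π .eA * opH π .eQinv) fun l _ => -l / (r - c))
    (hF : HasModes π F (fField r hπ) (opH π .eAinv) fun l μ => l / r + μ / (2 * r))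
    (hH : HasModes π H (psiField r hπ) (opH π .eQinv)
      fun l μ => (1 / r - 1 / (r - c)) * l + μ / (2 * r))
    (l : ℂ) (v : M) (hv : opH π .P v = l • v) (n : ℤ) (s t : ℂ) (hs : s = n - l / (r - c)) :
    E s (F t v) - F t (E s v) = (((q : ℂ) - (q : ℂ)⁻¹)⁻¹) •
      (((q : ℂ) ^ ((r - c / 2) * (s + t)) * (q : ℂ) ^ (c / 2 * (s + t)) * (q : ℂ) ^ (-c * s)) •
          H (s + t) v -
        ((q : ℂ) ^ (-(r - c / 2) * (s + t)) * (q : ℂ) ^ (-c / 2 * (s + t)) * (q : ℂ) ^ (c * s)) •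
          H (s + t) v) := by
  have hq : (q : ℂ) ≠ 0 := by exact_mod_cast hq₀.ne'
  have hr0 : (r : ℂ) ≠ 0 := by exact_mod_cast hr.ne'
  have hrc0 : (r : ℂ) - c ≠ 0 := by exact_mod_cast hrc.ne'
  have sE := shifts_eField r hπ
  have sF := shifts_fField r hπ
  have sH : Shifts π (psiField r hπ) 0 := shifts_vertexOp hπ _ _
  have TEF : opH π .eA * opH π .eQinv * opH π .eAinv = -opH π .eQinv := by
    rw [mul_assoc, eQinv_mul_eAinv, mul_neg, ← mul_assoc, eA_mul_eAinv, one_mul]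
  have TFE : opH π .eAinv * (opH π .eA * opH π .eQinv) = opH π .eQinv := by
    rw [← mul_assoc, eAinv_mul_eA, one_mul]
  rw [← sub_eq_zero]
  set a := (q : ℂ) ^ ((r - c / 2) * (s + t)) * (q : ℂ) ^ (c / 2 * (s + t)) * (q : ℂ) ^ (-c * s)
    with ha
  set b := (q : ℂ) ^ (-(r - c / 2) * (s + t)) * (q : ℂ) ^ (-c / 2 * (s + t)) * (q : ℂ) ^ (c * s)
    with hb
  refine eq_zero_of_P_eigenvector hπ (E s * F t - F t * E s -
    ((q : ℂ) - (q : ℂ)⁻¹)⁻¹ • (a • H (s + t) - b • H (s + t))) (fun μ v hv => ?_) hv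
  simp only [LinearMap.sub_apply, LinearMap.smul_apply, Module.End.mul_apply]
  rw [hE.comp hF sF (shiftsP_eAinv π) (fun n => (sF.commute _ n).mul_left (sF.commute _ n)) hv,
    hF.comp hE sE ((shiftsP_eA π).mul (shiftsP_eQinv π)) (sE.commute _) hv, TEF, TFE,
    hH l μ v hv, LinearMap.neg_apply]
  set w := opH π .eQinv v with hw
  have ww : IsWt π (l + -1) μ w := shiftsP_eQinv π l μ v hv
  have e₁ : -(l + 0) / ((r : ℂ) - c) - s = ((-n : ℤ) : ℂ) := by
    push_cast; rw [hs]; ring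
  have e₂ : -l / ((r : ℂ) - c) - s = ((-n : ℤ) : ℂ) := by push_cast; rw [hs]; ring
  have e₃ : (l + (-1 + 0)) / (r : ℂ) + (μ + 2) / (2 * r) - t = l / r + μ / (2 * r) - t := by
    field_simp
    ring
  rw [e₁, e₂, e₃, TField.at_intCast]
  by_cases hk : ∃ k : ℤ, (k : ℂ) = l / r + μ / (2 * r) - t
  · obtain ⟨k, hk⟩ := hk
    have e₄ : (1 / (r : ℂ) - 1 / (r - c)) * l + μ / (2 * r) - (s + t) = ((-n + k : ℤ) : ℂ) := by
      push_cast; rw [hk, hs]; ring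
    rw [← hk, e₄, TField.at_intCast, TField.at_intCast, map_neg, map_neg, ← neg_add',
      anticomm_e_f hq₀ hq₁ hr hrc]
    have wx : IsWt π (l + -1) (μ + 0) (psiField r hπ (-n + k) w) := by
      have := sH.isWt ww ((-n + k : ℤ) : ℂ)
      rwa [TField.at_intCast] at this
    rw [add_zero] at wx
    rw [hπ.qh μ _ wx.2, kinv_apply hπ hq₀ wx.2, smul_smul, smul_smul, smul_smul, smul_smul]
    have hst : s + t = (1 / (r : ℂ) - 1 / (r - c)) * l + μ / (2 * r) + n - k := by
      rw [sub_eq_iff_eq_add] at e₄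
      push_cast at e₄
      linear_combination -e₄
    have ea : ((q ^ c : ℝ) : ℂ) ^ (-n) * ((q ^ r : ℝ) : ℂ) ^ (-(-n + k)) * (q : ℂ) ^ (μ / 2) =
        a := by
      rw [ha, Complex.ofReal_cpow hq₀.le, Complex.ofReal_cpow hq₀.le, ← Complex.cpow_mul_int,
        ← Complex.cpow_mul_int]
      simp only [← Complex.cpow_add _ _ hq]
      congr 1
      rw [hst, hs]
      push_cast
      field_simp
      ring
    have eb : ((q ^ c : ℝ) : ℂ)⁻¹ ^ (-n) *
        ((q ^ r : ℝ) : ℂ)⁻¹ ^ (-(-n + k)) * (q : ℂ) ^ (-(μ / 2)) = b := by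
      rw [hb, Complex.ofReal_cpow hq₀.le, Complex.ofReal_cpow hq₀.le, ← Complex.cpow_neg,
        ← Complex.cpow_neg, ← Complex.cpow_mul_int, ← Complex.cpow_mul_int]
      simp only [← Complex.cpow_add _ _ hq]
      congr 1
      rw [hst, hs]
      push_cast
      field_simp
      ring
    rw [ea, eb, neg_smul, neg_neg, sub_self]
  · have h4 : ¬ ∃ k : ℤ, (k : ℂ) = (1 / (r : ℂ) - 1 / (r - c)) * l + μ / (2 * r) - (s + t) := by
      rintro ⟨k, h4⟩
      exact hk ⟨k + n, by push_cast; rw [h4, hs]; ring⟩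
    rw [TField.at_of_not _ hk, TField.at_of_not _ h4]
    simp

end EFCurrents

section SerreSeries
open PowerSeries
variable {q r c : ℝ}

/-- The structure function `B_*` of the Serre relation for `E` is the series that comes from
moving `u⁺` past `x⁺`. -/
lemma serreCoeff_E (hq₀ : 0 < q) (hq₁ : q < 1) (hr : 0 < r) (hrc : 0 < r - c) :
    (pochCoeff (nome q (r - c)) [nome q (r - c) * q ^ 2, nome q (r - c) / q]
      [nome q (r - c) / q ^ 2, nome q (r - c) * q]).series =
      expSeries fun m => uE q r c m * chargeP q c (-m) := by
  rw [pochCoeff_series (norm_nome_lt hq₀ hq₁ hrc)]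
  refine expSeries_congr fun m hm => ?_
  obtain ⟨s⟩ := scalarForms hq₀ hq₁ hr hrc hm
  obtain ⟨hm', hQ, hR, hS, hδ, hQ2, hR2, hS2, hR2', hS2', hQ3, hQ6⟩ := s.nz
  simp only [List.map_cons, List.map_nil, List.sum_cons, List.sum_nil, add_zero, div_pow,
    mul_pow, pow_right_comm _ _ m, s.q_pow, s.nome'_pow, s.chargeP_neg, s.uE_eq]
  field_simp
  ring

/-- The structure function `B` of the Serre relation for `F` is the series that comes from moving
`u⁻` past `x⁻`. -/
lemma serreCoeff_F (hq₀ : 0 < q) (hq₁ : q < 1) (hr : 0 < r) :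
    (pochCoeff (nome q r) [nome q r / q ^ 2, nome q r * q]
      [nome q r * q ^ 2, nome q r / q]).series =
      expSeries fun m => -(vF q r m * chargeM q m) := by
  rw [pochCoeff_series (norm_nome_lt hq₀ hq₁ hr)]
  refine expSeries_congr fun m hm => ?_
  obtain ⟨s⟩ := scalarForms (c := 0) hq₀ hq₁ hr (by simpa using hr) hm
  obtain ⟨hm', hQ, hR, hS, hδ, hQ2, hR2, hS2, hR2', hS2', hQ3, hQ6⟩ := s.nz
  simp only [List.map_cons, List.map_nil, List.sum_cons, List.sum_nil, add_zero, div_pow,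
    mul_pow, pow_right_comm _ _ m, s.q_pow, s.nome_pow, s.chargeM_pos, s.vF_eq]
  field_simp
  ring

/-- Splitting off the factor `1 - aw` from `(aw; p)_∞ = (1 - aw) (paw; p)_∞`. -/
lemma pochCoeff_series_cons {p : ℂ} (hp : ‖p‖ < 1) (a : ℂ) (N D : List ℂ) :
    (pochCoeff p (a :: N) D).series = (1 - C a * X) * (pochCoeff p (p * a :: N) D).series := by
  rw [pochCoeff_series hp, pochCoeff_series hp, one_sub_eq_expSeries, ← expSeries_commute]
  refine expSeries_congr fun m hm => ?_
  have h1 : 1 - p ^ m ≠ 0 := by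
    intro h
    have h2 := pow_lt_one₀ (norm_nonneg p) hp hm.ne'
    rw [← norm_pow, ← sub_eq_zero.mp h, norm_one] at h2
    exact lt_irrefl _ h2
  have hm' : (m : ℂ) ≠ 0 := by exact_mod_cast hm.ne'
  simp only [List.map_cons, List.sum_cons, mul_pow]
  field_simp
  ring

end SerreSeries

/-! ### The relations of the elliptic algebra -/

section Relations
variable {q r c : ℝ} {M : Type*} [AddCommGroup M] [Module ℂ M]
variable {π : Uq q c ⊗[ℂ] Heis →ₐ[ℂ] Module.End ℂ M}
  {E F K Ki H : ℂ → Module.End ℂ M}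

/-- The currents `E`, `F`, `K`, `K⁻¹`, `H` satisfy the relations of the elliptic algebra. -/
lemma ellipticRelations (hq₀ : 0 < q) (hq₁ : q < 1) (hr : 0 < r) (hrc : 0 < r - c)
    (hπ : IsRestricted π)
    (hE : HasModes π E (eField r hπ) (opH π .eA * opH π .eQinv) fun l _ => -l / (r - c))
    (hF : HasModes π F (fField r hπ) (opH π .eAinv) fun l μ => l / r + μ / (2 * r))
    (hK : HasModes π K (kField r hπ) (opH π .eQinv)
      fun l μ => (1 / r - 1 / (r - c)) * l + μ / (2 * r))
    (hKi : HasModes π Ki (kinvField r hπ) ((rhoVal r hπ 1)⁻¹ • opH π .eQ)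
      fun l μ => -((1 / r - 1 / (r - c)) * (l + 1) + μ / (2 * r)))
    (hH : HasModes π H (psiField r hπ) (opH π .eQinv)
      fun l μ => (1 / r - 1 / (r - c)) * l + μ / (2 * r)) :
    EllipticRelations q r c (opH π .P) E F K Ki H := by
  have hr0 : (r : ℂ) ≠ 0 := by exact_mod_cast hr.ne'
  have hrc0 : (r : ℂ) - c ≠ 0 := by exact_mod_cast hrc.ne'
  have hrc1 : ((r - c : ℝ) : ℂ) = r - c := by push_cast; rfl
  have hrc2 : ((r - c : ℝ) : ℂ) ≠ 0 := by rw [hrc1]; exact hrc0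
  have nr := norm_nome_lt hq₀ hq₁ hr
  have nrc := norm_nome_lt hq₀ hq₁ hrc
  have sE := shifts_eField r hπ
  have sF := shifts_fField r hπ
  have sK : Shifts π (kField r hπ) 0 := shifts_vertexOp hπ _ _
  have pE := (shiftsP_eA π).mul (shiftsP_eQinv π)
  have pF := shiftsP_eAinv π
  have pK := shiftsP_eQinv π
  have cE : ∀ {Y : TField M} {d : ℂ}, Shifts π Y d → ∀ n,
      Commute (opH π .eA * opH π .eQinv) (Y n) := fun h n =>
    (h.commute _ n).mul_left (h.commute _ n)
  constructor
  case smooth_E => exact hE.isSmooth hπ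
  case smooth_F => exact hF.isSmooth hπ
  case smooth_K => exact hK.isSmooth hπ
  case smooth_Kinv => exact hKi.isSmooth hπ
  case K_Kinv => exact K_Kinv_hasSum hq₀ hq₁ hr hrc hπ hK hKi
  case Kinv_K => exact Kinv_K_hasSum hq₀ hq₁ hr hrc hπ hK hKi
  case H_K => exact H_K_hasSum hq₀ hq₁ hr hrc hπ hK hKi hH
  case E_F => exact commutator_E_F hq₀ hq₁ hr hrc hπ hE hF hH
  case K_K =>
    refine ⟨rho_exchange hq₀ hq₁ hr hrc (by rw [hrc1]), fun s t v => ?_⟩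
    have h := exchange_series hπ hK hK sK sK pK pK (sK.commute _) (sK.commute _)
      (one_smul ℂ _).symm (exch_K_K hq₀ hq₁ hr hrc hπ) (γ := 1 / (r - c) - 1 / r)
      (fun l μ => by push_cast; ring) (fun l μ => by push_cast; ring) s t v
    rwa [mul_one] at h
  case K_E =>
    refine ⟨br_exchange hq₀ hrc2 (a := (r - c + 1) / 2) (b := (r - c - 1) / 2)
      (by rw [hrc1]; ring) (by rw [mul_div_cancel₀ _ two_ne_zero, mul_div_cancel₀ _ two_ne_zero])
      (by rw [hrc1]; ring), fun s t v => ?_⟩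
    -- the sign comes from `e^{-Q} e^ᾱ = -e^ᾱ e^{-Q}`
    have h := exchange_series hπ hK hE sK sE pK pE (cE sK) (sE.commute _) (k := -1)
      (by rw [← mul_assoc, eQinv_mul_eA, neg_mul, neg_one_smul]) (exch_K_E hq₀ hq₁ hr hrc hπ)
      (γ := 1 / (r - c))
      (fun l μ => by push_cast; field_simp; ring) (fun l μ => by push_cast; ring) s t v
    rwa [one_mul] at h
  case K_F =>
    refine ⟨br_exchange hq₀ hr0 (a := (r - 1) / 2) (b := (r + 1) / 2)
      (by ring) (by rw [mul_div_cancel₀ _ two_ne_zero, mul_div_cancel₀ _ two_ne_zero])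
      (by ring), fun s t v => ?_⟩
    -- the sign comes from `e^{-Q} e^{-ᾱ} = -e^{-ᾱ} e^{-Q}`
    have h := exchange_series hπ hK hF sK sF pK pF (sK.commute _) (sF.commute _) (k := -1)
      (by rw [eQinv_mul_eAinv, neg_one_smul]) (exch_K_F hq₀ hq₁ hr hrc hπ)
      (γ := -1 / r)
      (fun l μ => by push_cast; field_simp; ring) (fun l μ => by push_cast; ring) s t v
    rwa [one_mul] at h
  case E_E =>
    refine ⟨fun u => ?_, fun s t v => ?_⟩
    · have h := br_exchange₂ hq₀ nrc hrc2 (a := 1) (b := -(1 / 2)) rfl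
        (γ := 1 / (r - c) - 2) (by rw [hrc1]; ring) u
      have e₁ : (q : ℂ) ^ (2 * 1 : ℂ) = (q : ℂ) ^ 2 := by norm_cast
      have e₂ : (q : ℂ) ^ (2 * -(1 / 2) : ℂ) = (q : ℂ)⁻¹ := by
        rw [mul_neg, mul_div_cancel₀ _ two_ne_zero, Complex.cpow_neg_one]
      rwa [e₁, e₂, ← sub_eq_add_neg, sub_neg_eq_add, div_inv_eq_mul] at h
    -- here the sign and the exponent `-2` come from the Drinfeld relation; the zero modes commute
    · have h := exchange_series hπ hE hE sE sE pE pE (cE sE) (cE sE) (k := 1)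
        (one_smul ℂ _).symm (exch_E_E hq₀ hq₁ hr hrc hπ)
        (γ := 1 / (r - c) - 2)
        (fun l μ => by push_cast; ring) (fun l μ => by push_cast; ring) s t v
      rwa [mul_one] at h
  case F_F =>
    refine ⟨fun u => ?_, fun s t v => ?_⟩
    · have h := br_exchange₂ hq₀ nr hr0 (a := -1) (b := 1 / 2) rfl
        (γ := -1 / r - 2) (by ring) u
      have e₁ : (q : ℂ) ^ (2 * -1 : ℂ) = 1 / (q : ℂ) ^ 2 := by
        rw [mul_neg, mul_one, Complex.cpow_neg, one_div]; norm_cast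
      have e₂ : (q : ℂ) ^ (2 * (1 / 2) : ℂ) = (q : ℂ) := by
        rw [mul_div_cancel₀ _ two_ne_zero, Complex.cpow_one]
      rwa [e₁, e₂, ← sub_eq_add_neg, sub_neg_eq_add, div_div_eq_mul_div, div_one] at h
    · have h := exchange_series hπ hF hF sF sF pF pF (sF.commute _) (sF.commute _) (k := 1)
        (one_smul ℂ _).symm (exch_F_F hq₀ hq₁ hr hrc hπ)
        (γ := -1 / r - 2)
        (fun l μ => by push_cast; field_simp; ring) (fun l μ => by push_cast; field_simp; ring)
        s t v
      rwa [mul_one] at h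
  case serre_E =>
    have h := serre_current hπ hE sE pE (cE sE) (δ := 1 / (r - c))
      (fun l μ => by ring) (serre_eField hq₀ hπ)
    rw [pochCoeff_series_cons nrc, serreCoeff_E hq₀ hq₁ hr hrc]
    convert h using 1 <;> ring
  case serre_F =>
    have h := serre_current hπ hF sF pF (sF.commute _) (δ := -1 / r)
      (fun l μ => by field_simp; ring) (serre_fField hq₀ hπ)
    have e : nome q r * (1 / (q : ℂ) ^ 2) = nome q r / q ^ 2 := by ring
    rw [pochCoeff_series_cons nr, e, serreCoeff_F hq₀ hq₁ hr, one_div ((q : ℂ) ^ 2), ← inv_pow]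
    convert h using 1 <;> ring

end Relations

end EllipticA22

end

theorem mainTheorem2 (q r c : ℝ) (hq₀ : 0 < q) (hq₁ : q < 1) (hr : 0 < r) (hrc : 0 < r - c)
    {M : Type*} [AddCommGroup M] [Module ℂ M]
    (π : Uq q c ⊗[ℂ] Heis →ₐ[ℂ] Module.End ℂ M) (hπ : IsRestricted π) :
    ∃ E F K Kinv H : ℂ → Module.End ℂ M,
      -- `E(z) = e(z) e^ᾱ e^{-Q} z^{-P/r^*}`
      IsCurrent π E (eMode r π) (opH π .eA * opH π .eQinv) (fun l _ => -l / (r - c)) ∧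
      -- `F(z) = f(z) e^{-ᾱ} z^{P/r + h/(2r)}`
      IsCurrent π F (fMode r π) (opH π .eAinv) (fun l μ => l / r + μ / (2 * r)) ∧
      -- `K(z) = k(z) e^{-Q} z^{(1/r - 1/r^*) P + h/(2r)}`
      IsCurrent π K (kMode r π) (opH π .eQinv)
        (fun l μ => (1 / r - 1 / (r - c)) * l + μ / (2 * r)) ∧
      -- `H(z) = ψ(z) e^{-Q} z^{(1/r - 1/r^*) P + h/(2r)}`
      IsCurrent π H (psiMode r π) (opH π .eQinv)
        (fun l μ => (1 / r - 1 / (r - c)) * l + μ / (2 * r)) ∧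
      EllipticRelations q r c (opH π .P) E F K Kinv H := by
  obtain ⟨E, hE⟩ := exists_current hπ (eField r hπ) (opH π .eA * opH π .eQinv)
    fun l _ => -l / (r - c)
  obtain ⟨F, hF⟩ := exists_current hπ (fField r hπ) (opH π .eAinv)
    fun l μ => l / r + μ / (2 * r)
  obtain ⟨K, hK⟩ := exists_current hπ (kField r hπ) (opH π .eQinv)
    fun l μ => (1 / r - 1 / (r - c)) * l + μ / (2 * r)
  obtain ⟨Ki, hKi⟩ := exists_current hπ (kinvField r hπ) ((rhoVal r hπ 1)⁻¹ • opH π .eQ)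
    fun l μ => -((1 / r - 1 / (r - c)) * (l + 1) + μ / (2 * r))
  obtain ⟨H, hH⟩ := exists_current hπ (psiField r hπ) (opH π .eQinv)
    fun l μ => (1 / r - 1 / (r - c)) * l + μ / (2 * r)
  have hqn : ∀ m : ℕ, 0 < m → qn q (r * m) ≠ 0 := fun m hm => by
    have hx : 0 < r * m := mul_pos hr (by exact_mod_cast hm)
    have h1 := Real.rpow_pos_of_pos hq₀ (r * m)
    have h2 := (one_lt_inv₀ h1).mpr (Real.rpow_lt_one hq₀.le hq₁ hx)
    have h3 := Real.rpow_lt_one hq₀.le hq₁ hx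
    rw [qn_eq hq₀]
    exact div_ne_zero (by linarith) (q_sub_inv_ne hq₀ hq₁)
  exact ⟨E, F, K, Ki, H, HasModes.isCurrent hE (eMode_eq hπ), HasModes.isCurrent hF (fMode_eq hπ),
    HasModes.isCurrent hK (kMode_eq hπ hqn), HasModes.isCurrent hH (psiMode_eq hπ),
    ellipticRelations hq₀ hq₁ hr hrc hπ hE hF hK hKi hH⟩
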